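/- Let $D=\overline{B_1(0)}\subset\mathbb C$. An IFS on $D$ is a finite family $\Phi=\{f_1,\dots,f_n\}$ of maps, each holomorphic in a neighbourhood of $D$, injective on $D$, with $f_i(D)\subseteq D$ and $0<|f_i'|<1$ on $D$ (so $\Phi$ is uniformly contracting). Its attractor is the non-empty compact $K\subseteq D$ with $K=\bigcup_i f_i(K)$. For a word $\eta=\eta_1\cdots\eta_k$ put $f_\eta=f_{\eta_1}\circ\dots\circ f_{\eta_k}$, $c(\eta,x)=-\log|f_\eta'(x)|$, $\theta(\eta,x)=\arg f_\eta'(x)$, and let $\rho=\max_i\sup_D|f_i'|$. We say that $\Phi$ has distortion constant $L$ if $|f_\eta'(x)|\le L|f_\eta'(y)|$ for all words $\eta$ and $x,y\in D$. Four maps with distinct labels, denoted $f_1,f_2,f_3,f_4$, are distinguished, and we consider the conditions: * (S) $f_1(D)\cap f_2(D)=\emptyset$, $f_3(D)\cap f_4(D)=\emptyset$, and for every $k\ge5$ there is $i\in\{1,3\}$ such that $f_i(D),f_{i+1}(D),f_k(D)$ are pairwise disjoint. * (UNI) There are $\tilde C$ and $m,m'>0$ with $|\nabla\log|f_\eta'||\le\tilde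 C$ on $D$ for all words $\eta$, with $m\le|\nabla(\log|f_i'|-\log|f_{i+1}'|)|\le m'$ on $D$ for $i=1,3$, and with $m-2\tilde C\rho>0$. **Model.** Assume (S), and let $\mathbf p=(p_1,\dots,p_n)$ be a strictly positive probability vector. Put $\Psi_1=\Psi_2=\{f_1,f_2\}$, $\Psi_3=\Psi_4=\{f_3,f_4\}$, and for $k\ge5$ let $\Psi_k=\{f_i,f_{i+1},f_k\}$ with an $i$ as in (S). For each $k$ let $\Phi_k\subseteq\Phi$ be of maximal cardinality among the subfamilies that contain $\Psi_k$ and whose members have pairwise disjoint images of $D$ (any choices are allowed). Let $n_i=|\{j: f_i\in\Phi_j\}|$, $q_k=\sum_{f_i\in\Phi_k}p_i/n_i$ and $\tilde p^{(k)}_i=(p_i/n_i)/q_k$ for $f_i\in\Phi_k$. Let $\Omega=\{1,\dots,n\}^{\mathbb N}$ with left shift $\sigma$. For $\omega\in\Omega$ let $X_N^{(\omega)}$ be the set of words $J$ of length $N$ with $f_{J_j}\in\Phi_{\omega_j}$ for all $j$, let $\eta^{(\omega)}(J)=\prod_{j\le N}\tilde p^{(\omega_j)}_{J_j}$, let $\eta^{(\omega)}$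 also denote the product measure $\prod_{j\ge1}\tilde p^{(\omega_j)}$ on infinite words, and let $\mu_\omega$ be its image under $u\mapsto\lim_m f_{u_1}\circ\dots\circ f_{u_m}(0)$. For $s\in\mathbb C$, $\ell\in\mathbb Z$ and $g\in C^1(D)=C^1(D,\mathbb C)$ let $$P_{s,\ell,\omega,N}\,g(x)=\sum_{J\in X_N^{(\omega)}}\eta^{(\omega)}(J)\,e^{2\pi s\,c(J,x)}\,e^{i\ell\theta(J,x)}\,g(f_J(x)).$$ For $B>0$ let $\mathcal C_B$ be the set of real-valued $H\in C^1(D)$ with $H>0$ and $|\nabla H|\le BH$ on $D$. For complex-valued $g$, $|\nabla g|$ is the operator norm of the real Jacobian, and $\|g\|_{C^1}=\|g\|_\infty+\|\nabla g\|_\infty$. **Lemma.** Let $K\subset\mathbb C$ not be contained in a real-analytic curve, i.e. there is no real-analytic $F:U\to\mathbb R$ on an open set $U\supseteq K$ with $F=0$ and $\nabla F\ne0$ at all points of $K$. Let $L\in\mathbb R$. There is $\rho_0>0$, depending only on $K$ and $L$, such that the following holds for every IFS $\Phi$ on $D$ with attractor $K$, with distortion constant $L$, with $\rho<\rho_0$,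 and satisfying (S) and (UNI), for every strictly positive probability vector $\mathbf p$, and for every model as above. There are an integer $N>0$, $A>1$ and $0<\alpha<1$, and there are $\varepsilon,R>0$, such that for all $s=a+ib$ and $\ell\in\mathbb Z$ with $|a|<\varepsilon$ and $|b|+|\ell|>R$, and for all $\omega\in\Omega$, there is a finite set $\{N^J_{s,\ell}\}_{J\in\mathcal E_{s,\ell,\omega}}$ of bounded linear operators on $(C^1(D),\|\cdot\|_{C^1})$ satisfying: 1. Every $N^J_{s,\ell}$ maps $\mathcal C_{A(|b|+|\ell|)}$ into itself. 2. For all $H\in\mathcal C_{A(|b|+|\ell|)}$ and $J\in\mathcal E_{s,\ell,\omega}$, $$\int|N^J_{s,\ell}H|^2\,d\mu_{\sigma^N\omega}\le\alpha\int P_{0,0,\omega,N}(|H|^2)\,d\mu_{\sigma^N\omega}.$$ 3. If $H\in\mathcal C_{A(|b|+|\ell|)}$ and $f\in C^1(D)$ satisfy $|f|\le H$ and $|\nabla f|\le A(|b|+|\ell|)H$ on $D$, then there is $J\in\mathcal E_{s,\ell,\omega}$ such that, on $D$, $$|P_{s,\ell,\omega,N}f|\le N^J_{s,\ell}H\quad\text{and}\quad|\nabla(P_{s,\ell,\omega,N}f)|\le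 A(|b|+|\ell|)\,N^J_{s,\ell}H.$$ -/

import Mathlib

open MeasureTheory Filter Topology

noncomputable section

namespace Dolgopyat

/-! ### The closed unit disc and the space of `C¹` functions on it -/

/-- The closed unit disc. -/
def disc : Set ℂ := Metric.closedBall (0 : ℂ) 1

open Classical in
/-- Extension by zero of a function on the disc. Only its values on the disc are ever used. -/
def ext (g : disc → ℂ) (z : ℂ) : ℂ := if h : z ∈ disc then g ⟨z, h⟩ else 0

theorem ext_of_mem (g : disc → ℂ) {z : ℂ} (h : z ∈ disc) : ext g z = g ⟨z, h⟩ := by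
  simp [ext, h]

/-- `C¹(D)`: the complex valued functions on the closed disc that are continuously differentiable
(over the reals) up to the boundary. -/
def C1D : Submodule ℂ (disc → ℂ) where
  carrier := {g | ContDiffOn ℝ 1 (ext g) disc}
  add_mem' := by
    intro g h hg hh
    exact (hg.add hh).congr fun z hz => by simp [ext_of_mem _ hz]
  zero_mem' := by
    have h0 : ContDiffOn ℝ 1 (fun _ : ℂ => (0 : ℂ)) disc := contDiffOn_const
    exact h0.congr fun z hz => by simp [ext_of_mem _ hz]
  smul_mem' := by
    intro c g hg
    have hc : ContDiffOn ℝ 1 (fun z => c * ext g z) disc := contDiffOn_const.mul hg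
    exact hc.congr fun z hz => by simp [ext_of_mem _ hz]

/-- `|∇ g (x)|`, the operator norm of the real Jacobian of `g` at a point of the disc. -/
def gradNorm (g : disc → ℂ) (x : disc) : ℝ := ‖fderivWithin ℝ (ext g) disc x‖

/-- The norm `‖g‖_∞ + ‖∇ g‖_∞` of `C¹(D)`. -/
def c1Norm (g : C1D) : ℝ := (⨆ x, ‖g.1 x‖) + ⨆ x, gradNorm g.1 x

/-- Boundedness of a linear operator on `C¹(D)` with respect to the `C¹` norm. -/
def IsBoundedOp (T : C1D →ₗ[ℂ] C1D) : Prop := ∃ C : ℝ, ∀ g, c1Norm (T g) ≤ C * c1Norm g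

/-- The cone of all (real) positive `H ∈ C¹(D)` with `|∇ H| ≤ B H` on the disc. -/
def cone (B : ℝ) : Set C1D :=
  {H | ∀ x, (H.1 x).im = 0 ∧ 0 < (H.1 x).re ∧ gradNorm H.1 x ≤ B * (H.1 x).re}

/-- `K` is contained in a real-analytic planar curve, that is, in a one-dimensional real-analytic
submanifold of an open set `U`, given by an equation `F = 0` with `∇ F ≠ 0`. -/
def InAnalyticCurve (K : Set ℂ) : Prop :=
  ∃ (U : Set ℂ) (F : ℂ → ℝ), IsOpen U ∧ K ⊆ U ∧ AnalyticOnNhd ℝ F U ∧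
    ∀ z ∈ K, F z = 0 ∧ fderiv ℝ F z ≠ 0

/-! ### Iterated function systems on the disc -/

/-- A uniformly contracting holomorphic IFS with `n` maps on the closed unit disc. Every map is
holomorphic in a neighbourhood of the closed disc, injective on the disc, maps the disc into
itself, and has derivative of modulus in `(0, 1)` there. (By compactness, the modulus of the
derivative is then bounded away from `0` and `1`.) -/
structure DiscIFS (n : ℕ) where
  map : Fin n → ℂ → ℂ
  analytic : ∀ i, AnalyticOnNhd ℂ (map i) disc
  injOn : ∀ i, Set.InjOn (map i) disc
  mapsTo : ∀ i, Set.MapsTo (map i) disc disc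
  deriv_ne_zero : ∀ i, ∀ x ∈ disc, deriv (map i) x ≠ 0
  norm_deriv_lt_one : ∀ i, ∀ x ∈ disc, ‖deriv (map i) x‖ < 1

namespace DiscIFS

variable {n : ℕ}

/-- `f_η = f_{η₁} ∘ ⋯ ∘ f_{η_k}` for a finite word `η = η₁ ⋯ η_k`. -/
def word (Φ : DiscIFS n) : List (Fin n) → ℂ → ℂ
  | [] => id
  | i :: η => Φ.map i ∘ Φ.word η

/-- `K` is the attractor: a non-empty compact subset of the disc with `K = ⋃ f_i (K)`. -/
def IsAttractor (Φ : DiscIFS n) (K : Set ℂ) : Prop :=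
  IsCompact K ∧ K.Nonempty ∧ K ⊆ disc ∧ K = ⋃ i, Φ.map i '' K

/-- Bounded distortion with constant `L`: `|f_η'(x)| ≤ L |f_η'(y)|` for all words `η` and all
`x, y` in the disc. -/
def HasDistortion (Φ : DiscIFS n) (L : ℝ) : Prop :=
  ∀ η : List (Fin n), ∀ x ∈ disc, ∀ y ∈ disc,
    ‖deriv (Φ.word η) x‖ ≤ L * ‖deriv (Φ.word η) y‖

/-- The contraction rate `ρ = max_i ‖f_i'‖_∞`. -/
def rate (Φ : DiscIFS n) : ℝ := ⨆ i : Fin n, ⨆ x : disc, ‖deriv (Φ.map i) x‖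

/-- The sets `f_i (D)`, `i ∈ T`, are pairwise disjoint. -/
def DisjointImages (Φ : DiscIFS n) (T : Finset (Fin n)) : Prop :=
  ∀ i ∈ T, ∀ j ∈ T, i ≠ j → Disjoint (Φ.map i '' disc) (Φ.map j '' disc)

/-- The separation property of the four distinguished maps `f₁, f₂, f₃, f₄`, whose labels are
`e 0, e 1, e 2, e 3`. -/
def Separated (Φ : DiscIFS n) (e : Fin 4 ↪ Fin n) : Prop :=
  Φ.DisjointImages {e 0, e 1} ∧ Φ.DisjointImages {e 2, e 3} ∧
  ∀ k, k ∉ Set.range e → Φ.DisjointImages {e 0, e 1, k} ∨ Φ.DisjointImages {e 2, e 3, k}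

/-- `m ≤ |∇ (log |f_i'| - log |f_j'|)| ≤ m'` on the disc. -/
def UNIPair (Φ : DiscIFS n) (i j : Fin n) (m m' : ℝ) : Prop :=
  ∀ x ∈ disc,
    m ≤ ‖fderiv ℝ (fun z => Real.log ‖deriv (Φ.map i) z‖ - Real.log ‖deriv (Φ.map j) z‖) x‖ ∧
    ‖fderiv ℝ (fun z => Real.log ‖deriv (Φ.map i) z‖ - Real.log ‖deriv (Φ.map j) z‖) x‖ ≤ m'

/-- The uniform non-integrability property of the four distinguished maps. Here `Ct` bounds
`|∇ log |f_η'||` on the disc, uniformly in the word `η`. -/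
def UNI (Φ : DiscIFS n) (e : Fin 4 ↪ Fin n) : Prop :=
  ∃ Ct m m' : ℝ, 0 < m ∧
    (∀ η : List (Fin n), ∀ x ∈ disc,
      ‖fderiv ℝ (fun z => Real.log ‖deriv (Φ.word η) z‖) x‖ ≤ Ct) ∧
    Φ.UNIPair (e 0) (e 1) m m' ∧ Φ.UNIPair (e 2) (e 3) m m' ∧
    0 < m - 2 * Ct * Φ.rate

/-! ### The random model -/

/-- `T` is a set of labels of maximal cardinality among those that contain `Ψ` and whose maps have
pairwise disjoint images of the disc. -/
def IsMaxDisjoint (Φ : DiscIFS n) (Ψ T : Finset (Fin n)) : Prop :=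
  Ψ ⊆ T ∧ Φ.DisjointImages T ∧
    ∀ T' : Finset (Fin n), Ψ ⊆ T' → Φ.DisjointImages T' → T'.card ≤ T.card

/-- The family of sub-IFSs `Φ_k = {f_i : i ∈ S k}`, `k = 1, …, n`, of the model: `Φ_k` is maximal
over `Ψ_k`, where `Ψ_k = {f₁, f₂}` for `k = 1, 2`, where `Ψ_k = {f₃, f₄}` for `k = 3, 4`, and where
`Ψ_k` is `{f₁, f₂, f_k}` or `{f₃, f₄, f_k}` for every other `k`. -/
def IsModelFamily (Φ : DiscIFS n) (e : Fin 4 ↪ Fin n) (S : Fin n → Finset (Fin n)) : Prop :=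
  Φ.IsMaxDisjoint {e 0, e 1} (S (e 0)) ∧ Φ.IsMaxDisjoint {e 0, e 1} (S (e 1)) ∧
  Φ.IsMaxDisjoint {e 2, e 3} (S (e 2)) ∧ Φ.IsMaxDisjoint {e 2, e 3} (S (e 3)) ∧
  ∀ k, k ∉ Set.range e →
    Φ.IsMaxDisjoint {e 0, e 1, k} (S k) ∨ Φ.IsMaxDisjoint {e 2, e 3, k} (S k)

end DiscIFS

section Weights

variable {n : ℕ} (p : Fin n → ℝ) (S : Fin n → Finset (Fin n))

/-- `n_i`, the number of sub-IFSs that contain `f_i`. -/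
def multiplicity (i : Fin n) : ℕ := (Finset.univ.filter fun j => i ∈ S j).card

/-- `q_k`, the probability that the selection measure gives to the `k`-th sub-IFS. -/
def selWeight (k : Fin n) : ℝ := ∑ i ∈ S k, p i / multiplicity S i

/-- The probability vector on the `k`-th sub-IFS, extended by zero to all labels. -/
def branchWeight (k i : Fin n) : ℝ :=
  if i ∈ S k then (p i / multiplicity S i) / selWeight p S k else 0

/-- The probability vector on the `k`-th sub-IFS as a measure. -/
def branchMeasure (k : Fin n) : Measure (Fin n) :=
  ∑ i, ENNReal.ofReal (branchWeight p S k i) • Measure.dirac i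

theorem isProbabilityMeasure_branchMeasure (hp : ∀ i, 0 < p i) (k : Fin n) (hk : (S k).Nonempty) :
    IsProbabilityMeasure (branchMeasure p S k) := by
  have hm : ∀ i ∈ S k, 0 < p i / multiplicity S i := by
    intro i hi
    refine div_pos (hp i) ?_
    have : 0 < multiplicity S i := Finset.card_pos.2 ⟨k, by simp [hi]⟩
    exact_mod_cast this
  have hq : 0 < selWeight p S k := Finset.sum_pos hm hk
  have hnn : ∀ i, 0 ≤ branchWeight p S k i := by
    intro i
    unfold branchWeight
    split_ifs with h
    · exact (div_pos (hm i h) hq).le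
    · exact le_rfl
  have hs : ∑ i, branchWeight p S k i = 1 := by
    unfold branchWeight
    rw [Finset.sum_ite_mem, Finset.univ_inter, ← Finset.sum_div]
    exact div_self hq.ne'
  constructor
  simp only [branchMeasure, Measure.coe_finsetSum, Finset.sum_apply, Measure.smul_apply,
    measure_univ, smul_eq_mul, mul_one]
  rw [← ENNReal.ofReal_sum_of_nonneg fun i _ => hnn i, hs, ENNReal.ofReal_one]

/-- The product measure `η^(ω)` on infinite words. It is carried by the words `u` with
`u j ∈ S (ω j)` for every `j`. -/
def pathMeasure (ω : ℕ → Fin n) : Measure (ℕ → Fin n) :=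
  Measure.infinitePi fun j => branchMeasure p S (ω j)

/-- `X_N^(ω)`: the words of length `N` whose `j`-th letter belongs to the `ω_j`-th sub-IFS. -/
def words (N : ℕ) (ω : ℕ → Fin n) : Finset (Fin N → Fin n) :=
  Fintype.piFinset fun j : Fin N => S (ω j)

/-- `η^(ω) (J)` for a finite word `J`. -/
def wordWeight {N : ℕ} (ω : ℕ → Fin n) (J : Fin N → Fin n) : ℝ :=
  ∏ j : Fin N, branchWeight p S (ω j) (J j)

end Weights

/-- The iterated shift `σ^N` on the parameter space. -/
def shift {n : ℕ} (N : ℕ) (ω : ℕ → Fin n) : ℕ → Fin n := fun j => ω (j + N)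

namespace DiscIFS

variable {n : ℕ}

/-- The coding map: the limit of `f_{u_1} ∘ ⋯ ∘ f_{u_m} (0)` as `m → ∞`. -/
def coding (Φ : DiscIFS n) (u : ℕ → Fin n) : ℂ :=
  limUnder atTop fun m : ℕ => Φ.word (List.ofFn fun j : Fin m => u j) 0

/-- The random measure `μ_ω`, the image of `η^(ω)` under the coding map. -/
def randomMeasure (Φ : DiscIFS n) (p : Fin n → ℝ) (S : Fin n → Finset (Fin n)) (ω : ℕ → Fin n) :
    Measure ℂ :=
  (pathMeasure p S ω).map Φ.coding

/-- The norm cocycle `c(η, x) = - log |f_η'(x)|`. -/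
def normCocycle (Φ : DiscIFS n) (η : List (Fin n)) (x : ℂ) : ℝ := - Real.log ‖deriv (Φ.word η) x‖

/-- The angle cocycle `θ(η, x) = arg f_η'(x)`. -/
def angleCocycle (Φ : DiscIFS n) (η : List (Fin n)) (x : ℂ) : ℝ :=
  Complex.arg (deriv (Φ.word η) x)

/-- The random transfer operator `P_{s,ℓ,ω,N}`, at `g` and `x`:
the sum over `J ∈ X_N^(ω)` of `η^(ω)(J) e^{2π s c(J,x)} (e^{iθ(J,x)})^ℓ g (f_J x)`. -/
def transferFun (Φ : DiscIFS n) (p : Fin n → ℝ) (S : Fin n → Finset (Fin n))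
    (s : ℂ) (ℓ : ℤ) (ω : ℕ → Fin n) (N : ℕ) (g : disc → ℂ) (x : disc) : ℂ :=
  ∑ J ∈ words S N ω,
    (wordWeight p S ω J : ℂ) *
      Complex.exp (2 * Real.pi * s * (Φ.normCocycle (List.ofFn J) x : ℂ)) *
      Complex.exp (Complex.I * (Φ.angleCocycle (List.ofFn J) x : ℂ)) ^ ℓ *
      ext g (Φ.word (List.ofFn J) x)

theorem word_mapsTo (Φ : DiscIFS n) (η : List (Fin n)) : Set.MapsTo (Φ.word η) disc disc := by
  induction η with
  | nil => exact Set.mapsTo_id _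
  | cons i η ih => exact (Φ.mapsTo i).comp ih

theorem word_analytic (Φ : DiscIFS n) (η : List (Fin n)) :
    AnalyticOnNhd ℂ (Φ.word η) disc := by
  induction η with
  | nil => exact analyticOnNhd_id
  | cons i η ih => exact (Φ.analytic i).comp ih (Φ.word_mapsTo η)

theorem word_deriv_ne_zero (Φ : DiscIFS n) (η : List (Fin n)) :
    ∀ x ∈ disc, deriv (Φ.word η) x ≠ 0 := by
  induction η with
  | nil => intro x _; simp [word]
  | cons i η ih =>
    intro x hx
    have h1 := (Φ.analytic i _ (Φ.word_mapsTo η hx)).differentiableAt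
    have h2 := (Φ.word_analytic η x hx).differentiableAt
    have : deriv (Φ.word (i :: η)) x = deriv (Φ.map i) (Φ.word η x) * deriv (Φ.word η) x :=
      deriv_comp x h1 h2
    rw [this]
    exact mul_ne_zero (Φ.deriv_ne_zero i _ (Φ.word_mapsTo η hx)) (ih x hx)

/-- The random transfer operator preserves `C¹(D)`. -/
theorem transferFun_mem (Φ : DiscIFS n) (p : Fin n → ℝ) (S : Fin n → Finset (Fin n))
    (s : ℂ) (ℓ : ℤ) (ω : ℕ → Fin n) (N : ℕ) (g : C1D) :
    Φ.transferFun p S s ℓ ω N g.1 ∈ C1D := by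
  have hsum : ContDiffOn ℝ 1 (fun z => ∑ J ∈ words S N ω,
      (wordWeight p S ω J : ℂ) *
      Complex.exp (2 * Real.pi * s * ((- Real.log ‖deriv (Φ.word (List.ofFn J)) z‖ : ℝ) : ℂ)) *
      (deriv (Φ.word (List.ofFn J)) z / ((‖deriv (Φ.word (List.ofFn J)) z‖ : ℝ) : ℂ)) ^ ℓ *
      ext g.1 (Φ.word (List.ofFn J) z)) disc := by
    refine ContDiffOn.sum fun J _ => ?_
    set η := List.ofFn J
    have hd : ContDiffOn ℝ 1 (deriv (Φ.word η)) disc := fun z hz =>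
      (((Φ.word_analytic η).deriv z hz).contDiffAt.restrict_scalars ℝ).contDiffWithinAt
    have hn : ContDiffOn ℝ 1 (fun z => ‖deriv (Φ.word η) z‖) disc :=
      hd.norm ℝ (Φ.word_deriv_ne_zero η)
    have hn0 : ∀ z ∈ disc, ‖deriv (Φ.word η) z‖ ≠ 0 := fun z hz =>
      norm_ne_zero_iff.2 (Φ.word_deriv_ne_zero η z hz)
    have hl : ContDiffOn ℝ 1 (fun z => ((- Real.log ‖deriv (Φ.word η) z‖ : ℝ) : ℂ)) disc :=
      Complex.ofRealCLM.contDiff.comp_contDiffOn (hn.log hn0).neg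
    have hnc : ContDiffOn ℝ 1 (fun z => ((‖deriv (Φ.word η) z‖ : ℝ) : ℂ)) disc :=
      Complex.ofRealCLM.contDiff.comp_contDiffOn hn
    have hw : ContDiffOn ℝ 1 (Φ.word η) disc := fun z hz =>
      ((Φ.word_analytic η z hz).contDiffAt.restrict_scalars ℝ).contDiffWithinAt
    have hg : ContDiffOn ℝ 1 (fun z => ext g.1 (Φ.word η z)) disc :=
      ContDiffOn.comp (g := ext g.1) g.2 hw (Φ.word_mapsTo η)
    have hu : ContDiffOn ℝ 1
        (fun z => deriv (Φ.word η) z / ((‖deriv (Φ.word η) z‖ : ℝ) : ℂ)) disc := by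
      refine (hd.mul (hnc.inv ?_)).congr fun z _ => div_eq_mul_inv _ _
      intro z hz
      exact_mod_cast hn0 z hz
    have hu0 : ∀ z ∈ disc, deriv (Φ.word η) z / ((‖deriv (Φ.word η) z‖ : ℝ) : ℂ) ≠ 0 :=
      fun z hz => div_ne_zero (Φ.word_deriv_ne_zero η z hz) (by exact_mod_cast hn0 z hz)
    have hz : ContDiffOn ℝ 1
        (fun z => (deriv (Φ.word η) z / ((‖deriv (Φ.word η) z‖ : ℝ) : ℂ)) ^ ℓ) disc := by
      cases ℓ with
      | ofNat k => simpa using hu.pow k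
      | negSucc k =>
        simp only [zpow_negSucc]
        exact (hu.pow (k + 1)).inv fun z hz => pow_ne_zero _ (hu0 z hz)
    exact ((contDiffOn_const.mul (contDiffOn_const.mul hl).cexp).mul hz).mul hg
  refine hsum.congr fun z hz => ?_
  rw [ext_of_mem _ hz]
  refine Finset.sum_congr rfl fun J _ => ?_
  have h0 := Φ.word_deriv_ne_zero (List.ofFn J) z hz
  have hn : ((‖deriv (Φ.word (List.ofFn J)) z‖ : ℝ) : ℂ) ≠ 0 := by
    exact_mod_cast norm_ne_zero_iff.2 h0
  have : Complex.exp (Complex.I * (Complex.arg (deriv (Φ.word (List.ofFn J)) z) : ℂ)) =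
      deriv (Φ.word (List.ofFn J)) z / ((‖deriv (Φ.word (List.ofFn J)) z‖ : ℝ) : ℂ) := by
    rw [eq_div_iff hn, mul_comm, mul_comm Complex.I]
    exact Complex.norm_mul_exp_arg_mul_I _
  simp only [normCocycle, angleCocycle, this]

/-- The random transfer operator `P_{s,ℓ,ω,N} : C¹(D) → C¹(D)`. -/
def transfer (Φ : DiscIFS n) (p : Fin n → ℝ) (S : Fin n → Finset (Fin n))
    (s : ℂ) (ℓ : ℤ) (ω : ℕ → Fin n) (N : ℕ) (g : C1D) : C1D :=
  ⟨Φ.transferFun p S s ℓ ω N g.1, Φ.transferFun_mem p S s ℓ ω N g⟩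

end DiscIFS

end Dolgopyat

end

noncomputable section

namespace Dolgopyat

/-! ### The disc -/

/-! This is Dolgopyat's method, uniform over a random sequence of sub-systems. Write B = |b| + |ℓ|.
Each branch of the transfer operator has an amplitude, which depends on `a` only, and a phase. With
a holomorphic logarithm of f_η' the phase is Re(ζ log f_η') for the single frequency ζ = -2πb - iℓ,
whose size is comparable to B; so the norm and the angle cocycles are treated together. For two
words of length N that differ only in the last letter, (UNI) bounds the derivative of the difference
h of the logarithms from below (`le_norm_deriv_wordLog_sub`). Hence the relative phase Re(ζh) has a
gradient of size about B, in a direction that depends on ζ and on the point.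

Cancellation can be exploited only if the fractal extends in that direction. This is
`exists_nonconcentration`, a compactness argument: if images of K under holomorphic maps with
distortion L could be arbitrarily thin relative to their size, a limit would be a holomorphic
function without critical points whose real part is constant on K, and K would lie in an analytic
curve. The resulting width κ depends on K and L only. By maximality the first-level images of any
sub-system of the model come within 4ρ of every point of K, so for ρ small against κ the sub-systems
inherit the width (`exists_letters`). This determines ρ₀.

A cylinder of size r ≈ 1/B therefore contains two sub-cylinders between which the relative phase
changes by an amount that is bounded below and at most 1. The two branches cannot be almost aligned
near both, so near one of them one branch can be damped by a definite factor
(`exists_damped_subcylinder`). The Dolgopyat operators multiply the two branches by 1 - τ times a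
sum of bumps centred on a grid of mesh comparable to 1/B. The functions f and H influence only which
grid points are used, so the family is finite.

The bumps have gradient O(τB), and the contraction of the words keeps the cone invariant. For the L²
bound, a pointwise Cauchy-Schwarz inequality gains on each damped sub-cylinder. Self-similarity of
the measures bounds the relative mass of that sub-cylinder from below, uniformly in ω, and P(H²)
varies by at most a factor 2 on the cylinder. Summation over a stopping-time decomposition
(`average_le_of_cylinders`) gives `integral_dampedOp_le`. The order in which the constants are fixed
is settled in `exists_dolgopyat_constants`. -/

theorem convex_disc : Convex ℝ disc := convex_closedBall _ _

theorem isCompact_disc : IsCompact disc := isCompact_closedBall _ _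

theorem zero_mem_disc : (0 : ℂ) ∈ disc := by simp [disc]

theorem norm_le_one_of_mem_disc {x : ℂ} (hx : x ∈ disc) : ‖x‖ ≤ 1 := by simpa [disc] using hx

theorem norm_sub_le_two_of_mem_disc {x y : ℂ} (hx : x ∈ disc) (hy : y ∈ disc) : ‖x - y‖ ≤ 2 := by
  have := norm_sub_le x y
  linarith [norm_le_one_of_mem_disc hx, norm_le_one_of_mem_disc hy]

theorem uniqueDiffOn_disc : UniqueDiffOn ℝ disc := by
  refine uniqueDiffOn_convex convex_disc ⟨0, ?_⟩
  rw [mem_interior_iff_mem_nhds]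
  exact Metric.closedBall_mem_nhds _ one_pos

instance : CompactSpace disc := isCompact_iff_compactSpace.1 isCompact_disc

instance : Nonempty disc := ⟨⟨0, zero_mem_disc⟩⟩

theorem norm_image_sub_le_of_norm_deriv_le_disc {f : ℂ → ℂ} (hf : AnalyticOnNhd ℂ f disc) {C : ℝ}
    (hC : ∀ x ∈ disc, ‖deriv f x‖ ≤ C) {x y : ℂ} (hx : x ∈ disc) (hy : y ∈ disc) :
    ‖f x - f y‖ ≤ C * ‖x - y‖ :=
  convex_disc.norm_image_sub_le_of_norm_deriv_le (fun z hz => (hf z hz).differentiableAt) hC hy hx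

/-- A non-vanishing holomorphic function near the closed disc has a holomorphic logarithm. -/
theorem exists_analytic_log {q : ℂ → ℂ} (hq : AnalyticOnNhd ℂ q disc) (h0 : ∀ x ∈ disc, q x ≠ 0) :
    ∃ h : ℂ → ℂ, AnalyticOnNhd ℂ h disc ∧ ∀ x ∈ disc, ∀ᶠ z in 𝓝 x, Complex.exp (h z) = q z := by
  have hU : IsOpen {z | AnalyticAt ℂ q z ∧ q z ≠ 0} := by
    rw [isOpen_iff_mem_nhds]
    rintro z ⟨hz, hz0⟩
    exact hz.eventually_analyticAt.and (hz.continuousAt.eventually_ne hz0)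
  -- Enlarging the disc to a slightly larger open ball gives a convex domain on which the
  -- logarithmic derivative of `q` has a primitive.
  obtain ⟨δ, hδ, hsub⟩ := isCompact_disc.exists_thickening_subset_open hU
    (fun z hz => ⟨hq z hz, h0 z hz⟩)
  rw [disc, thickening_closedBall hδ zero_le_one] at hsub
  set V := Metric.ball (0 : ℂ) (δ + 1)
  have hdisc : disc ⊆ V := Metric.closedBall_subset_ball (by linarith)
  have hd : DifferentiableOn ℂ (fun z => deriv q z / q z) V := fun z hz =>
    ((hsub hz).1.deriv.differentiableAt.div (hsub hz).1.differentiableAt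
      (hsub hz).2).differentiableWithinAt
  obtain ⟨h, hh0, hh⟩ := hd.isExactOn_ball.with_val_at 0 (Complex.log (q 0))
  have key : ∀ z ∈ V, Complex.exp (h z) = q z := by
    have hder : ∀ z ∈ V, HasDerivAt (fun z => Complex.exp (-h z) * q z) 0 z := by
      intro z hz
      have h1 := ((hh z hz).neg.cexp).mul (hsub hz).1.differentiableAt.hasDerivAt
      refine HasDerivAt.congr_deriv h1 ?_
      have := (hsub hz).2
      field_simp
      ring
    have hconst : ∀ z ∈ V, Complex.exp (-h z) * q z = 1 := by
      intro z hz
      have h00 : (0 : ℂ) ∈ V := hdisc zero_mem_disc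
      have := (convex_ball (0 : ℂ) (δ + 1)).norm_image_sub_le_of_norm_hasDerivWithin_le (𝕜 := ℂ)
        (C := 0) (fun w hw => (hder w hw).hasDerivWithinAt) (by simp) h00 hz
      simp only [zero_mul, norm_le_zero_iff, sub_eq_zero] at this
      rw [this, hh0, Complex.exp_neg, Complex.exp_log (hsub h00).2,
        inv_mul_cancel₀ (hsub h00).2]
    intro z hz
    have := hconst z hz
    rw [Complex.exp_neg, inv_mul_eq_one₀ (Complex.exp_ne_zero _)] at this
    exact this
  refine ⟨h, fun z hz => ?_, fun x hx => ?_⟩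
  · have : DifferentiableOn ℂ h V := fun w hw => (hh w hw).differentiableAt.differentiableWithinAt
    exact this.analyticAt (Metric.isOpen_ball.mem_nhds (hdisc hz))
  · exact eventually_of_mem (Metric.isOpen_ball.mem_nhds (hdisc hx)) key

namespace DiscIFS

variable {n : ℕ} (Φ : DiscIFS n)

/-! ### Words -/

theorem word_append (η ξ : List (Fin n)) : Φ.word (η ++ ξ) = Φ.word η ∘ Φ.word ξ := by
  induction η with
  | nil => rfl
  | cons i η ih => rw [List.cons_append, word, word, ih, Function.comp_assoc]

theorem word_append_apply (η ξ : List (Fin n)) (x : ℂ) :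
    Φ.word (η ++ ξ) x = Φ.word η (Φ.word ξ x) := by rw [word_append]; rfl

theorem word_singleton (i : Fin n) : Φ.word [i] = Φ.map i := rfl

theorem differentiableAt_word (η : List (Fin n)) {x : ℂ} (hx : x ∈ disc) :
    DifferentiableAt ℂ (Φ.word η) x := (Φ.word_analytic η x hx).differentiableAt

theorem continuousOn_word (η : List (Fin n)) : ContinuousOn (Φ.word η) disc :=
  (Φ.word_analytic η).continuousOn

theorem deriv_word_append (η ξ : List (Fin n)) {x : ℂ} (hx : x ∈ disc) :
    deriv (Φ.word (η ++ ξ)) x = deriv (Φ.word η) (Φ.word ξ x) * deriv (Φ.word ξ) x := by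
  rw [word_append]
  exact deriv_comp x (Φ.differentiableAt_word η (Φ.word_mapsTo ξ hx))
    (Φ.differentiableAt_word ξ hx)

theorem bddAbove_norm_deriv_map (i : Fin n) :
    BddAbove (Set.range fun x : disc => ‖deriv (Φ.map i) x‖) :=
  ⟨1, by rintro _ ⟨x, rfl⟩; exact (Φ.norm_deriv_lt_one i x x.2).le⟩

theorem norm_deriv_map_le_rate (i : Fin n) {x : ℂ} (hx : x ∈ disc) :
    ‖deriv (Φ.map i) x‖ ≤ Φ.rate :=
  (le_ciSup (Φ.bddAbove_norm_deriv_map i) ⟨x, hx⟩).trans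
    (le_ciSup (f := fun i => ⨆ x : disc, ‖deriv (Φ.map i) x‖) (Set.finite_range _).bddAbove i)

theorem rate_nonneg : 0 ≤ Φ.rate :=
  Real.iSup_nonneg fun _ => Real.iSup_nonneg fun _ => norm_nonneg _

/-- Each supremum over the compact disc is attained, and there are finitely many maps. -/
theorem rate_lt_one : Φ.rate < 1 := by
  have h : ∀ i, (⨆ x : disc, ‖deriv (Φ.map i) x‖) < 1 := by
    intro i
    have hc : Continuous fun x : disc => ‖deriv (Φ.map i) x‖ :=
      (((Φ.analytic i).deriv.continuousOn).domRestrict).norm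
    obtain ⟨x, hx⟩ := hc.exists_forall_ge_of_hasCompactSupport (HasCompactSupport.of_compactSpace _)
    exact (ciSup_le hx).trans_lt (Φ.norm_deriv_lt_one i x x.2)
  rcases isEmpty_or_nonempty (Fin n) with hn | hn
  · simp [rate]
  · obtain ⟨i, hi⟩ := exists_eq_ciSup_of_finite (f := fun i => ⨆ x : disc, ‖deriv (Φ.map i) x‖)
    rw [rate, ← hi]
    exact h i

theorem norm_deriv_word_le (η : List (Fin n)) {x : ℂ} (hx : x ∈ disc) :
    ‖deriv (Φ.word η) x‖ ≤ Φ.rate ^ η.length := by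
  induction η with
  | nil => simp [word]
  | cons i η ih =>
    rw [← List.singleton_append, Φ.deriv_word_append _ _ hx, norm_mul, List.length_append,
      List.length_singleton, pow_add, pow_one]
    exact mul_le_mul (Φ.norm_deriv_map_le_rate i (Φ.word_mapsTo η hx)) ih (norm_nonneg _)
      Φ.rate_nonneg

theorem norm_word_sub_le (η : List (Fin n)) {x y : ℂ} (hx : x ∈ disc) (hy : y ∈ disc) :
    ‖Φ.word η x - Φ.word η y‖ ≤ Φ.rate ^ η.length * ‖x - y‖ :=
  norm_image_sub_le_of_norm_deriv_le_disc (Φ.word_analytic η)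
    (fun _ hz => Φ.norm_deriv_word_le η hz) hx hy

theorem norm_word_sub_le_of_hasDistortion {L : ℝ} (hL : Φ.HasDistortion L) (η : List (Fin n))
    {x y : ℂ} (hx : x ∈ disc) (hy : y ∈ disc) :
    ‖Φ.word η x - Φ.word η y‖ ≤ L * ‖deriv (Φ.word η) 0‖ * ‖x - y‖ :=
  norm_image_sub_le_of_norm_deriv_le_disc (Φ.word_analytic η)
    (fun z hz => hL η z hz 0 zero_mem_disc) hx hy

/-- The empty word has derivative 1. -/
theorem one_le_of_hasDistortion {L : ℝ} (hL : Φ.HasDistortion L) : 1 ≤ L := by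
  simpa [word] using hL [] 0 zero_mem_disc 0 zero_mem_disc

/-- A positive lower bound for the derivatives of all maps of the system. -/
theorem exists_le_norm_deriv_map :
    ∃ κ : ℝ, 0 < κ ∧ ∀ i, ∀ x ∈ disc, κ ≤ ‖deriv (Φ.map i) x‖ := by
  have h : ∀ i, ∃ κ : ℝ, 0 < κ ∧ ∀ x ∈ disc, κ ≤ ‖deriv (Φ.map i) x‖ := by
    intro i
    obtain ⟨x, hx, hmin⟩ := isCompact_disc.exists_isMinOn ⟨0, zero_mem_disc⟩
      ((Φ.analytic i).deriv.continuousOn.norm)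
    exact ⟨_, norm_pos_iff.2 (Φ.deriv_ne_zero i x hx), fun y hy => hmin hy⟩
  choose κ hκ hle using h
  rcases isEmpty_or_nonempty (Fin n) with hn | hn
  · exact ⟨1, one_pos, fun i => hn.elim i⟩
  · refine ⟨Finset.univ.inf' Finset.univ_nonempty κ, ?_, fun i x hx => ?_⟩
    · simpa [Finset.lt_inf'_iff] using hκ
    · exact (Finset.inf'_le κ (Finset.mem_univ i)).trans (hle i x hx)

/-! ### Logarithms of derivatives -/

/-- A holomorphic logarithm of `f_η'` near the disc. -/
def wordLog (η : List (Fin n)) : ℂ → ℂ :=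
  (exists_analytic_log (Φ.word_analytic η).deriv (Φ.word_deriv_ne_zero η)).choose

theorem wordLog_analytic (η : List (Fin n)) : AnalyticOnNhd ℂ (Φ.wordLog η) disc :=
  (exists_analytic_log (Φ.word_analytic η).deriv (Φ.word_deriv_ne_zero η)).choose_spec.1

theorem exp_wordLog_eventually (η : List (Fin n)) {x : ℂ} (hx : x ∈ disc) :
    ∀ᶠ z in 𝓝 x, Complex.exp (Φ.wordLog η z) = deriv (Φ.word η) z :=
  (exists_analytic_log (Φ.word_analytic η).deriv (Φ.word_deriv_ne_zero η)).choose_spec.2 x hx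

theorem exp_wordLog (η : List (Fin n)) {x : ℂ} (hx : x ∈ disc) :
    Complex.exp (Φ.wordLog η x) = deriv (Φ.word η) x :=
  (Φ.exp_wordLog_eventually η hx).self_of_nhds

theorem hasDerivAt_wordLog (η : List (Fin n)) {x : ℂ} (hx : x ∈ disc) :
    HasDerivAt (Φ.wordLog η) (deriv (Φ.wordLog η) x) x :=
  (Φ.wordLog_analytic η x hx).differentiableAt.hasDerivAt

theorem deriv_wordLog (η : List (Fin n)) {x : ℂ} (hx : x ∈ disc) :
    deriv (Φ.wordLog η) x = logDeriv (deriv (Φ.word η)) x := by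
  have h1 := (Φ.hasDerivAt_wordLog η hx).cexp.deriv
  have h2 : deriv (fun z => Complex.exp (Φ.wordLog η z)) x = deriv (deriv (Φ.word η)) x :=
    Filter.EventuallyEq.deriv_eq (Φ.exp_wordLog_eventually η hx)
  rw [logDeriv_apply, ← h2, h1, Φ.exp_wordLog η hx, mul_div_cancel_left₀ _
    (Φ.word_deriv_ne_zero η x hx)]

/-- The logarithms of different words are chosen independently, so they add up only modulo constants
in 2πiℤ; their derivatives are logarithmic derivatives and add up exactly. -/
theorem deriv_wordLog_append (η ξ : List (Fin n)) {x : ℂ} (hx : x ∈ disc) :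
    deriv (Φ.wordLog (η ++ ξ)) x =
      deriv (Φ.wordLog η) (Φ.word ξ x) * deriv (Φ.word ξ) x + deriv (Φ.wordLog ξ) x := by
  have hξ := Φ.word_mapsTo ξ hx
  have hev : deriv (Φ.word (η ++ ξ)) =ᶠ[𝓝 x]
      fun z => (deriv (Φ.word η) ∘ Φ.word ξ) z * deriv (Φ.word ξ) z := by
    have h1 : ∀ᶠ z in 𝓝 x, AnalyticAt ℂ (Φ.word ξ) z :=
      (Φ.word_analytic ξ x hx).eventually_analyticAt
    have h2 : ∀ᶠ z in 𝓝 x, AnalyticAt ℂ (Φ.word η) (Φ.word ξ z) :=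
      (Φ.word_analytic ξ x hx).continuousAt.eventually
        (Φ.word_analytic η _ hξ).eventually_analyticAt
    filter_upwards [h1, h2] with z h1 h2
    rw [word_append]
    exact deriv_comp z h2.differentiableAt h1.differentiableAt
  have hA := (Φ.word_analytic η _ hξ).deriv.differentiableAt
  have hB := Φ.differentiableAt_word ξ hx
  rw [Φ.deriv_wordLog _ hx, Φ.deriv_wordLog _ hξ, Φ.deriv_wordLog _ hx, 
    (logDeriv_congr_nhds hev).self_of_nhds, logDeriv_mul, logDeriv_comp hA hB]
  · exact Φ.word_deriv_ne_zero η _ hξ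
  · exact Φ.word_deriv_ne_zero ξ x hx
  · exact hA.comp x hB
  · exact (Φ.word_analytic ξ x hx).deriv.differentiableAt

theorem log_norm_deriv_word (η : List (Fin n)) {x : ℂ} (hx : x ∈ disc) :
    Real.log ‖deriv (Φ.word η) x‖ = (Φ.wordLog η x).re := by
  rw [← Φ.exp_wordLog η hx, Complex.norm_exp, Real.log_exp]

/-- The principal argument jumps, but only its exponential enters the operator, and that depends on
the angle modulo 2π. The smooth imaginary part of the logarithm may replace it. -/
theorem exp_arg_deriv_word (η : List (Fin n)) {x : ℂ} (hx : x ∈ disc) :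
    Complex.exp (Complex.I * (Complex.arg (deriv (Φ.word η) x) : ℂ)) =
      Complex.exp (Complex.I * ((Φ.wordLog η x).im : ℂ)) := by
  have h0 := Φ.word_deriv_ne_zero η x hx
  have h1 := Complex.norm_mul_exp_arg_mul_I (deriv (Φ.word η) x)
  have h2 : ((‖deriv (Φ.word η) x‖ : ℝ) : ℂ) * Complex.exp ((Φ.wordLog η x).im * Complex.I)
      = deriv (Φ.word η) x := by
    rw [← Φ.exp_wordLog η hx, Complex.norm_exp, Complex.ofReal_exp, ← Complex.exp_add,
      Complex.re_add_im]
  rw [mul_comm, mul_comm Complex.I]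
  refine mul_left_cancel₀ ?_ (h1.trans h2.symm)
  exact_mod_cast norm_ne_zero_iff.2 h0

theorem hasFDerivAt_log_norm_deriv_word (η : List (Fin n)) {x : ℂ} (hx : x ∈ disc) :
    HasFDerivAt (fun z => Real.log ‖deriv (Φ.word η) z‖)
      (Complex.reCLM.comp ((ContinuousLinearMap.toSpanSingleton ℂ
        (deriv (Φ.wordLog η) x)).restrictScalars ℝ)) x := by
  have h1 : HasFDerivAt (fun z => (Φ.wordLog η z).re)
      (Complex.reCLM.comp ((ContinuousLinearMap.toSpanSingleton ℂ
        (deriv (Φ.wordLog η) x)).restrictScalars ℝ)) x :=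
    Complex.reCLM.hasFDerivAt.comp x
      ((Φ.hasDerivAt_wordLog η hx).hasFDerivAt.restrictScalars ℝ)
  refine h1.congr_of_eventuallyEq ?_
  filter_upwards [Φ.exp_wordLog_eventually η hx] with z hz
  rw [← hz, Complex.norm_exp, Real.log_exp]

end DiscIFS

/-- By the Cauchy-Riemann equations, the gradient of the real part of a holomorphic function has the
modulus of its derivative; the norm is attained at the conjugate of `a`. This translates (UNI),
stated for log|f'|, into bounds for complex derivatives of `wordLog`, which control the angle as
well. -/
theorem norm_reCLM_comp_toSpanSingleton (a : ℂ) :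
    ‖Complex.reCLM.comp ((ContinuousLinearMap.toSpanSingleton ℂ a).restrictScalars ℝ)‖ = ‖a‖ := by
  refine le_antisymm (ContinuousLinearMap.opNorm_le_bound _ (norm_nonneg _) fun v => ?_) ?_
  · calc ‖(v * a).re‖ ≤ ‖v * a‖ := Complex.abs_re_le_norm _
      _ = ‖a‖ * ‖v‖ := by rw [norm_mul, mul_comm]
  · rcases eq_or_ne a 0 with rfl | ha
    · simp
    have h := ContinuousLinearMap.le_opNorm
      (Complex.reCLM.comp ((ContinuousLinearMap.toSpanSingleton ℂ a).restrictScalars ℝ))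
      ((starRingEnd ℂ) a)
    have h2 : ‖(Complex.reCLM.comp ((ContinuousLinearMap.toSpanSingleton ℂ a).restrictScalars ℝ))
      ((starRingEnd ℂ) a)‖ = ‖a‖ * ‖a‖ := by
      change ‖((starRingEnd ℂ) a * a).re‖ = _
      rw [← Complex.normSq_eq_conj_mul_self, Complex.ofReal_re, Complex.normSq_eq_norm_sq,
        Real.norm_of_nonneg (sq_nonneg _), sq]
    rw [h2, Complex.norm_conj] at h
    exact le_of_mul_le_mul_right h (norm_pos_iff.2 ha)

namespace DiscIFS

variable {n : ℕ} (Φ : DiscIFS n)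

theorem norm_fderiv_log_norm_deriv_word (η : List (Fin n)) {x : ℂ} (hx : x ∈ disc) :
    ‖fderiv ℝ (fun z => Real.log ‖deriv (Φ.word η) z‖) x‖ = ‖deriv (Φ.wordLog η) x‖ := by
  rw [(Φ.hasFDerivAt_log_norm_deriv_word η hx).fderiv, norm_reCLM_comp_toSpanSingleton]

theorem norm_fderiv_log_norm_deriv_map_sub (i j : Fin n) {x : ℂ} (hx : x ∈ disc) :
    ‖fderiv ℝ (fun z => Real.log ‖deriv (Φ.map i) z‖ - Real.log ‖deriv (Φ.map j) z‖) x‖ =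
      ‖deriv (Φ.wordLog [i]) x - deriv (Φ.wordLog [j]) x‖ := by
  have h := (Φ.hasFDerivAt_log_norm_deriv_word [i] hx).sub
    (Φ.hasFDerivAt_log_norm_deriv_word [j] hx)
  have h2 := h.fderiv
  simp only [word_singleton] at h2
  change ‖fderiv ℝ ((fun z => Real.log ‖deriv (Φ.map i) z‖) -
    fun z => Real.log ‖deriv (Φ.map j) z‖) x‖ = _
  rw [h2, ← norm_reCLM_comp_toSpanSingleton]
  congr 1
  ext v
  simp only [sub_apply, ContinuousLinearMap.comp_apply,
    ContinuousLinearMap.coe_restrictScalars', ContinuousLinearMap.toSpanSingleton_apply,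
    Complex.reCLM_apply, smul_eq_mul, mul_sub, Complex.sub_re]

/-- The uniform non-integrability for long words with different last letters. -/
theorem le_norm_deriv_wordLog_sub {i j : Fin n} {Ct m m' : ℝ}
    (hCt : ∀ η : List (Fin n), ∀ x ∈ disc, ‖deriv (Φ.wordLog η) x‖ ≤ Ct)
    (h : Φ.UNIPair i j m m') (ξ : List (Fin n)) {x : ℂ} (hx : x ∈ disc) :
    m - 2 * Ct * Φ.rate ≤ ‖deriv (Φ.wordLog (ξ ++ [i])) x - deriv (Φ.wordLog (ξ ++ [j])) x‖ := by
  have hm := (h x hx).1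
  rw [Φ.norm_fderiv_log_norm_deriv_map_sub i j hx] at hm
  rw [Φ.deriv_wordLog_append _ _ hx, Φ.deriv_wordLog_append _ _ hx]
  -- The common prefix is evaluated after one more contraction, so it changes each derivative by at
  -- most Ct·ρ; there are two such terms.
  have hb : ∀ k : Fin n, ‖deriv (Φ.wordLog ξ) (Φ.word [k] x) * deriv (Φ.word [k]) x‖
      ≤ Ct * Φ.rate := by
    intro k
    rw [norm_mul]
    exact mul_le_mul (hCt _ _ (Φ.word_mapsTo [k] hx)) (Φ.norm_deriv_map_le_rate k hx)
      (norm_nonneg _) ((norm_nonneg _).trans (hCt [] 0 zero_mem_disc))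
  set A := deriv (Φ.wordLog ξ) (Φ.word [i] x) * deriv (Φ.word [i]) x
  set A' := deriv (Φ.wordLog ξ) (Φ.word [j] x) * deriv (Φ.word [j]) x
  have h1 : ‖deriv (Φ.wordLog [i]) x - deriv (Φ.wordLog [j]) x‖ ≤
      ‖A + deriv (Φ.wordLog [i]) x - (A' + deriv (Φ.wordLog [j]) x)‖ + (‖A‖ + ‖A'‖) := by
    calc _ = ‖(A + deriv (Φ.wordLog [i]) x - (A' + deriv (Φ.wordLog [j]) x)) - (A - A')‖ := by
            congr 1; ring
      _ ≤ _ := (norm_sub_le _ _).trans (by gcongr; exact norm_sub_le _ _)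
  linarith [hb i, hb j]

/-- A common Lipschitz constant for the derivatives of the logarithms of all words in a finite
set. -/
theorem exists_lipschitz_deriv_wordLog (W : Set (List (Fin n))) (hW : W.Finite) :
    ∃ C : ℝ, 0 ≤ C ∧ ∀ η ∈ W, ∀ x ∈ disc, ∀ y ∈ disc,
      ‖deriv (Φ.wordLog η) x - deriv (Φ.wordLog η) y‖ ≤ C * ‖x - y‖ := by
  have h : ∀ η, ∃ C : ℝ, 0 ≤ C ∧ ∀ x ∈ disc, ∀ y ∈ disc,
      ‖deriv (Φ.wordLog η) x - deriv (Φ.wordLog η) y‖ ≤ C * ‖x - y‖ := by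
    intro η
    obtain ⟨C, hC⟩ := isCompact_disc.exists_bound_of_continuousOn
      (Φ.wordLog_analytic η).deriv.deriv.continuousOn
    exact ⟨C, (norm_nonneg _).trans (hC 0 zero_mem_disc), fun x hx y hy =>
      norm_image_sub_le_of_norm_deriv_le_disc (Φ.wordLog_analytic η).deriv hC hx hy⟩
  choose C hC0 hC using h
  refine ⟨∑ η ∈ hW.toFinset, C η, Finset.sum_nonneg fun η _ => hC0 η, fun η hη x hx y hy => ?_⟩
  refine (hC η x hx y hy).trans ?_
  gcongr
  exact Finset.single_le_sum (f := C) (fun η _ => hC0 η) (hW.mem_toFinset.2 hη)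

/-- A common bound for the logarithms of all words in a finite set. -/
theorem exists_bound_wordLog (W : Set (List (Fin n))) (hW : W.Finite) :
    ∃ C : ℝ, 0 ≤ C ∧ ∀ η ∈ W, ∀ x ∈ disc, ‖Φ.wordLog η x‖ ≤ C := by
  choose C hC using fun η => isCompact_disc.exists_bound_of_continuousOn
    (Φ.wordLog_analytic η).continuousOn
  have hC0 : ∀ η, 0 ≤ C η := fun η => (norm_nonneg _).trans (hC η 0 zero_mem_disc)
  refine ⟨∑ η ∈ hW.toFinset, C η, Finset.sum_nonneg fun η _ => hC0 η, fun η hη x hx => ?_⟩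
  exact (hC η x hx).trans
    (Finset.single_le_sum (f := C) (fun η _ => hC0 η) (hW.mem_toFinset.2 hη))

end DiscIFS

/-! ### Non-concentration of the attractor along analytic curves -/

/-- Otherwise K would lie in the unit circle, which is an analytic curve. An interior point is
needed because the limit functions in the compactness argument are holomorphic on the open disc
only. -/
theorem exists_norm_lt_one_of_not_inAnalyticCurve {K : Set ℂ} (hK : ¬ InAnalyticCurve K)
    (hKd : K ⊆ disc) : ∃ x ∈ K, ‖x‖ < 1 := by
  by_contra! hcon
  have h1 : ∀ z ∈ K, ‖z‖ = 1 := fun z hz => le_antisymm (norm_le_one_of_mem_disc (hKd hz)) (hcon z hz)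
  refine hK ⟨Set.univ, fun z => z.re * z.re + z.im * z.im - 1, isOpen_univ, Set.subset_univ _,
    fun z _ => ?_, fun z hz => ⟨?_, fun h0 => ?_⟩⟩
  · have hre : AnalyticAt ℝ (fun z : ℂ => z.re) z := Complex.reCLM.analyticAt z
    have him : AnalyticAt ℝ (fun z : ℂ => z.im) z := Complex.imCLM.analyticAt z
    exact ((hre.mul hre).add (him.mul him)).sub analyticAt_const
  · have := Complex.normSq_eq_norm_sq z
    rw [Complex.normSq_apply, h1 z hz] at this
    simp [this]
  · have hre : HasFDerivAt (fun z : ℂ => z.re) Complex.reCLM z := Complex.reCLM.hasFDerivAt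
    have him : HasFDerivAt (fun z : ℂ => z.im) Complex.imCLM z := Complex.imCLM.hasFDerivAt
    have h := ((hre.mul hre).add (him.mul him)).sub_const 1
    have h2 := h.fderiv.symm.trans h0
    -- Testing the differential of |z|² - 1 on the radial vector z gives 2|z|² = 2, so it does not
    -- vanish.
    have h3 := congrArg (fun T : ℂ →L[ℝ] ℝ => T z) h2
    have h4 := Complex.normSq_eq_norm_sq z
    rw [Complex.normSq_apply, h1 z hz] at h4
    simp at h3
    linarith

namespace DiscIFS

variable {n : ℕ} (Φ : DiscIFS n)

variable {Φ} in
theorem IsAttractor.map_mem {K : Set ℂ} (h : Φ.IsAttractor K) (i : Fin n) {x : ℂ} (hx : x ∈ K) :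
    Φ.map i x ∈ K := by
  rw [h.2.2.2]
  exact Set.mem_iUnion.2 ⟨i, x, hx, rfl⟩

variable {Φ} in
theorem IsAttractor.word_mem {K : Set ℂ} (h : Φ.IsAttractor K) (η : List (Fin n)) {x : ℂ}
    (hx : x ∈ K) : Φ.word η x ∈ K := by
  induction η with
  | nil => exact hx
  | cons i η ih => exact h.map_mem i ih

variable {Φ} in
theorem IsAttractor.exists_map_eq {K : Set ℂ} (h : Φ.IsAttractor K) {x : ℂ} (hx : x ∈ K) :
    ∃ i, ∃ y ∈ K, Φ.map i y = x := by
  rw [h.2.2.2] at hx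
  obtain ⟨i, y, hy, e⟩ := Set.mem_iUnion.1 hx
  exact ⟨i, y, hy, e⟩

variable {Φ} in
theorem IsAttractor.exists_word_eq {K : Set ℂ} (h : Φ.IsAttractor K) (m : ℕ) {x : ℂ} (hx : x ∈ K) :
    ∃ η : List (Fin n), η.length = m ∧ ∃ y ∈ K, Φ.word η y = x := by
  induction m generalizing x with
  | zero => exact ⟨[], rfl, x, hx, rfl⟩
  | succ m ih =>
    obtain ⟨i, y, hy, rfl⟩ := h.exists_map_eq hx
    obtain ⟨η, hη, z, hz, rfl⟩ := ih hy
    exact ⟨i :: η, by simp [hη], z, hz, rfl⟩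

variable {Φ} in
/-- Some cylinder is contained in the open disc. -/
theorem IsAttractor.exists_word_mem_ball {K : Set ℂ} (h : Φ.IsAttractor K)
    (hK : ¬ InAnalyticCurve K) : ∃ η, ∀ x ∈ disc, Φ.word η x ∈ Metric.ball (0 : ℂ) 1 := by
  obtain ⟨x, hx, hx1⟩ := exists_norm_lt_one_of_not_inAnalyticCurve hK h.2.2.1
  -- A cylinder of length m around x has diameter at most 2ρ^m, which is now less than the distance
  -- from x to the unit circle.
  obtain ⟨m, hm⟩ := exists_pow_lt_of_lt_one (show 0 < (1 - ‖x‖) / 2 by linarith) Φ.rate_lt_one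
  obtain ⟨η, hη, y, hy, rfl⟩ := h.exists_word_eq m hx
  refine ⟨η, fun z hz => ?_⟩
  rw [mem_ball_zero_iff]
  have h1 := Φ.norm_word_sub_le η hz (h.2.2.1 hy)
  have h2 := norm_sub_le_two_of_mem_disc hz (h.2.2.1 hy)
  rw [hη] at h1
  have h3 : Φ.rate ^ m * ‖z - y‖ ≤ Φ.rate ^ m * 2 := by
    gcongr
    exact pow_nonneg Φ.rate_nonneg m
  have h4 := norm_add_le (Φ.word η z - Φ.word η y) (Φ.word η y)
  rw [sub_add_cancel] at h4
  linarith

variable {Φ} in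
/-- If the real part of a holomorphic function without critical points on the open disc is
constant on the attractor, then the attractor is contained in an analytic curve. -/
theorem IsAttractor.inAnalyticCurve_of_re_eq {K : Set ℂ} (h : Φ.IsAttractor K)
    {G : ℂ → ℂ} (hG : DifferentiableOn ℂ G (Metric.ball 0 1))
    (hG0 : ∀ z ∈ Metric.ball (0 : ℂ) 1, deriv G z ≠ 0)
    (hGK : ∀ x ∈ K, ∀ y ∈ K, (G x).re = (G y).re) : InAnalyticCurve K := by
  by_contra hK
  obtain ⟨η, hη⟩ := h.exists_word_mem_ball hK
  obtain ⟨x₀, hx₀⟩ := h.2.1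
  have hGa : ∀ z ∈ Metric.ball (0 : ℂ) 1, AnalyticAt ℂ G z := fun z hz =>
    hG.analyticAt (Metric.isOpen_ball.mem_nhds hz)
  -- The attractor may touch the unit circle, where `G` is not controlled. Precomposition with a
  -- cylinder map into the open disc avoids this: f_η maps K into K and its derivative does not
  -- vanish.
  refine hK ⟨{z | AnalyticAt ℂ (Φ.word η) z ∧ Φ.word η z ∈ Metric.ball (0 : ℂ) 1},
    fun z => (G (Φ.word η z)).re - (G (Φ.word η x₀)).re, ?_, fun z hz => ?_, ?_, fun z hz => ⟨?_, ?_⟩⟩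
  · rw [isOpen_iff_mem_nhds]
    rintro z ⟨hz, hzb⟩
    exact hz.eventually_analyticAt.and (hz.continuousAt.eventually (Metric.isOpen_ball.mem_nhds hzb))
  · exact ⟨Φ.word_analytic η z (h.2.2.1 hz), hη z (h.2.2.1 hz)⟩
  · rintro z ⟨hz, hzb⟩
    have h1 : AnalyticAt ℝ (fun z => G (Φ.word η z)) z :=
      ((hGa _ hzb).comp hz).restrictScalars
    exact ((Complex.reCLM.analyticAt _).comp h1).sub analyticAt_const
  · exact sub_eq_zero.2 (hGK _ (h.word_mem η hz) _ (h.word_mem η hx₀))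
  · intro h0
    have hzd := h.2.2.1 hz
    have hc : HasDerivAt (fun z => G (Φ.word η z))
        (deriv G (Φ.word η z) * deriv (Φ.word η) z) z :=
      (hGa _ (hη z hzd)).differentiableAt.hasDerivAt.comp z
        (Φ.differentiableAt_word η hzd).hasDerivAt
    have hf := (Complex.reCLM.hasFDerivAt.comp z (hc.hasFDerivAt.restrictScalars ℝ)).sub_const
      (G (Φ.word η x₀)).re
    have h2 := norm_reCLM_comp_toSpanSingleton (deriv G (Φ.word η z) * deriv (Φ.word η) z)
    have h3 := hf.fderiv
    have h4 : Complex.reCLM.comp ((ContinuousLinearMap.toSpanSingleton ℂ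
        (deriv G (Φ.word η z) * deriv (Φ.word η) z)).restrictScalars ℝ) = 0 := h3.symm.trans h0
    rw [h4, norm_zero] at h2
    exact mul_ne_zero (hG0 _ (hη z hzd)) (Φ.word_deriv_ne_zero η z hzd) (norm_eq_zero.1 h2.symm)

variable {Φ} in
/-- Uniform non-concentration of the attractor: its images under holomorphic maps with bounded
distortion are not concentrated along lines. -/
theorem IsAttractor.exists_nonconcentration {K : Set ℂ} (h : Φ.IsAttractor K)
    (hK : ¬ InAnalyticCurve K) {L : ℝ} (hL : 1 ≤ L) :
    ∃ κ : ℝ, 0 < κ ∧ ∀ g : ℂ → ℂ, AnalyticOnNhd ℂ g disc → deriv g 0 ≠ 0 →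
      (∀ x ∈ disc, ∀ y ∈ disc, ‖deriv g x‖ ≤ L * ‖deriv g y‖) → ∀ w : ℂ, ‖w‖ = 1 →
      ∃ x ∈ K, ∃ y ∈ K, κ * ‖deriv g 0‖ ≤ |(w * (g y - g x)).re| := by
  by_contra! hcon
  choose g hga hg0 hgL w hw hgK using fun k : ℕ =>
    hcon (1 / ((k : ℝ) + 1)) (by positivity)
  have hL0 : 0 < L := one_pos.trans_le hL
  -- Normalisation: G_k(0) = 0, the direction w_k is rotated to the real axis, and the distortion
  -- bound becomes 1/L ≤ |G_k'| ≤ L. The counterexamples now say that Re G_k oscillates by less than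
  -- 1/(k+1) on K.
  set G : ℕ → ℂ → ℂ := fun k z => w k / ‖deriv (g k) 0‖ * (g k z - g k 0) with hGdef
  have hnz : ∀ k, (0 : ℝ) < ‖deriv (g k) 0‖ := fun k => norm_pos_iff.2 (hg0 k)
  have hGa : ∀ k, AnalyticOnNhd ℂ (G k) disc := fun k z hz =>
    analyticAt_const.mul ((hga k z hz).sub analyticAt_const)
  have hcoef : ∀ k, ‖w k / (‖deriv (g k) 0‖ : ℂ)‖ = ‖deriv (g k) 0‖⁻¹ := by
    intro k
    simp [hw k]
  have hGd : ∀ k, ∀ z ∈ disc, ‖deriv (G k) z‖ = ‖deriv (g k) 0‖⁻¹ * ‖deriv (g k) z‖ := by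
    intro k z hz
    have : HasDerivAt (G k) (w k / ‖deriv (g k) 0‖ * deriv (g k) z) z :=
      ((hga k z hz).differentiableAt.hasDerivAt.sub_const _).const_mul _
    rw [this.deriv, norm_mul, hcoef]
  have hGup : ∀ k, ∀ z ∈ disc, ‖deriv (G k) z‖ ≤ L := by
    intro k z hz
    rw [hGd k z hz, inv_mul_le_iff₀ (hnz k), mul_comm]
    exact hgL k z hz 0 zero_mem_disc
  have hGlow : ∀ k, ∀ z ∈ disc, L⁻¹ ≤ ‖deriv (G k) z‖ := by
    intro k z hz
    rw [hGd k z hz, inv_mul_eq_div, le_div_iff₀ (hnz k), inv_mul_le_iff₀ hL0]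
    exact hgL k 0 zero_mem_disc z hz
  have hGlip : ∀ k, LipschitzWith L.toNNReal fun x : disc => G k x := by
    intro k
    refine LipschitzWith.of_dist_le_mul fun x y => ?_
    rw [Real.coe_toNNReal _ hL0.le, dist_eq_norm, Subtype.dist_eq, dist_eq_norm]
    exact norm_image_sub_le_of_norm_deriv_le_disc (hGa k) (hGup k) x.2 y.2
  set Gb : ℕ → BoundedContinuousFunction disc ℂ := fun k =>
    BoundedContinuousFunction.mkOfCompact ⟨fun x : disc => G k x, (hGlip k).continuous⟩
  -- A uniformly bounded family with a common Lipschitz constant on the closed disc is relatively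
  -- compact, by Arzelà-Ascoli.
  have hcomp : IsCompact (closure (Set.range Gb)) := by
    refine BoundedContinuousFunction.arzela_ascoli (Metric.closedBall (0 : ℂ) L)
      (isCompact_closedBall _ _) _ ?_ ?_
    · rintro _ x ⟨k, rfl⟩
      rw [mem_closedBall_zero_iff]
      have h1 := norm_image_sub_le_of_norm_deriv_le_disc (hGa k) (hGup k) x.2 zero_mem_disc
      have h2 : G k 0 = 0 := by simp [hGdef]
      rw [h2, sub_zero, sub_zero] at h1
      exact h1.trans (mul_le_of_le_one_right hL0.le (norm_le_one_of_mem_disc x.2))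
    · refine UniformEquicontinuous.equicontinuous ?_
      refine LipschitzWith.uniformEquicontinuous _ L.toNNReal ?_
      rintro ⟨_, k, rfl⟩
      exact hGlip k
  obtain ⟨F, -, φ, hφ, hlim⟩ := hcomp.tendsto_subseq fun k => subset_closure ⟨k, rfl⟩
  have hunif : TendstoUniformlyOn (fun k => G (φ k)) (ext F) atTop disc := by
    have h1 := BoundedContinuousFunction.tendsto_iff_tendstoUniformly.1 hlim
    rw [Metric.tendstoUniformlyOn_iff]
    rw [Metric.tendstoUniformly_iff] at h1
    intro ε hε
    filter_upwards [h1 ε hε] with k hk x hx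
    rw [ext_of_mem _ hx]
    exact hk ⟨x, hx⟩
  have hball : Metric.ball (0 : ℂ) 1 ⊆ disc := Metric.ball_subset_closedBall
  have hloc : TendstoLocallyUniformlyOn (fun k => G (φ k)) (ext F) atTop (Metric.ball 0 1) :=
    (hunif.mono hball).tendstoLocallyUniformlyOn
  have hdiff : ∀ᶠ k in atTop, DifferentiableOn ℂ (G (φ k)) (Metric.ball 0 1) :=
    Eventually.of_forall fun k z hz =>
      ((hGa (φ k)) z (hball hz)).differentiableAt.differentiableWithinAt
  refine hK (h.inAnalyticCurve_of_re_eq (hloc.differentiableOn hdiff Metric.isOpen_ball)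
    (fun z hz h0 => ?_) fun x hx y hy => ?_)
  -- Derivatives converge as well, so the lower bound 1/L passes to the limit and excludes critical
  -- points.
  · have h1 := ((hloc.deriv hdiff Metric.isOpen_ball).tendsto_at hz).norm
    have h2 : L⁻¹ ≤ ‖deriv (ext F) z‖ :=
      ge_of_tendsto h1 (Eventually.of_forall fun k => hGlow (φ k) z (hball hz))
    rw [h0, norm_zero] at h2
    exact absurd h2 (not_le.2 (inv_pos.2 hL0))
  · have hxd := h.2.2.1 hx
    have hyd := h.2.2.1 hy
    have h1 : Tendsto (fun k => |(G (φ k) x).re - (G (φ k) y).re|) atTop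
        (𝓝 |(ext F x).re - (ext F y).re|) :=
      (((Complex.continuous_re.tendsto _).comp (hunif.tendsto_at hxd)).sub
        ((Complex.continuous_re.tendsto _).comp (hunif.tendsto_at hyd))).abs
    have h2 : Tendsto (fun k => 1 / ((φ k : ℝ) + 1)) atTop (𝓝 0) :=
      tendsto_one_div_add_atTop_nhds_zero_nat.comp hφ.tendsto_atTop
    have h3 : |(ext F x).re - (ext F y).re| ≤ 0 := by
      refine le_of_tendsto_of_tendsto' h1 h2 fun k => ?_
      have h4 := (hgK (φ k) y hy x hx).le
      have h5 : (G (φ k) x).re - (G (φ k) y).re =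
          ‖deriv (g (φ k)) 0‖⁻¹ * (w (φ k) * (g (φ k) x - g (φ k) y)).re := by
        rw [← Complex.sub_re, ← Complex.re_ofReal_mul]
        congr 1
        simp only [hGdef, Complex.ofReal_inv]
        ring
      rw [h5, abs_mul, abs_of_pos (inv_pos.2 (hnz (φ k))), inv_mul_le_iff₀ (hnz (φ k)),
        mul_comm ‖deriv (g (φ k)) 0‖]
      exact h4
    exact sub_eq_zero.1 (abs_eq_zero.1 (le_antisymm h3 (abs_nonneg _)))

/-! ### Non-concentration for the sub-systems -/

variable {Φ} in
-- A label whose image were disjoint from all images in `T` could be added to `T`, against maximal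
-- cardinality.
theorem IsMaxDisjoint.exists_inter {Ψ T : Finset (Fin n)} (hT : Φ.IsMaxDisjoint Ψ T) (k : Fin n) :
    ∃ i ∈ T, (Φ.map i '' disc ∩ Φ.map k '' disc).Nonempty := by
  classical
  by_cases hk : k ∈ T
  · exact ⟨k, hk, Φ.map k 0, ⟨0, zero_mem_disc, rfl⟩, ⟨0, zero_mem_disc, rfl⟩⟩
  by_contra! hcon
  have hd : ∀ i ∈ T, Disjoint (Φ.map i '' disc) (Φ.map k '' disc) := fun i hi =>
    Set.disjoint_iff_inter_eq_empty.2 (hcon i hi)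
  have h1 := hT.2.2 (insert k T) (hT.1.trans (Finset.subset_insert _ _)) ?_
  · rw [Finset.card_insert_of_notMem hk] at h1
    omega
  · intro i hi j hj hij
    rcases Finset.mem_insert.1 hi with hik | hi' <;>
      rcases Finset.mem_insert.1 hj with hjk | hj'
    · exact absurd (hik.trans hjk.symm) hij
    · exact hik ▸ (hd j hj').symm
    · exact hjk ▸ hd i hi'
    · exact hT.2.1 i hi' j hj' hij

/-- `T` meets the image of the disc under every map of the system. -/
def IsDense (T : Finset (Fin n)) : Prop :=
  ∀ k, ∃ i ∈ T, (Φ.map i '' disc ∩ Φ.map k '' disc).Nonempty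

variable {Φ} in
-- The point lies in some f_k(D), which meets f_i(D) for some i in `T`; both images have diameter at
-- most 2ρ.
theorem IsAttractor.exists_mem_forall_norm_sub_le {K : Set ℂ} (h : Φ.IsAttractor K)
    {T : Finset (Fin n)} (hT : Φ.IsDense T) {x : ℂ} (hx : x ∈ K) :
    ∃ i ∈ T, ∀ z ∈ disc, ‖Φ.map i z - x‖ ≤ 4 * Φ.rate := by
  obtain ⟨k, y, hy, rfl⟩ := h.exists_map_eq hx
  obtain ⟨i, hi, _, ⟨a, ha, rfl⟩, b, hb, hab⟩ := hT k
  refine ⟨i, hi, fun z hz => ?_⟩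
  have h1 := Φ.norm_word_sub_le [i] hz ha
  have h2 := Φ.norm_word_sub_le [k] hb (h.2.2.1 hy)
  simp only [word_singleton, List.length_singleton, pow_one] at h1 h2
  have h3 := norm_sub_le_two_of_mem_disc hz ha
  have h4 := norm_sub_le_two_of_mem_disc hb (h.2.2.1 hy)
  have h5 : Φ.map i z - Φ.map k y = (Φ.map i z - Φ.map i a) + (Φ.map k b - Φ.map k y) := by
    rw [hab]; ring
  rw [h5]
  have h6 := norm_add_le (Φ.map i z - Φ.map i a) (Φ.map k b - Φ.map k y)
  nlinarith [Φ.rate_nonneg]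

variable {Φ} in
/-- Non-concentration of the images of the first generation of a dense sub-system. -/
theorem IsAttractor.exists_letters {K : Set ℂ} (h : Φ.IsAttractor K) {L κ : ℝ}
    (hκ : ∀ g : ℂ → ℂ, AnalyticOnNhd ℂ g disc → deriv g 0 ≠ 0 →
      (∀ x ∈ disc, ∀ y ∈ disc, ‖deriv g x‖ ≤ L * ‖deriv g y‖) → ∀ w : ℂ, ‖w‖ = 1 →
      ∃ x ∈ K, ∃ y ∈ K, κ * ‖deriv g 0‖ ≤ |(w * (g y - g x)).re|)
    (hL : Φ.HasDistortion L) (hr : 16 * L * Φ.rate ≤ κ)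
    {T : Finset (Fin n)} (hT : Φ.IsDense T) (v : List (Fin n)) {w : ℂ} (hw : ‖w‖ = 1) :
    ∃ i ∈ T, ∃ j ∈ T, ∀ x ∈ disc, ∀ y ∈ disc,
      κ / 2 * ‖deriv (Φ.word v) 0‖ ≤
        |(w * (Φ.word v (Φ.map j y) - Φ.word v (Φ.map i x))).re| := by
  obtain ⟨a, ha, b, hb, hab⟩ := hκ (Φ.word v) (Φ.word_analytic v)
    (Φ.word_deriv_ne_zero v 0 zero_mem_disc) (hL v) w hw
  obtain ⟨i, hi, hia⟩ := h.exists_mem_forall_norm_sub_le hT ha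
  obtain ⟨j, hj, hjb⟩ := h.exists_mem_forall_norm_sub_le hT hb
  refine ⟨i, hi, j, hj, fun x hx y hy => ?_⟩
  have hL1 := Φ.one_le_of_hasDistortion hL
  set d := ‖deriv (Φ.word v) 0‖
  have hd : 0 ≤ d := norm_nonneg _
  -- Replacing `a` and `b` by arbitrary points of the two images costs 4Lρ|f_v'(0)| each. The
  -- smallness of ρ makes the total at most half of the width κ|f_v'(0)|.
  have h1 : ‖Φ.word v (Φ.map i x) - Φ.word v a‖ ≤ L * d * (4 * Φ.rate) :=
    (Φ.norm_word_sub_le_of_hasDistortion hL v (Φ.mapsTo i hx) (h.2.2.1 ha)).trans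
      (by gcongr; exact hia x hx)
  have h2 : ‖Φ.word v (Φ.map j y) - Φ.word v b‖ ≤ L * d * (4 * Φ.rate) :=
    (Φ.norm_word_sub_le_of_hasDistortion hL v (Φ.mapsTo j hy) (h.2.2.1 hb)).trans
      (by gcongr; exact hjb y hy)
  have h3 : w * (Φ.word v b - Φ.word v a) =
      w * (Φ.word v (Φ.map j y) - Φ.word v (Φ.map i x)) +
      w * ((Φ.word v (Φ.map i x) - Φ.word v a) - (Φ.word v (Φ.map j y) - Φ.word v b)) := by ring
  rw [h3, Complex.add_re] at hab
  have h4 : |(w * ((Φ.word v (Φ.map i x) - Φ.word v a) -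
      (Φ.word v (Φ.map j y) - Φ.word v b))).re| ≤ 8 * L * Φ.rate * d := by
    refine (Complex.abs_re_le_norm _).trans ?_
    rw [norm_mul, hw, one_mul]
    refine (norm_sub_le _ _).trans ?_
    linarith
  have h5 := abs_add_le (w * (Φ.word v (Φ.map j y) - Φ.word v (Φ.map i x))).re
    (w * ((Φ.word v (Φ.map i x) - Φ.word v a) - (Φ.word v (Φ.map j y) - Φ.word v b))).re
  nlinarith

end DiscIFS

/-! ### Weights -/

section Weights

variable {n : ℕ} {p : Fin n → ℝ} {S : Fin n → Finset (Fin n)}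

theorem div_multiplicity_pos (hp : ∀ i, 0 < p i) {k i : Fin n} (hi : i ∈ S k) :
    0 < p i / multiplicity S i := by
  refine div_pos (hp i) ?_
  have : 0 < multiplicity S i := Finset.card_pos.2 ⟨k, by simp [hi]⟩
  exact_mod_cast this

theorem selWeight_pos (hp : ∀ i, 0 < p i) {k : Fin n} (hk : (S k).Nonempty) :
    0 < selWeight p S k :=
  Finset.sum_pos (fun _ hi => div_multiplicity_pos hp hi) hk

theorem branchWeight_pos (hp : ∀ i, 0 < p i) {k i : Fin n} (hi : i ∈ S k) :
    0 < branchWeight p S k i := by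
  rw [branchWeight, if_pos hi]
  exact div_pos (div_multiplicity_pos hp hi) (selWeight_pos hp ⟨i, hi⟩)

theorem branchWeight_eq_zero {k i : Fin n} (hi : i ∉ S k) : branchWeight p S k i = 0 := by
  rw [branchWeight, if_neg hi]

theorem branchWeight_nonneg (hp : ∀ i, 0 < p i) (k i : Fin n) : 0 ≤ branchWeight p S k i := by
  by_cases hi : i ∈ S k
  · exact (branchWeight_pos hp hi).le
  · exact (branchWeight_eq_zero hi).ge

theorem sum_branchWeight (hp : ∀ i, 0 < p i) {k : Fin n} (hk : (S k).Nonempty) :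
    ∑ i ∈ S k, branchWeight p S k i = 1 := by
  have : ∀ i ∈ S k, branchWeight p S k i = (p i / multiplicity S i) / selWeight p S k :=
    fun i hi => by rw [branchWeight, if_pos hi]
  rw [Finset.sum_congr rfl this, ← Finset.sum_div]
  exact div_self (selWeight_pos hp hk).ne'

/-- One lower bound for all sub-systems keeps every later gain uniform in ω. -/
theorem exists_le_branchWeight (hp : ∀ i, 0 < p i) :
    ∃ w₀ : ℝ, 0 < w₀ ∧ w₀ ≤ 1 ∧ ∀ k, ∀ i ∈ S k, w₀ ≤ branchWeight p S k i := by
  classical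
  -- Pairs with i ∉ S k have weight zero; the substitute value 1 keeps the minimum over all pairs
  -- positive.
  have hpos : ∀ x : Fin n × Fin n, 0 < if x.2 ∈ S x.1 then branchWeight p S x.1 x.2 else 1 := by
    intro x
    split_ifs with h
    · exact branchWeight_pos hp h
    · exact one_pos
  obtain ⟨w, hw, hle⟩ : ∃ w : ℝ, 0 < w ∧ ∀ x : Fin n × Fin n,
      w ≤ if x.2 ∈ S x.1 then branchWeight p S x.1 x.2 else 1 := by
    rcases isEmpty_or_nonempty (Fin n × Fin n) with h | h
    · exact ⟨1, one_pos, fun x => h.elim x⟩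
    · obtain ⟨x, hx⟩ := Finite.exists_min fun x : Fin n × Fin n =>
        if x.2 ∈ S x.1 then branchWeight p S x.1 x.2 else 1
      exact ⟨_, hpos x, hx⟩
  refine ⟨min w 1, lt_min hw one_pos, min_le_right _ _, fun k i hi => ?_⟩
  have := hle (k, i)
  rw [if_pos hi] at this
  exact (min_le_left _ _).trans this

theorem wordWeight_nonneg (hp : ∀ i, 0 < p i) {N : ℕ} (ω : ℕ → Fin n) (J : Fin N → Fin n) :
    0 ≤ wordWeight p S ω J :=
  Finset.prod_nonneg fun _ _ => branchWeight_nonneg hp _ _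

theorem pow_le_wordWeight {w₀ : ℝ} (hw₀ : 0 < w₀) (hw : ∀ k, ∀ i ∈ S k, w₀ ≤ branchWeight p S k i)
    {N : ℕ} {ω : ℕ → Fin n} {J : Fin N → Fin n} (hJ : J ∈ words S N ω) :
    w₀ ^ N ≤ wordWeight p S ω J := by
  have h : ∏ _j : Fin N, w₀ ≤ wordWeight p S ω J :=
    Finset.prod_le_prod (fun _ _ => hw₀.le) fun j _ => hw _ _ (Fintype.mem_piFinset.1 hJ j)
  simpa using h

theorem sum_wordWeight (hp : ∀ i, 0 < p i) (hS : ∀ k, (S k).Nonempty) (N : ℕ) (ω : ℕ → Fin n) :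
    ∑ J ∈ words S N ω, wordWeight p S ω J = 1 := by
  unfold words wordWeight
  rw [← Finset.prod_univ_sum]
  exact Finset.prod_eq_one fun j _ => sum_branchWeight hp (hS _)

/-! ### The path measure -/

/-- Prepending a letter to an infinite word. -/
def consPath (i : Fin n) (u : ℕ → Fin n) : ℕ → Fin n
  | 0 => i
  | j + 1 => u j

theorem measurable_consPath (i : Fin n) : Measurable (consPath i) := by
  refine measurable_pi_lambda _ fun j => ?_
  cases j with
  | zero => exact measurable_const
  | succ j => exact measurable_pi_apply j

theorem shift_zero (ω : ℕ → Fin n) : shift 0 ω = ω := rfl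

theorem shift_shift (a b : ℕ) (ω : ℕ → Fin n) : shift a (shift b ω) = shift (b + a) ω := by
  funext j
  simp only [shift]
  congr 1
  omega

theorem branchMeasure_apply (k : Fin n) (t : Set (Fin n)) :
    branchMeasure p S k t = ∑ i, ENNReal.ofReal (branchWeight p S k i) * t.indicator 1 i := by
  simp [branchMeasure]

/-- The first letter is independent of the shifted word, so the product measure splits according to
it; equality is checked on finite cylinder sets. This is the source of the self-similarity of the
random measures. -/
theorem pathMeasure_eq_sum (hp : ∀ i, 0 < p i) (hS : ∀ k, (S k).Nonempty) (ω : ℕ → Fin n) :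
    pathMeasure p S ω = ∑ i, ENNReal.ofReal (branchWeight p S (ω 0) i) •
      (pathMeasure p S (shift 1 ω)).map (consPath i) := by
  have : ∀ k, IsProbabilityMeasure (branchMeasure p S k) := fun k =>
    isProbabilityMeasure_branchMeasure p S hp k (hS k)
  classical
  symm
  refine Measure.eq_infinitePi _ fun s t ht => ?_
  -- The index set is enlarged to an initial segment containing 0, with full sets at the new
  -- indices, so that the factor of the first letter can be split off.
  obtain ⟨m, hm⟩ : ∃ m, s ⊆ Finset.range (m + 1) := by
    obtain ⟨m, hm⟩ := s.exists_nat_subset_range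
    exact ⟨m, hm.trans (Finset.range_mono (Nat.le_succ m))⟩
  set t' : ℕ → Set (Fin n) := fun j => if j ∈ s then t j else Set.univ with ht'
  have hpi : Set.pi (s : Set ℕ) t = {u | ∀ j ∈ Finset.range (m + 1), u j ∈ t' j} := by
    ext u
    simp only [Set.mem_pi, Set.mem_ofPred_eq, ht']
    constructor
    · intro h j _
      split_ifs with hj
      · exact h j hj
      · trivial
    · intro h j hj
      have := h j (hm hj)
      rwa [if_pos (Finset.mem_coe.1 hj)] at this
  have hms : MeasurableSet (Set.pi (s : Set ℕ) t) :=
    MeasurableSet.pi s.countable_toSet fun i _ => ht i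
  have hprod : ∏ j ∈ s, branchMeasure p S (ω j) (t j) =
      ∏ j ∈ Finset.range (m + 1), branchMeasure p S (ω j) (t' j) := by
    rw [← Finset.prod_subset hm]
    · exact Finset.prod_congr rfl fun j hj => by rw [ht']; simp [hj]
    · intro j _ hj
      simp [ht', hj]
  rw [hprod, Finset.prod_range_succ', mul_comm, branchMeasure_apply, Finset.sum_mul]
  simp only [Measure.coe_finsetSum, Finset.sum_apply, Measure.smul_apply, smul_eq_mul]
  refine Finset.sum_congr rfl fun i _ => ?_
  rw [Measure.map_apply (measurable_consPath i) hms, mul_assoc]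
  congr 1
  have hpre : consPath i ⁻¹' Set.pi (s : Set ℕ) t =
      if i ∈ t' 0 then Set.pi (Finset.range m : Set ℕ) (fun j => t' (j + 1)) else ∅ := by
    rw [hpi]
    ext u
    split_ifs with hi
    · simp only [Set.mem_preimage, Set.mem_ofPred_eq, Set.mem_pi]
      constructor
      · intro h j hj
        exact h (j + 1) (by simp at hj ⊢; omega)
      · intro h j hj
        cases j with
        | zero => exact hi
        | succ j => exact h j (by simp at hj ⊢; omega)
    · simp only [Set.mem_preimage, Set.mem_ofPred_eq, Set.mem_empty_iff_false, iff_false]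
      intro h
      exact hi (h 0 (by simp))
  rw [hpre]
  split_ifs with hi
  · rw [Set.indicator_of_mem hi, Pi.one_apply, one_mul, pathMeasure,
      Measure.infinitePi_pi _ fun j _ => MeasurableSet.of_discrete]
    rfl
  · rw [Set.indicator_of_notMem hi, zero_mul, measure_empty]

end Weights

namespace DiscIFS

variable {n : ℕ} (Φ : DiscIFS n)

/-! ### The coding map -/

/-- The approximations `f_{u_1} ∘ ⋯ ∘ f_{u_m} (0)` of the coding map. -/
def codingApprox (m : ℕ) (u : ℕ → Fin n) : ℂ := Φ.word (List.ofFn fun j : Fin m => u j) 0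

theorem codingApprox_mem (m : ℕ) (u : ℕ → Fin n) : Φ.codingApprox m u ∈ disc :=
  Φ.word_mapsTo _ zero_mem_disc

theorem dist_codingApprox_le (m : ℕ) (u : ℕ → Fin n) :
    dist (Φ.codingApprox m u) (Φ.codingApprox (m + 1) u) ≤ 1 * Φ.rate ^ m := by
  have h1 : List.ofFn (fun j : Fin (m + 1) => u j) =
      List.ofFn (fun j : Fin m => u j) ++ [u m] := by
    rw [List.ofFn_succ', List.concat_eq_append]
    simp
  have h2 := Φ.norm_word_sub_le (List.ofFn fun j : Fin m => u j) zero_mem_disc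
    (Φ.mapsTo (u m) zero_mem_disc)
  rw [List.length_ofFn, zero_sub, norm_neg] at h2
  rw [dist_eq_norm, codingApprox, codingApprox, h1, word_append_apply, word_singleton, one_mul]
  exact h2.trans (mul_le_of_le_one_right (pow_nonneg Φ.rate_nonneg m)
    (norm_le_one_of_mem_disc (Φ.mapsTo (u m) zero_mem_disc)))

theorem tendsto_codingApprox (u : ℕ → Fin n) :
    Tendsto (fun m => Φ.codingApprox m u) atTop (𝓝 (Φ.coding u)) :=
  (cauchySeq_of_le_geometric Φ.rate 1 Φ.rate_lt_one
    fun m => Φ.dist_codingApprox_le m u).tendsto_limUnder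

theorem coding_mem (u : ℕ → Fin n) : Φ.coding u ∈ disc :=
  isCompact_disc.isClosed.mem_of_tendsto (Φ.tendsto_codingApprox u)
    (Eventually.of_forall fun m => Φ.codingApprox_mem m u)

/-- The approximations converge uniformly at a geometric rate, and each depends on finitely many
discrete letters. -/
theorem continuous_coding : Continuous Φ.coding := by
  have hu : TendstoUniformly Φ.codingApprox Φ.coding atTop := by
    rw [Metric.tendstoUniformly_iff]
    intro ε hε
    have ht : Tendsto (fun m => 1 * Φ.rate ^ m / (1 - Φ.rate)) atTop (𝓝 0) := by
      simpa using ((tendsto_pow_atTop_nhds_zero_of_lt_one Φ.rate_nonneg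
        Φ.rate_lt_one).const_mul 1).div_const (1 - Φ.rate)
    filter_upwards [ht.eventually (gt_mem_nhds hε)] with m hm u
    rw [dist_comm]
    exact (dist_le_of_le_geometric_of_tendsto Φ.rate 1 Φ.rate_lt_one
      (fun m => Φ.dist_codingApprox_le m u) (Φ.tendsto_codingApprox u) m).trans_lt hm
  refine hu.continuous (Eventually.of_forall fun m => ?_).frequently
  have h1 : Continuous fun (u : ℕ → Fin n) (j : Fin m) => u j :=
    continuous_pi fun j => continuous_apply _
  exact (continuous_of_discreteTopology (f := fun J : Fin m → Fin n =>
    Φ.word (List.ofFn J) 0)).comp h1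

theorem coding_consPath (i : Fin n) (u : ℕ → Fin n) :
    Φ.coding (consPath i u) = Φ.map i (Φ.coding u) := by
  have h1 := (tendsto_add_atTop_iff_nat 1).2 (Φ.tendsto_codingApprox (consPath i u))
  have h2 : Tendsto (fun m => Φ.map i (Φ.codingApprox m u)) atTop (𝓝 (Φ.map i (Φ.coding u))) :=
    ((Φ.analytic i _ (Φ.coding_mem u)).continuousAt.tendsto).comp (Φ.tendsto_codingApprox u)
  refine tendsto_nhds_unique h1 (h2.congr fun m => ?_)
  simp only [codingApprox, List.ofFn_succ, word, Function.comp_apply]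
  rfl

/-! ### Averages over the random measures -/

section Average

variable (p : Fin n → ℝ) (S : Fin n → Finset (Fin n))

/-- The average of a function with respect to the random measure. -/
def average (ω : ℕ → Fin n) (F : ℂ → ℝ) : ℝ := ∫ u, F (Φ.coding u) ∂(pathMeasure p S ω)

/-- All estimates are made on the symbolic space, where prefixes distinguish cylinders even if their
images in the plane overlap. -/
theorem integral_randomMeasure (ω : ℕ → Fin n) {F : ℂ → ℝ} (hF : Measurable F) :
    ∫ z, F z ∂(Φ.randomMeasure p S ω) = Φ.average p S ω F :=
  integral_map Φ.continuous_coding.measurable.aemeasurable hF.aestronglyMeasurable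

theorem continuous_comp_coding {F : ℂ → ℝ} (hF : ContinuousOn F disc) :
    Continuous fun u => F (Φ.coding u) :=
  hF.comp_continuous Φ.continuous_coding Φ.coding_mem

variable {p S}

theorem isProbabilityMeasure_pathMeasure (hp : ∀ i, 0 < p i) (hS : ∀ k, (S k).Nonempty)
    (ω : ℕ → Fin n) : IsProbabilityMeasure (pathMeasure p S ω) := by
  have : ∀ k, IsProbabilityMeasure (branchMeasure p S k) := fun k =>
    isProbabilityMeasure_branchMeasure p S hp k (hS k)
  exact inferInstanceAs (IsProbabilityMeasure (Measure.infinitePi _))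

theorem integrable_comp_coding (hp : ∀ i, 0 < p i) (hS : ∀ k, (S k).Nonempty)
    (ω : ℕ → Fin n) {F : ℂ → ℝ} (hF : ContinuousOn F disc) :
    Integrable (fun u => F (Φ.coding u)) (pathMeasure p S ω) := by
  have := isProbabilityMeasure_pathMeasure hp hS ω
  obtain ⟨C, hC⟩ := isCompact_disc.exists_bound_of_continuousOn hF
  exact Integrable.of_bound (Φ.continuous_comp_coding hF).measurable.aestronglyMeasurable C
    (Eventually.of_forall fun u => hC _ (Φ.coding_mem u))

theorem average_mono (hp : ∀ i, 0 < p i) (hS : ∀ k, (S k).Nonempty)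
    (ω : ℕ → Fin n) {F G : ℂ → ℝ} (hF : ContinuousOn F disc) (hG : ContinuousOn G disc)
    (h : ∀ x ∈ disc, F x ≤ G x) : Φ.average p S ω F ≤ Φ.average p S ω G :=
  integral_mono (Φ.integrable_comp_coding hp hS ω hF) (Φ.integrable_comp_coding hp hS ω hG)
    fun u => h _ (Φ.coding_mem u)

theorem average_const (hp : ∀ i, 0 < p i) (hS : ∀ k, (S k).Nonempty)
    (ω : ℕ → Fin n) (c : ℝ) : Φ.average p S ω (fun _ => c) = c := by
  have := isProbabilityMeasure_pathMeasure hp hS ω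
  simp [average]

theorem average_nonneg (ω : ℕ → Fin n) {F : ℂ → ℝ} (h : ∀ x ∈ disc, 0 ≤ F x) :
    0 ≤ Φ.average p S ω F :=
  integral_nonneg fun u => h _ (Φ.coding_mem u)

theorem average_sub (hp : ∀ i, 0 < p i) (hS : ∀ k, (S k).Nonempty)
    (ω : ℕ → Fin n) {F G : ℂ → ℝ} (hF : ContinuousOn F disc) (hG : ContinuousOn G disc) :
    Φ.average p S ω (fun x => F x - G x) = Φ.average p S ω F - Φ.average p S ω G :=
  integral_sub (Φ.integrable_comp_coding hp hS ω hF) (Φ.integrable_comp_coding hp hS ω hG)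

theorem average_const_mul (ω : ℕ → Fin n) (c : ℝ) (F : ℂ → ℝ) :
    Φ.average p S ω (fun x => c * F x) = c * Φ.average p S ω F :=
  integral_const_mul _ _

/-- Self-similarity of the random measures. -/
theorem average_eq_sum (hp : ∀ i, 0 < p i) (hS : ∀ k, (S k).Nonempty)
    (ω : ℕ → Fin n) {F : ℂ → ℝ} (hF : ContinuousOn F disc) :
    Φ.average p S ω F = ∑ i ∈ S (ω 0), branchWeight p S (ω 0) i *
      Φ.average p S (shift 1 ω) (F ∘ Φ.map i) := by
  have hc := Φ.continuous_comp_coding hF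
  have hint : ∀ i ∈ Finset.univ, Integrable (fun u => F (Φ.coding u))
      (ENNReal.ofReal (branchWeight p S (ω 0) i) •
        (pathMeasure p S (shift 1 ω)).map (consPath i)) := by
    intro i _
    refine Integrable.smul_measure ?_ ENNReal.ofReal_ne_top
    rw [integrable_map_measure hc.measurable.aestronglyMeasurable
      (measurable_consPath i).aemeasurable]
    have h2 := Φ.integrable_comp_coding hp hS (shift 1 ω) (F := F ∘ Φ.map i)
      (hF.comp (Φ.analytic i).continuousOn (Φ.mapsTo i))
    refine h2.congr (Eventually.of_forall fun u => ?_)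
    simp [coding_consPath]
  rw [average, pathMeasure_eq_sum hp hS ω, integral_finsetSum_measure hint]
  rw [← Finset.sum_subset (Finset.subset_univ (S (ω 0)))]
  · refine Finset.sum_congr rfl fun i _ => ?_
    rw [integral_smul_measure, ENNReal.toReal_ofReal (branchWeight_nonneg hp _ _),
      integral_map (measurable_consPath i).aemeasurable hc.measurable.aestronglyMeasurable]
    simp [coding_consPath, average]
  · intro i _ hi
    simp [branchWeight_eq_zero hi]

variable (S) in
/-- `v` is a prefix of an infinite word that is admissible for the parameter `ω`. -/
def IsAdmissible : (ℕ → Fin n) → List (Fin n) → Prop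
  | _, [] => True
  | ω, i :: v => i ∈ S (ω 0) ∧ IsAdmissible (shift 1 ω) v

theorem exists_isAdmissible (hS : ∀ k, (S k).Nonempty) (m : ℕ) (ω : ℕ → Fin n) :
    ∃ v : List (Fin n), v.length = m ∧ IsAdmissible S ω v := by
  induction m generalizing ω with
  | zero => exact ⟨[], rfl, trivial⟩
  | succ m ih =>
    obtain ⟨v, hv, hva⟩ := ih (shift 1 ω)
    obtain ⟨i, hi⟩ := hS (ω 0)
    exact ⟨i :: v, by simp [hv], hi, hva⟩

/-- Iterating self-similarity along `u` and dropping all other branches, which are nonnegative,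
costs at most a factor w₀ per letter. -/
theorem pow_mul_average_le {w₀ : ℝ} (hw₀ : 0 < w₀)
    (hw : ∀ k, ∀ i ∈ S k, w₀ ≤ branchWeight p S k i)
    (hp : ∀ i, 0 < p i) (hS : ∀ k, (S k).Nonempty) {u : List (Fin n)} {ω : ℕ → Fin n}
    (hu : IsAdmissible S ω u) {F : ℂ → ℝ} (hF : ContinuousOn F disc) (hF0 : ∀ x ∈ disc, 0 ≤ F x) :
    w₀ ^ u.length * Φ.average p S (shift u.length ω) (F ∘ Φ.word u) ≤ Φ.average p S ω F := by
  induction u generalizing ω F with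
  | nil => simp [word, shift_zero]
  | cons i u ih =>
    have hFi : ContinuousOn (F ∘ Φ.map i) disc :=
      hF.comp (Φ.analytic i).continuousOn (Φ.mapsTo i)
    have h1 := ih hu.2 hFi (fun x hx => hF0 _ (Φ.mapsTo i hx))
    rw [shift_shift] at h1
    have h2 : branchWeight p S (ω 0) i * Φ.average p S (shift 1 ω) (F ∘ Φ.map i) ≤
        Φ.average p S ω F := by
      rw [Φ.average_eq_sum hp hS ω hF]
      refine Finset.single_le_sum (f := fun i => branchWeight p S (ω 0) i *
        Φ.average p S (shift 1 ω) (F ∘ Φ.map i)) (fun j _ => ?_) hu.1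
      exact mul_nonneg (branchWeight_nonneg hp _ _)
        (Φ.average_nonneg _ fun x hx => hF0 _ (Φ.mapsTo j hx))
    have h3 : 0 ≤ Φ.average p S (shift 1 ω) (F ∘ Φ.map i) :=
      Φ.average_nonneg _ fun x hx => hF0 _ (Φ.mapsTo i hx)
    have h4 := mul_le_mul_of_nonneg_right (hw (ω 0) i hu.1) h3
    have h5 := mul_le_mul_of_nonneg_left h1 hw₀.le
    have h6 : (i :: u).length = 1 + u.length := by simp [add_comm]
    rw [h6, pow_add, pow_one, mul_assoc]
    exact (h5.trans h4).trans h2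

/-- If an inequality between averages holds on all cylinders whose size is comparable to `r`, then
it holds globally. -/
theorem average_le_of_cylinders (hp : ∀ i, 0 < p i) (hS : ∀ k, (S k).Nonempty)
    {L κ r c : ℝ} (hL : Φ.HasDistortion L)
    (hκ : ∀ i, ∀ x ∈ disc, κ ≤ ‖deriv (Φ.map i) x‖) (hκ0 : 0 < κ)
    (hr : 0 < r) (hr1 : r ≤ 1) {ω : ℕ → Fin n}
    {F G : ℂ → ℝ} (hF : ContinuousOn F disc) (hG : ContinuousOn G disc)
    (hcyl : ∀ v : List (Fin n), κ / L * r ≤ ‖deriv (Φ.word v) 0‖ → ‖deriv (Φ.word v) 0‖ ≤ r →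
      Φ.average p S (shift v.length ω) (F ∘ Φ.word v) ≤
        c * Φ.average p S (shift v.length ω) (G ∘ Φ.word v)) :
    Φ.average p S ω F ≤ c * Φ.average p S ω G := by
  have hL1 := Φ.one_le_of_hasDistortion hL
  have hL0 : 0 < L := one_pos.trans_le hL1
  -- At depth M every cylinder has derivative below r, so the subdivision stops by then; `k` below
  -- counts the remaining letters.
  obtain ⟨M, hM⟩ := exists_pow_lt_of_lt_one hr Φ.rate_lt_one
  have key : ∀ k : ℕ, ∀ v : List (Fin n), v.length + k = M → κ / L * r ≤ ‖deriv (Φ.word v) 0‖ →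
      Φ.average p S (shift v.length ω) (F ∘ Φ.word v) ≤
        c * Φ.average p S (shift v.length ω) (G ∘ Φ.word v) := by
    intro k
    induction k with
    | zero =>
      intro v hv hge
      refine hcyl v hge ((Φ.norm_deriv_word_le v zero_mem_disc).trans ?_)
      rw [add_zero] at hv
      rw [hv]
      exact hM.le
    | succ k ih =>
      intro v hv hge
      rcases le_or_gt ‖deriv (Φ.word v) 0‖ r with hle | hgt
      · exact hcyl v hge hle
      have hFv := hF.comp (Φ.continuousOn_word v) (Φ.word_mapsTo v)
      have hGv := hG.comp (Φ.continuousOn_word v) (Φ.word_mapsTo v)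
      -- A cylinder that is still too large is divided once more. One letter reduces the derivative
      -- at 0 by a factor no smaller than κ/L, so the lower size bound survives.
      rw [Φ.average_eq_sum hp hS _ hFv, Φ.average_eq_sum hp hS _ hGv, Finset.mul_sum]
      refine Finset.sum_le_sum fun i _ => ?_
      have h1 := ih (v ++ [i]) (by simp; omega) ?_
      · rw [word_append, word_singleton, List.length_append, List.length_singleton] at h1
        rw [shift_shift]
        have h2 := mul_le_mul_of_nonneg_left h1
          (branchWeight_nonneg (S := S) hp (shift v.length ω 0) i)
        rw [mul_left_comm] at h2
        exact h2
      · rw [Φ.deriv_word_append _ _ zero_mem_disc, norm_mul, word_singleton]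
        have h2 := hL v 0 zero_mem_disc (Φ.map i 0) (Φ.mapsTo i zero_mem_disc)
        have h3 := hκ i 0 zero_mem_disc
        have h4 : r / L ≤ ‖deriv (Φ.word v) (Φ.map i 0)‖ := by
          rw [div_le_iff₀ hL0, mul_comm]
          linarith
        calc κ / L * r = r / L * κ := by ring
          _ ≤ _ := mul_le_mul h4 h3 hκ0.le (norm_nonneg _)
  have h := key M [] (by simp) ?_
  · simpa [word, shift_zero] using h
  · have hκ1 : κ ≤ 1 ∨ IsEmpty (Fin n) := by
      rcases isEmpty_or_nonempty (Fin n) with h | ⟨⟨i⟩⟩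
      · exact Or.inr h
      · exact Or.inl ((hκ i 0 zero_mem_disc).trans (Φ.norm_deriv_lt_one i 0 zero_mem_disc).le)
    rcases hκ1 with h | h
    · simp only [word, deriv_id, norm_one]
      have : κ / L ≤ 1 := (div_le_one hL0).2 (h.trans hL1)
      exact mul_le_one₀ this hr.le hr1
    · exact h.elim (ω 0)

/-- A gain on a sub-cylinder gives a gain on average. -/
theorem average_le_of_subcylinder {w₀ : ℝ} (hw₀ : 0 < w₀)
    (hw : ∀ k, ∀ i ∈ S k, w₀ ≤ branchWeight p S k i)
    (hp : ∀ i, 0 < p i) (hS : ∀ k, (S k).Nonempty) {u : List (Fin n)} {ω : ℕ → Fin n}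
    (hu : IsAdmissible S ω u) {F G : ℂ → ℝ} (hF : ContinuousOn F disc) (hG : ContinuousOn G disc)
    (hFG : ∀ x ∈ disc, F x ≤ G x) {γ : ℝ} (hγ : 0 ≤ γ)
    (hgain : ∀ x ∈ disc, F (Φ.word u x) ≤ (1 - γ) * G (Φ.word u x))
    (hosc : ∀ x ∈ disc, ∀ y ∈ disc, G x ≤ 2 * G y) :
    Φ.average p S ω F ≤ (1 - w₀ ^ u.length * γ / 4) * Φ.average p S ω G := by
  have h1 := Φ.pow_mul_average_le hw₀ hw hp hS hu (F := fun x => G x - F x) (hG.sub hF)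
    fun x hx => sub_nonneg.2 (hFG x hx)
  rw [Φ.average_sub hp hS ω hG hF] at h1
  have hFu := hF.comp (Φ.continuousOn_word u) (Φ.word_mapsTo u)
  have hGu := hG.comp (Φ.continuousOn_word u) (Φ.word_mapsTo u)
  -- The factor 4 in the gain is 2·2: the oscillation bound for G is used once to bound G below on
  -- the sub-cylinder and once to bound its average above, both by comparison with G(0).
  have h2 : γ * (G 0 / 2) ≤
      Φ.average p S (shift u.length ω) ((fun x => G x - F x) ∘ Φ.word u) := by
    rw [← Φ.average_const hp hS (shift u.length ω) (γ * (G 0 / 2))]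
    refine Φ.average_mono hp hS _ continuousOn_const (hGu.sub hFu) fun x hx => ?_
    have h3 := hgain x hx
    have h4 := hosc 0 zero_mem_disc _ (Φ.word_mapsTo u hx)
    simp only [Function.comp_apply]
    nlinarith
  have h5 : Φ.average p S ω G ≤ 2 * G 0 := by
    rw [← Φ.average_const hp hS ω (2 * G 0)]
    exact Φ.average_mono hp hS _ hG continuousOn_const fun x hx => hosc x hx 0 zero_mem_disc
  have h6 : γ / 4 * Φ.average p S ω G ≤
      Φ.average p S (shift u.length ω) ((fun x => G x - F x) ∘ Φ.word u) := by
    refine le_trans ?_ h2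
    nlinarith
  have h7 := mul_le_mul_of_nonneg_left h6 (pow_nonneg hw₀.le u.length)
  linarith

end Average

end DiscIFS

/-! ### Calculus on `C¹(D)` -/

theorem ext_coe (g : disc → ℂ) (x : disc) : ext g x = g x := ext_of_mem g x.2

theorem contDiffOn_ext (g : C1D) : ContDiffOn ℝ 1 (ext g.1) disc := g.2

theorem continuousOn_ext (g : C1D) : ContinuousOn (ext g.1) disc := (contDiffOn_ext g).continuousOn

theorem hasFDerivWithinAt_ext (g : C1D) {x : ℂ} (hx : x ∈ disc) :
    HasFDerivWithinAt (ext g.1) (fderivWithin ℝ (ext g.1) disc x) disc x :=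
  ((contDiffOn_ext g).differentiableOn one_ne_zero x hx).hasFDerivWithinAt

theorem bddAbove_norm (g : C1D) : BddAbove (Set.range fun x => ‖g.1 x‖) := by
  obtain ⟨C, hC⟩ := isCompact_disc.exists_bound_of_continuousOn (continuousOn_ext g)
  refine ⟨C, ?_⟩
  rintro _ ⟨x, rfl⟩
  simpa [ext_coe] using hC x x.2

theorem exists_bound_fderivWithin {F : ℂ → ℂ} (hF : ContDiffOn ℝ 1 F disc) :
    ∃ C : ℝ, ∀ x ∈ disc, ‖fderivWithin ℝ F disc x‖ ≤ C :=
  isCompact_disc.exists_bound_of_continuousOn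
    (hF.continuousOn_fderivWithin uniqueDiffOn_disc le_rfl)

theorem bddAbove_gradNorm (g : C1D) : BddAbove (Set.range fun x => gradNorm g.1 x) := by
  obtain ⟨C, hC⟩ := exists_bound_fderivWithin (contDiffOn_ext g)
  refine ⟨C, ?_⟩
  rintro _ ⟨x, rfl⟩
  exact hC x x.2

theorem norm_le_c1Norm (g : C1D) (x : disc) : ‖g.1 x‖ ≤ c1Norm g :=
  (le_ciSup (bddAbove_norm g) x).trans
    (le_add_of_nonneg_right (Real.iSup_nonneg fun _ => norm_nonneg _))

theorem gradNorm_le_c1Norm (g : C1D) (x : disc) : gradNorm g.1 x ≤ c1Norm g :=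
  (le_ciSup (bddAbove_gradNorm g) x).trans
    (le_add_of_nonneg_left (Real.iSup_nonneg fun _ => norm_nonneg _))

/-- Members of a cone satisfy a Harnack inequality. -/
theorem re_le_exp_mul_of_mem_cone {H : C1D} {M : ℝ} (hH : H ∈ cone M) {x y : ℂ}
    (hx : x ∈ disc) (hy : y ∈ disc) :
    (ext H.1 x).re ≤ Real.exp (M * ‖x - y‖) * (ext H.1 y).re := by
  have hpos : ∀ z ∈ disc, 0 < (ext H.1 z).re := fun z hz => by
    rw [ext_of_mem _ hz]; exact (hH ⟨z, hz⟩).2.1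
  have hd : ∀ z ∈ disc, HasFDerivWithinAt (fun z => Real.log (ext H.1 z).re)
      ((ext H.1 z).re⁻¹ • Complex.reCLM.comp (fderivWithin ℝ (ext H.1) disc z)) disc z :=
    fun z hz => (Complex.reCLM.hasFDerivAt.comp_hasFDerivWithinAt z ((hasFDerivWithinAt_ext H) hz)).log
      (hpos z hz).ne'
  have hb : ∀ z ∈ disc,
      ‖(ext H.1 z).re⁻¹ • Complex.reCLM.comp (fderivWithin ℝ (ext H.1) disc z)‖ ≤ M := by
    intro z hz
    rw [norm_smul, norm_inv, Real.norm_of_nonneg (hpos z hz).le, inv_mul_le_iff₀ (hpos z hz)]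
    refine (ContinuousLinearMap.opNorm_comp_le _ _).trans ?_
    rw [Complex.reCLM_norm, one_mul, mul_comm, ext_of_mem _ hz]
    exact (hH ⟨z, hz⟩).2.2
  have h1 := convex_disc.norm_image_sub_le_of_norm_hasFDerivWithin_le hd hb hy hx
  have h2 := (le_abs_self _).trans h1
  rw [← Real.log_le_log_iff (hpos x hx) (mul_pos (Real.exp_pos _) (hpos y hy)),
    Real.log_mul (Real.exp_pos _).ne' (hpos y hy).ne', Real.log_exp]
  linarith

/-- A function dominated by a member of the cone has a Lipschitz quotient. -/
theorem norm_div_sub_div_le {H f : C1D} {M : ℝ} (hH : H ∈ cone M)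
    (hf : ∀ x, ‖f.1 x‖ ≤ (H.1 x).re) (hf' : ∀ x, gradNorm f.1 x ≤ M * (H.1 x).re) {x y : ℂ}
    (hx : x ∈ disc) (hy : y ∈ disc) :
    ‖ext f.1 x / (ext H.1 x).re - ext f.1 y / (ext H.1 y).re‖ ≤ 2 * M * ‖x - y‖ := by
  have hpos : ∀ z ∈ disc, 0 < (ext H.1 z).re := fun z hz => by
    rw [ext_of_mem _ hz]; exact (hH ⟨z, hz⟩).2.1
  set D : ℂ → ℂ →L[ℝ] ℂ := fun z => fderivWithin ℝ (ext H.1) disc z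
  have hre : ∀ z ∈ disc, HasFDerivWithinAt (fun z => (ext H.1 z).re⁻¹)
      ((-((ext H.1 z).re ^ 2)⁻¹) • Complex.reCLM.comp (D z)) disc z := fun z hz =>
    (hasDerivAt_inv (hpos z hz).ne').comp_hasFDerivWithinAt z
      (Complex.reCLM.hasFDerivAt.comp_hasFDerivWithinAt z ((hasFDerivWithinAt_ext H) hz))
  have hd : ∀ z ∈ disc, HasFDerivWithinAt (fun z => (ext H.1 z).re⁻¹ • ext f.1 z)
      ((ext H.1 z).re⁻¹ • fderivWithin ℝ (ext f.1) disc z +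
        ((-((ext H.1 z).re ^ 2)⁻¹) • Complex.reCLM.comp (D z)).smulRight (ext f.1 z)) disc z :=
    fun z hz => (hre z hz).smul ((hasFDerivWithinAt_ext f) hz)
  have hb : ∀ z ∈ disc, ‖(ext H.1 z).re⁻¹ • fderivWithin ℝ (ext f.1) disc z +
      ((-((ext H.1 z).re ^ 2)⁻¹) • Complex.reCLM.comp (D z)).smulRight (ext f.1 z)‖ ≤ 2 * M := by
    intro z hz
    have hz0 := hpos z hz
    have e1 : ‖fderivWithin ℝ (ext f.1) disc z‖ ≤ M * (ext H.1 z).re := by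
      rw [ext_of_mem _ hz]; exact hf' ⟨z, hz⟩
    have e2 : ‖D z‖ ≤ M * (ext H.1 z).re := by
      rw [ext_of_mem _ hz]; exact (hH ⟨z, hz⟩).2.2
    have e3 : ‖ext f.1 z‖ ≤ (ext H.1 z).re := by
      rw [ext_of_mem _ hz, ext_of_mem _ hz]; exact hf ⟨z, hz⟩
    have e4 : ‖Complex.reCLM.comp (D z)‖ ≤ M * (ext H.1 z).re := by
      refine (ContinuousLinearMap.opNorm_comp_le _ _).trans ?_
      rwa [Complex.reCLM_norm, one_mul]
    refine (norm_add_le _ _).trans ?_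
    rw [norm_smul, ContinuousLinearMap.norm_smulRight_apply, norm_smul, norm_neg, norm_inv,
      norm_inv, norm_pow, Real.norm_of_nonneg hz0.le]
    set t := (ext H.1 z).re
    have f1 : t⁻¹ * ‖fderivWithin ℝ (ext f.1) disc z‖ ≤ t⁻¹ * (M * t) := by gcongr
    have f2 : (t ^ 2)⁻¹ * ‖Complex.reCLM.comp (D z)‖ * ‖ext f.1 z‖ ≤ (t ^ 2)⁻¹ * (M * t) * t := by
      have hMt : 0 ≤ M * t := (norm_nonneg _).trans e4
      gcongr
    have f3 : t⁻¹ * (M * t) = M := by field_simp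
    have f4 : (t ^ 2)⁻¹ * (M * t) * t = M := by field_simp
    linarith
  have h1 := convex_disc.norm_image_sub_le_of_norm_hasFDerivWithin_le hd hb hy hx
  simp only [Complex.real_smul, Complex.ofReal_inv, inv_mul_eq_div] at h1
  exact h1

/-! ### Weighted composition operators -/

section WeightedOp

variable {ι : Type*} (s : Finset ι) {w F : ι → ℂ → ℂ}

/-- The operator `g ↦ ∑ wᵢ · g ∘ Fᵢ` on `C¹(D)`. -/
def weightedOp (hw : ∀ i, ContDiffOn ℝ 1 (w i) disc) (hF : ∀ i, ContDiffOn ℝ 1 (F i) disc)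
    (hm : ∀ i, Set.MapsTo (F i) disc disc) : C1D →ₗ[ℂ] C1D where
  toFun g := ⟨fun x => ∑ i ∈ s, w i x * ext g.1 (F i x), by
    have h : ContDiffOn ℝ 1 (fun x => ∑ i ∈ s, w i x * ext g.1 (F i x)) disc :=
      ContDiffOn.sum fun i _ => (hw i).mul ((contDiffOn_ext g).comp (hF i) (hm i))
    exact h.congr fun z hz => by rw [ext_of_mem _ hz]⟩
  map_add' g h := by
    ext x
    simp only [Submodule.coe_add, Pi.add_apply, ← Finset.sum_add_distrib]
    refine Finset.sum_congr rfl fun i _ => ?_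
    rw [ext_of_mem _ (hm i x.2), ext_of_mem _ (hm i x.2), ext_of_mem _ (hm i x.2), ← mul_add]
    rfl
  map_smul' c g := by
    ext x
    simp only [Submodule.coe_smul, Pi.smul_apply, smul_eq_mul, RingHom.id_apply, Finset.mul_sum]
    refine Finset.sum_congr rfl fun i _ => ?_
    rw [ext_of_mem _ (hm i x.2), ext_of_mem _ (hm i x.2), mul_left_comm]
    rfl

variable (hw : ∀ i, ContDiffOn ℝ 1 (w i) disc) (hF : ∀ i, ContDiffOn ℝ 1 (F i) disc)
    (hm : ∀ i, Set.MapsTo (F i) disc disc)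

theorem weightedOp_apply (g : C1D) (x : disc) :
    (weightedOp s hw hF hm g).1 x = ∑ i ∈ s, w i x * ext g.1 (F i x) := rfl

theorem gradNorm_weightedOp_le (g : C1D) (x : disc) :
    gradNorm (weightedOp s hw hF hm g).1 x ≤ ∑ i ∈ s,
      (‖fderivWithin ℝ (w i) disc x‖ * ‖ext g.1 (F i x)‖ +
        ‖w i x‖ * (‖fderivWithin ℝ (F i) disc x‖ *
          ‖fderivWithin ℝ (ext g.1) disc (F i x)‖)) := by
  have hd : ∀ i, HasFDerivWithinAt (fun z => w i z * ext g.1 (F i z))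
      (w i x • (fderivWithin ℝ (ext g.1) disc (F i x)).comp (fderivWithin ℝ (F i) disc x) +
        ext g.1 (F i x) • fderivWithin ℝ (w i) disc x) disc x := by
    intro i
    have h1 := (((hw i).differentiableOn one_ne_zero) x x.2).hasFDerivWithinAt
    have h2 := (((hF i).differentiableOn one_ne_zero) x x.2).hasFDerivWithinAt
    exact h1.mul (((hasFDerivWithinAt_ext g) (hm i x.2)).comp x.1 h2 (hm i))
  have hs := HasFDerivWithinAt.fun_sum (u := s) fun i _ => hd i
  have hs' := hs.congr (f₁ := ext (weightedOp s hw hF hm g).1)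
    (fun z hz => by rw [ext_of_mem _ hz]; rfl) (by rw [ext_of_mem _ x.2]; rfl)
  rw [gradNorm, hs'.fderivWithin (uniqueDiffOn_disc x x.2)]
  refine (norm_sum_le _ _).trans (Finset.sum_le_sum fun i _ => ?_)
  refine (norm_add_le _ _).trans ?_
  rw [norm_smul, norm_smul, add_comm, mul_comm ‖ext g.1 (F i x)‖]
  gcongr
  rw [mul_comm]
  exact ContinuousLinearMap.opNorm_comp_le _ _

theorem isBoundedOp_weightedOp : IsBoundedOp (weightedOp s hw hF hm) := by
  choose C₁ hC₁ using fun i => isCompact_disc.exists_bound_of_continuousOn (hw i).continuousOn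
  choose C₂ hC₂ using fun i => exists_bound_fderivWithin (hw i)
  choose C₃ hC₃ using fun i => exists_bound_fderivWithin (hF i)
  have h1 : ∀ i, 0 ≤ C₁ i := fun i => (norm_nonneg _).trans (hC₁ i 0 zero_mem_disc)
  have h2 : ∀ i, 0 ≤ C₂ i := fun i => (norm_nonneg _).trans (hC₂ i 0 zero_mem_disc)
  have h3 : ∀ i, 0 ≤ C₃ i := fun i => (norm_nonneg _).trans (hC₃ i 0 zero_mem_disc)
  refine ⟨∑ i ∈ s, C₁ i + ∑ i ∈ s, (C₂ i + C₁ i * C₃ i), fun g => ?_⟩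
  have hg0 : 0 ≤ c1Norm g := (norm_nonneg _).trans (norm_le_c1Norm g ⟨0, zero_mem_disc⟩)
  have hgb : ∀ z ∈ disc, ‖ext g.1 z‖ ≤ c1Norm g := fun z hz => by
    rw [ext_of_mem _ hz]; exact norm_le_c1Norm g _
  have hgb' : ∀ z ∈ disc, ‖fderivWithin ℝ (ext g.1) disc z‖ ≤ c1Norm g := fun z hz =>
    gradNorm_le_c1Norm g ⟨z, hz⟩
  rw [add_mul, Finset.sum_mul, Finset.sum_mul]
  refine add_le_add (ciSup_le fun x => ?_) (ciSup_le fun x => ?_)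
  · rw [weightedOp_apply]
    refine (norm_sum_le _ _).trans (Finset.sum_le_sum fun i _ => ?_)
    rw [norm_mul]
    exact mul_le_mul (hC₁ i x x.2) (hgb _ (hm i x.2)) (norm_nonneg _) (h1 i)
  · refine (gradNorm_weightedOp_le s hw hF hm g x).trans (Finset.sum_le_sum fun i _ => ?_)
    rw [add_mul, mul_assoc]
    refine add_le_add ?_ ?_
    · exact mul_le_mul (hC₂ i x x.2) (hgb _ (hm i x.2)) (norm_nonneg _) (h2 i)
    · exact mul_le_mul (hC₁ i x x.2) (mul_le_mul (hC₃ i x x.2) (hgb' _ (hm i x.2)) (norm_nonneg _)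
        (h3 i)) (mul_nonneg (norm_nonneg _) (norm_nonneg _)) (h1 i)

/-- The Lasota-Yorke type estimate. -/
theorem gradNorm_weightedOp_le_of_bounds {g : C1D} {h : ℂ → ℝ} {M E θ : ℝ}
    (hg : ∀ z ∈ disc, ‖ext g.1 z‖ ≤ h z)
    (hg' : ∀ z ∈ disc, ‖fderivWithin ℝ (ext g.1) disc z‖ ≤ M * h z) (x : disc)
    (hE : ∀ i, ‖fderivWithin ℝ (w i) disc x‖ ≤ E * ‖w i x‖)
    (hθ : ∀ i ∈ s, ‖fderivWithin ℝ (F i) disc x‖ ≤ θ) :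
    gradNorm (weightedOp s hw hF hm g).1 x ≤ (E + θ * M) * ∑ i ∈ s, ‖w i x‖ * h (F i x) := by
  refine (gradNorm_weightedOp_le s hw hF hm g x).trans ?_
  rw [Finset.mul_sum]
  refine Finset.sum_le_sum fun i hi => ?_
  have hx := hm i x.2
  have e1 : ‖fderivWithin ℝ (w i) disc x‖ * ‖ext g.1 (F i x)‖ ≤ E * ‖w i x‖ * h (F i x) :=
    mul_le_mul (hE i) (hg _ hx) (norm_nonneg _) ((norm_nonneg _).trans (hE i))
  have e2 : ‖fderivWithin ℝ (F i) disc x‖ * ‖fderivWithin ℝ (ext g.1) disc (F i x)‖ ≤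
      θ * (M * h (F i x)) :=
    mul_le_mul (hθ i hi) (hg' _ hx) (norm_nonneg _) ((norm_nonneg _).trans (hθ i hi))
  have e3 := mul_le_mul_of_nonneg_left e2 (norm_nonneg (w i x))
  linarith

end WeightedOp

/-! ### The cocycle weights -/

namespace DiscIFS

variable {n : ℕ} (Φ : DiscIFS n)

/-- The factor `e^{2π s c(η, x)} e^{i ℓ θ(η, x)}` of the transfer operator, written with a
holomorphic logarithm of the derivative. -/
def cocycleWeight (s : ℂ) (ℓ : ℤ) (η : List (Fin n)) (x : ℂ) : ℂ :=
  Complex.exp (-(2 * Real.pi * s * ((Φ.wordLog η x).re : ℂ)) +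
    Complex.I * ℓ * ((Φ.wordLog η x).im : ℂ))

theorem contDiffOn_cocycleWeight (s : ℂ) (ℓ : ℤ) (η : List (Fin n)) :
    ContDiffOn ℝ 1 (Φ.cocycleWeight s ℓ η) disc := by
  have hh : ContDiffOn ℝ 1 (Φ.wordLog η) disc := fun z hz =>
    (((Φ.wordLog_analytic η) z hz).contDiffAt.restrict_scalars ℝ).contDiffWithinAt
  have hre : ContDiffOn ℝ 1 (fun z => ((Φ.wordLog η z).re : ℂ)) disc :=
    (Complex.ofRealCLM.comp Complex.reCLM).contDiff.comp_contDiffOn hh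
  have him : ContDiffOn ℝ 1 (fun z => ((Φ.wordLog η z).im : ℂ)) disc :=
    (Complex.ofRealCLM.comp Complex.imCLM).contDiff.comp_contDiffOn hh
  exact ((contDiffOn_const.mul hre).neg.add (contDiffOn_const.mul him)).cexp

theorem norm_cocycleWeight (a b : ℝ) (ℓ : ℤ) (η : List (Fin n)) (x : ℂ) :
    ‖Φ.cocycleWeight (a + b * Complex.I) ℓ η x‖ =
      Real.exp (-(2 * Real.pi * a * (Φ.wordLog η x).re)) := by
  rw [cocycleWeight, Complex.norm_exp]
  congr 1
  simp

theorem cocycleWeight_zero (η : List (Fin n)) (x : ℂ) : Φ.cocycleWeight 0 0 η x = 1 := by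
  simp [cocycleWeight]

theorem cocycleWeight_ofReal (a : ℝ) (η : List (Fin n)) (x : ℂ) :
    Φ.cocycleWeight a 0 η x = (Real.exp (-(2 * Real.pi * a * (Φ.wordLog η x).re)) : ℝ) := by
  simp [cocycleWeight]

/-- The weight is an exponential, so its relative gradient is that of the exponent, and the real and
imaginary parts of the logarithm have the same gradient bound Ct. -/
theorem norm_fderivWithin_cocycleWeight_le {Ct : ℝ}
    (hCt : ∀ η : List (Fin n), ∀ x ∈ disc, ‖deriv (Φ.wordLog η) x‖ ≤ Ct)
    (s : ℂ) (ℓ : ℤ) (η : List (Fin n)) {x : ℂ} (hx : x ∈ disc) :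
    ‖fderivWithin ℝ (Φ.cocycleWeight s ℓ η) disc x‖ ≤
      (2 * Real.pi * ‖s‖ + |(ℓ : ℝ)|) * Ct * ‖Φ.cocycleWeight s ℓ η x‖ := by
  set D : ℂ →L[ℝ] ℂ :=
    (ContinuousLinearMap.toSpanSingleton ℂ (deriv (Φ.wordLog η) x)).restrictScalars ℝ with hD
  have hh : HasFDerivAt (Φ.wordLog η) D x :=
    (Φ.hasDerivAt_wordLog η hx).hasFDerivAt.restrictScalars ℝ
  have hDn : ‖D‖ ≤ Ct := by
    rw [hD, ContinuousLinearMap.norm_restrictScalars, ContinuousLinearMap.norm_toSpanSingleton]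
    exact hCt η x hx
  have hre : HasFDerivAt (fun z => ((Φ.wordLog η z).re : ℂ))
      ((Complex.ofRealCLM.comp Complex.reCLM).comp D) x :=
    (Complex.ofRealCLM.comp Complex.reCLM).hasFDerivAt.comp x hh
  have him : HasFDerivAt (fun z => ((Φ.wordLog η z).im : ℂ))
      ((Complex.ofRealCLM.comp Complex.imCLM).comp D) x :=
    (Complex.ofRealCLM.comp Complex.imCLM).hasFDerivAt.comp x hh
  have hw := ((hre.const_mul (2 * Real.pi * s)).neg.add
    (him.const_mul (Complex.I * ℓ))).cexp
  have e := (hw.hasFDerivWithinAt (s := disc)).fderivWithin (uniqueDiffOn_disc x hx)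
  have e' : fderivWithin ℝ (Φ.cocycleWeight s ℓ η) disc x = _ := e
  rw [e', norm_smul, mul_comm]
  refine mul_le_mul_of_nonneg_right ?_ (norm_nonneg _)
  have b1 : ‖(Complex.ofRealCLM.comp Complex.reCLM).comp D‖ ≤ Ct := by
    refine ContinuousLinearMap.opNorm_le_bound _ ((norm_nonneg _).trans hDn) fun v => ?_
    calc ‖(((D v).re : ℝ) : ℂ)‖ ≤ ‖D v‖ := by rw [Complex.norm_real]; exact Complex.abs_re_le_norm _
      _ ≤ Ct * ‖v‖ := D.le_of_opNorm_le hDn v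
  have b2 : ‖(Complex.ofRealCLM.comp Complex.imCLM).comp D‖ ≤ Ct := by
    refine ContinuousLinearMap.opNorm_le_bound _ ((norm_nonneg _).trans hDn) fun v => ?_
    calc ‖(((D v).im : ℝ) : ℂ)‖ ≤ ‖D v‖ := by rw [Complex.norm_real]; exact Complex.abs_im_le_norm _
      _ ≤ Ct * ‖v‖ := D.le_of_opNorm_le hDn v
  refine (norm_add_le _ _).trans ?_
  rw [norm_neg, norm_smul, norm_smul, add_mul]
  refine add_le_add ?_ ?_
  · have : ‖(2 * Real.pi * s : ℂ)‖ = 2 * Real.pi * ‖s‖ := by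
      simp [abs_of_pos Real.pi_pos]
    rw [this]
    gcongr
  · have : ‖(Complex.I * ℓ : ℂ)‖ = |(ℓ : ℝ)| := by simp
    rw [this]
    gcongr

theorem contDiffOn_word (η : List (Fin n)) : ContDiffOn ℝ 1 (Φ.word η) disc := fun z hz =>
  ((Φ.word_analytic η z hz).contDiffAt.restrict_scalars ℝ).contDiffWithinAt

theorem norm_fderivWithin_word_le (η : List (Fin n)) {x : ℂ} (hx : x ∈ disc) :
    ‖fderivWithin ℝ (Φ.word η) disc x‖ ≤ Φ.rate ^ η.length := by
  have h := ((Φ.differentiableAt_word η hx).hasDerivAt.hasFDerivAt.restrictScalars ℝ)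
  rw [(h.hasFDerivWithinAt (s := disc)).fderivWithin (uniqueDiffOn_disc x hx),
    ContinuousLinearMap.norm_restrictScalars, ContinuousLinearMap.norm_toSpanSingleton]
  exact Φ.norm_deriv_word_le η hx

variable (p : Fin n → ℝ) (S : Fin n → Finset (Fin n))

/-- The sum is rewritten with smooth exponents; integrality of ℓ lets the power of the exponential
of the angle become an exponential. -/
theorem transferFun_eq (s : ℂ) (ℓ : ℤ) (ω : ℕ → Fin n) (N : ℕ) (g : disc → ℂ) (x : disc) :
    Φ.transferFun p S s ℓ ω N g x = ∑ J ∈ words S N ω,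
      (wordWeight p S ω J : ℂ) * Φ.cocycleWeight s ℓ (List.ofFn J) x *
        ext g (Φ.word (List.ofFn J) x) := by
  refine Finset.sum_congr rfl fun J _ => ?_
  rw [normCocycle, angleCocycle, Φ.log_norm_deriv_word _ x.2, Φ.exp_arg_deriv_word _ x.2,
    ← Complex.exp_int_mul, mul_assoc (wordWeight p S ω J : ℂ), ← Complex.exp_add, cocycleWeight]
  congr 3
  push_cast
  ring

theorem contDiffOn_const_mul_cocycleWeight (c : ℂ) (s : ℂ) (ℓ : ℤ) (η : List (Fin n)) :
    ContDiffOn ℝ 1 (fun x => c * Φ.cocycleWeight s ℓ η x) disc :=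
  contDiffOn_const.mul (Φ.contDiffOn_cocycleWeight s ℓ η)

theorem transfer_eq_weightedOp (s : ℂ) (ℓ : ℤ) (ω : ℕ → Fin n) (N : ℕ) (g : C1D) :
    Φ.transfer p S s ℓ ω N g = weightedOp (words S N ω)
      (fun J => Φ.contDiffOn_const_mul_cocycleWeight (wordWeight p S ω J) s ℓ (List.ofFn J))
      (fun J => Φ.contDiffOn_word (List.ofFn J)) (fun J => Φ.word_mapsTo (List.ofFn J)) g :=
  Subtype.ext (funext fun x => Φ.transferFun_eq p S s ℓ ω N g.1 x)

end DiscIFS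

/-! ### Smooth bumps centred at lattice points -/

/-- A smooth bump that is `1` on the ball of radius `2` and vanishes off the ball of radius `3`. -/
def bump : ContDiffBump (0 : ℂ) := ⟨2, 3, by norm_num, by norm_num⟩

theorem bump_eq_one {z : ℂ} (hz : ‖z‖ ≤ 2) : bump z = 1 :=
  bump.one_of_mem_closedBall (by simpa [bump] using hz)

theorem bump_eq_zero {z : ℂ} (hz : 3 ≤ ‖z‖) : bump z = 0 :=
  bump.zero_of_le_dist (by simpa [bump] using hz)

theorem contDiff_bump : ContDiff ℝ 1 (bump : ℂ → ℝ) := bump.contDiff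

theorem exists_bound_fderiv_bump : ∃ C : ℝ, 0 ≤ C ∧ ∀ z, ‖fderiv ℝ (bump : ℂ → ℝ) z‖ ≤ C := by
  obtain ⟨C, hC⟩ := (bump.hasCompactSupport.fderiv ℝ).exists_bound_of_continuous
    (contDiff_bump.continuous_fderiv one_ne_zero)
  exact ⟨C, (norm_nonneg _).trans (hC 0), hC⟩

theorem fderiv_bump_eq_zero {z : ℂ} (hz : 3 < ‖z‖) : fderiv ℝ (bump : ℂ → ℝ) z = 0 := by
  by_contra h
  have h1 : z ∈ tsupport (bump : ℂ → ℝ) := support_fderiv_subset ℝ h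
  rw [bump.tsupport_eq, mem_closedBall_zero_iff] at h1
  exact absurd hz (not_lt.2 h1)

/-- The Gaussian integer with given coordinates. -/
def latticePoint (c : ℤ × ℤ) : ℂ := ⟨c.1, c.2⟩

theorem exists_norm_sub_latticePoint_le (y : ℂ) :
    ∃ c : ℤ × ℤ, ‖y - latticePoint c‖ ≤ 1 ∧ |(c.1 : ℝ)| ≤ ‖y‖ + 1 ∧ |(c.2 : ℝ)| ≤ ‖y‖ + 1 := by
  have h1 := abs_sub_round y.re
  have h2 := abs_sub_round y.im
  refine ⟨(round y.re, round y.im), ?_, ?_, ?_⟩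
  · refine (Complex.norm_le_abs_re_add_abs_im _).trans ?_
    simp only [latticePoint, Complex.sub_re, Complex.sub_im]
    linarith
  · have h3 := Complex.abs_re_le_norm y
    have h4 := abs_sub_abs_le_abs_sub (round y.re : ℝ) y.re
    rw [abs_sub_comm] at h4
    simp only
    linarith
  · have h3 := Complex.abs_im_le_norm y
    have h4 := abs_sub_abs_le_abs_sub (round y.im : ℝ) y.im
    rw [abs_sub_comm] at h4
    simp only
    linarith

theorem card_Icc_ceil_floor_le (t : ℝ) : (Finset.Icc ⌈t - 3⌉ ⌊t + 3⌋).card ≤ 7 := by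
  rw [Int.card_Icc, Int.toNat_le]
  have h1 := Int.floor_le (t + 3)
  have h2 := Int.le_ceil (t - 3)
  have h3 : ((⌊t + 3⌋ + 1 - ⌈t - 3⌉ : ℤ) : ℝ) ≤ ((7 : ℕ) : ℤ) := by
    push_cast
    linarith
  exact_mod_cast h3

/-- Each coordinate of such a lattice point is an integer in an interval of length 6, hence one of
at most 7 values. -/
theorem card_filter_latticePoint_le (Γ : Finset (ℤ × ℤ)) (y : ℂ) :
    (Γ.filter fun c => ‖y - latticePoint c‖ ≤ 3).card ≤ 49 := by
  have hsub : (Γ.filter fun c => ‖y - latticePoint c‖ ≤ 3) ⊆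
      Finset.Icc ⌈y.re - 3⌉ ⌊y.re + 3⌋ ×ˢ Finset.Icc ⌈y.im - 3⌉ ⌊y.im + 3⌋ := by
    intro c hc
    have hc3 := (Finset.mem_filter.1 hc).2
    have h1 := abs_le.1 ((Complex.abs_re_le_norm _).trans hc3)
    have h2 := abs_le.1 ((Complex.abs_im_le_norm _).trans hc3)
    simp only [latticePoint, Complex.sub_re, Complex.sub_im] at h1 h2
    simp only [Finset.mem_product, Finset.mem_Icc, Int.ceil_le, Int.le_floor]
    refine ⟨⟨?_, ?_⟩, ?_, ?_⟩ <;> linarith [h1.1, h1.2, h2.1, h2.2]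
  refine (Finset.card_le_card hsub).trans ?_
  rw [Finset.card_product]
  exact Nat.mul_le_mul (card_Icc_ceil_floor_le _) (card_Icc_ceil_floor_le _)

/-- Bounded overlap: sums of bumps, and of their gradients, are bounded independently of the number
of centres and of the scale. -/
theorem sum_le_of_latticePoint (Γ : Finset (ℤ × ℤ)) (y : ℂ) {f : ℤ × ℤ → ℝ} {C : ℝ} (hC : 0 ≤ C)
    (hf : ∀ c, f c ≤ C) (hf0 : ∀ c, 3 < ‖y - latticePoint c‖ → f c = 0) :
    ∑ c ∈ Γ, f c ≤ 49 * C := by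
  rw [← Finset.sum_filter_add_sum_filter_not Γ fun c => ‖y - latticePoint c‖ ≤ 3]
  rw [Finset.sum_eq_zero (s := Γ.filter fun c => ¬ ‖y - latticePoint c‖ ≤ 3), add_zero]
  · refine (Finset.sum_le_card_nsmul _ _ C fun c _ => hf c).trans ?_
    rw [nsmul_eq_mul]
    gcongr
    exact_mod_cast card_filter_latticePoint_le Γ y
  · intro c hc
    exact hf0 c (not_le.1 (Finset.mem_filter.1 hc).2)

/-- The sum of the bumps at scale `σ` centred at the points `σ c`, for `c ∈ Γ`. -/
def bumpSum (σ : ℝ) (Γ : Finset (ℤ × ℤ)) (x : ℂ) : ℝ :=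
  ∑ c ∈ Γ, bump (σ⁻¹ • x - latticePoint c)

theorem bumpSum_nonneg (σ : ℝ) (Γ : Finset (ℤ × ℤ)) (x : ℂ) : 0 ≤ bumpSum σ Γ x :=
  Finset.sum_nonneg fun _ _ => bump.nonneg

theorem bumpSum_le (σ : ℝ) (Γ : Finset (ℤ × ℤ)) (x : ℂ) : bumpSum σ Γ x ≤ 49 := by
  have := sum_le_of_latticePoint Γ (σ⁻¹ • x) (C := 1)
    (f := fun c => bump (σ⁻¹ • x - latticePoint c)) zero_le_one (fun _ => bump.le_one)
    fun c hc => bump_eq_zero hc.le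
  rwa [mul_one] at this

theorem norm_smul_sub_latticePoint {σ : ℝ} (hσ : 0 < σ) (x : ℂ) (c : ℤ × ℤ) :
    ‖σ⁻¹ • x - latticePoint c‖ = σ⁻¹ * ‖x - σ • latticePoint c‖ := by
  have : σ⁻¹ • x - latticePoint c = σ⁻¹ • (x - σ • latticePoint c) := by
    rw [smul_sub, smul_smul, inv_mul_cancel₀ hσ.ne', one_smul]
  rw [this, norm_smul, Real.norm_of_nonneg (inv_nonneg.2 hσ.le)]

theorem one_le_bumpSum {σ : ℝ} (hσ : 0 < σ) {Γ : Finset (ℤ × ℤ)} {c : ℤ × ℤ} (hc : c ∈ Γ) {x : ℂ}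
    (hx : ‖x - σ • latticePoint c‖ ≤ 2 * σ) : 1 ≤ bumpSum σ Γ x := by
  have h1 : bump (σ⁻¹ • x - latticePoint c) = 1 := by
    refine bump_eq_one ?_
    rw [norm_smul_sub_latticePoint hσ, inv_mul_le_iff₀ hσ, mul_comm]
    exact hx
  rw [← h1]
  exact Finset.single_le_sum (f := fun c => bump (σ⁻¹ • x - latticePoint c))
    (fun _ _ => bump.nonneg) hc

theorem exists_of_bumpSum_ne_zero {σ : ℝ} (hσ : 0 < σ) {Γ : Finset (ℤ × ℤ)} {x : ℂ}
    (hx : bumpSum σ Γ x ≠ 0) : ∃ c ∈ Γ, ‖x - σ • latticePoint c‖ ≤ 3 * σ := by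
  obtain ⟨c, hc, hne⟩ := Finset.exists_ne_zero_of_sum_ne_zero hx
  refine ⟨c, hc, ?_⟩
  by_contra h
  refine hne (bump_eq_zero ?_)
  rw [norm_smul_sub_latticePoint hσ, le_inv_mul_iff₀ hσ, mul_comm]
  exact (not_le.1 h).le

theorem contDiff_bumpSum (σ : ℝ) (Γ : Finset (ℤ × ℤ)) : ContDiff ℝ 1 (bumpSum σ Γ) :=
  ContDiff.sum fun _ _ => contDiff_bump.comp ((contDiff_id.const_smul σ⁻¹).sub contDiff_const)

theorem norm_fderiv_bumpSum_le {C : ℝ} (hC0 : 0 ≤ C)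
    (hC : ∀ z, ‖fderiv ℝ (bump : ℂ → ℝ) z‖ ≤ C) {σ : ℝ} (hσ : 0 < σ) (Γ : Finset (ℤ × ℤ)) (x : ℂ) :
    ‖fderiv ℝ (bumpSum σ Γ) x‖ ≤ 49 * (C / σ) := by
  have hd : ∀ c, HasFDerivAt (fun x : ℂ => bump (σ⁻¹ • x - latticePoint c))
      ((fderiv ℝ (bump : ℂ → ℝ) (σ⁻¹ • x - latticePoint c)).comp
        (σ⁻¹ • ContinuousLinearMap.id ℝ ℂ)) x := fun c =>
    ((contDiff_bump.differentiable one_ne_zero _).hasFDerivAt).comp x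
      (((hasFDerivAt_id x).const_smul σ⁻¹).sub_const _)
  have hs : HasFDerivAt (bumpSum σ Γ) (∑ c ∈ Γ,
      (fderiv ℝ (bump : ℂ → ℝ) (σ⁻¹ • x - latticePoint c)).comp
        (σ⁻¹ • ContinuousLinearMap.id ℝ ℂ)) x := HasFDerivAt.fun_sum fun c _ => hd c
  rw [hs.fderiv]
  refine (norm_sum_le _ _).trans ?_
  refine sum_le_of_latticePoint Γ (σ⁻¹ • x) (by positivity) (fun c => ?_) fun c hc => ?_
  · rw [ContinuousLinearMap.comp_smul, ContinuousLinearMap.comp_id, norm_smul, norm_inv,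
      Real.norm_of_nonneg hσ.le, inv_mul_eq_div]
    gcongr
    exact hC _
  · rw [fderiv_bump_eq_zero hc]
    simp

/-- A finite set of lattice points whose dilation by `σ` is `σ`-dense in the disc. -/
def grid (σ : ℝ) : Finset (ℤ × ℤ) :=
  Finset.Icc (-⌈σ⁻¹ + 1⌉) ⌈σ⁻¹ + 1⌉ ×ˢ Finset.Icc (-⌈σ⁻¹ + 1⌉) ⌈σ⁻¹ + 1⌉

theorem exists_mem_grid {σ : ℝ} (hσ : 0 < σ) {x : ℂ} (hx : x ∈ disc) :
    ∃ c ∈ grid σ, ‖x - σ • latticePoint c‖ ≤ σ := by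
  obtain ⟨c, hc, h1, h2⟩ := exists_norm_sub_latticePoint_le (σ⁻¹ • x)
  have hn : ‖σ⁻¹ • x‖ ≤ σ⁻¹ := by
    rw [norm_smul, Real.norm_of_nonneg (inv_nonneg.2 hσ.le)]
    exact mul_le_of_le_one_right (inv_nonneg.2 hσ.le) (norm_le_one_of_mem_disc hx)
  have key : ∀ k : ℤ, |(k : ℝ)| ≤ ‖σ⁻¹ • x‖ + 1 → k ∈ Finset.Icc (-⌈σ⁻¹ + 1⌉) ⌈σ⁻¹ + 1⌉ := by
    intro k hk
    have h3 : |(k : ℝ)| ≤ (⌈σ⁻¹ + 1⌉ : ℝ) := (hk.trans (by linarith)).trans (Int.le_ceil _)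
    rw [Finset.mem_Icc, ← abs_le]
    exact_mod_cast h3
  refine ⟨c, Finset.mem_product.2 ⟨key _ h1, key _ h2⟩, ?_⟩
  rw [norm_smul_sub_latticePoint hσ, inv_mul_le_iff₀ hσ, mul_one] at hc
  exact hc

/-! ### Elementary inequalities for cancellation -/

/-- If there is almost no cancellation in a sum of two vectors, then they are almost aligned. -/
theorem aligned_of_lt_norm {u₁ u₂ : ℂ} (h₁ : ‖u₁‖ ≤ 1) (h₂ : ‖u₂‖ ≤ 1) {a₁ a₂ τ : ℝ} (ha₁ : 0 < a₁)
    (ha : a₁ ≤ 2 * a₂) (hτ1 : τ ≤ 1)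
    (h : (1 - τ) * a₁ + a₂ < ‖(a₁ : ℂ) * u₁ + (a₂ : ℂ) * u₂‖) :
    ‖u₁ - u₂‖ ^ 2 ≤ 8 * τ ∧ 1 - 2 * τ ≤ ‖u₁‖ ∧ 1 - 2 * τ ≤ ‖u₂‖ := by
  -- Equal weights a₁/2 are split off; the rest of the second weight is nonnegative because a₁ ≤
  -- 2a₂. Failure of damping then forces |u₁ + u₂| > 2(1 - τ), and the parallelogram law gives |u₁ -
  -- u₂|² ≤ 4 - 4(1 - τ)² ≤ 8τ.
  have e : (a₁ : ℂ) * u₁ + (a₂ : ℂ) * u₂ =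
      ((a₁ / 2 : ℝ) : ℂ) * (u₁ + u₂) + (((a₁ / 2 : ℝ) : ℂ) * u₁ + ((a₂ - a₁ / 2 : ℝ) : ℂ) * u₂) := by
    push_cast
    ring
  have h3 : ‖(a₁ : ℂ) * u₁ + (a₂ : ℂ) * u₂‖ ≤ a₁ / 2 * ‖u₁ + u₂‖ + a₂ := by
    rw [e]
    refine (norm_add_le _ _).trans ?_
    have h4 := norm_add_le (((a₁ / 2 : ℝ) : ℂ) * u₁) (((a₂ - a₁ / 2 : ℝ) : ℂ) * u₂)
    rw [norm_mul, norm_mul, Complex.norm_real, Complex.norm_real,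
      Real.norm_of_nonneg (by linarith : (0 : ℝ) ≤ a₁ / 2),
      Real.norm_of_nonneg (by linarith : (0 : ℝ) ≤ a₂ - a₁ / 2)] at h4
    rw [norm_mul, Complex.norm_real, Real.norm_of_nonneg (by linarith : (0 : ℝ) ≤ a₁ / 2)]
    nlinarith
  have h5 : 2 * (1 - τ) < ‖u₁ + u₂‖ := by nlinarith
  have h6 := parallelogram_law_with_norm ℝ u₁ u₂
  have h7 := norm_add_le u₁ u₂
  refine ⟨?_, by linarith, by linarith⟩
  nlinarith [norm_nonneg u₁, norm_nonneg u₂, norm_nonneg (u₁ + u₂)]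

/-- For phases of size at most 1 there is no wrap-around modulo 2π, so a phase difference is visible
in the exponential. -/
theorem half_abs_le_norm_exp_sub_one {t : ℝ} (ht : |t| ≤ 1) :
    |t| / 2 ≤ ‖Complex.exp (t * Complex.I) - 1‖ := by
  have h1 : |Real.sin t| ≤ ‖Complex.exp (t * Complex.I) - 1‖ := by
    have := Complex.abs_im_le_norm (Complex.exp (t * Complex.I) - 1)
    rwa [Complex.sub_im, Complex.exp_ofReal_mul_I_im, Complex.one_im, sub_zero] at this
  refine le_trans ?_ h1
  rcases eq_or_ne t 0 with rfl | h0
  · simp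
  have h2 := Real.sin_gt_sub_cube (abs_pos.2 h0)
  have h3 : Real.sin |t| ≤ |Real.sin t| := by
    rcases abs_choice t with h | h <;> rw [h]
    · exact le_abs_self _
    · rw [Real.sin_neg]; exact neg_le_abs _
  have h4 : |t| ^ 3 ≤ |t| := by
    have := abs_nonneg t
    calc |t| ^ 3 = |t| * |t| ^ 2 := by ring
      _ ≤ |t| * 1 := by gcongr; exact pow_le_one₀ this ht
      _ = |t| := mul_one _
  linarith [abs_nonneg t]

/-- If two pairs of vectors are almost aligned, then their relative phases almost agree. -/
theorem norm_exp_sub_one_le_of_aligned {v₁ v₂ v₁' v₂' : ℂ} {θ₁ θ₂ θ₁' θ₂' σ ν : ℝ}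
    (h : ‖Complex.exp (θ₁ * Complex.I) * v₁ - Complex.exp (θ₂ * Complex.I) * v₂‖ ≤ σ)
    (h' : ‖Complex.exp (θ₁' * Complex.I) * v₁' - Complex.exp (θ₂' * Complex.I) * v₂'‖ ≤ σ)
    (h₁ : ‖v₁ - v₁'‖ ≤ ν) (h₂ : ‖v₂ - v₂'‖ ≤ ν) (hv : 1 / 2 ≤ ‖v₁'‖) :
    ‖Complex.exp (((θ₁ - θ₂) - (θ₁' - θ₂') : ℝ) * Complex.I) - 1‖ ≤ 4 * (σ + ν) := by
  have key : ∀ (s t : ℝ) (a b : ℂ), ‖Complex.exp (s * Complex.I) * a -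
      Complex.exp (t * Complex.I) * b‖ = ‖Complex.exp ((s - t : ℝ) * Complex.I) * a - b‖ := by
    intro s t a b
    have : Complex.exp (s * Complex.I) * a - Complex.exp (t * Complex.I) * b =
        Complex.exp (t * Complex.I) * (Complex.exp ((s - t : ℝ) * Complex.I) * a - b) := by
      rw [mul_sub, ← mul_assoc, ← Complex.exp_add]
      congr 3
      push_cast
      ring
    rw [this, norm_mul, Complex.norm_exp_ofReal_mul_I, one_mul]
  rw [key] at h h'
  set E := Complex.exp ((θ₁ - θ₂ : ℝ) * Complex.I)
  set E' := Complex.exp ((θ₁' - θ₂' : ℝ) * Complex.I)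
  have hE : ‖E‖ = 1 := Complex.norm_exp_ofReal_mul_I _
  -- Both relations are transported to the same vector v₁', whose norm is at least 1/2; dividing by
  -- it turns the factor 2 into 4.
  have h3 : ‖E * v₁' - E' * v₁'‖ ≤ 2 * (σ + ν) := by
    have e : E * v₁' - E' * v₁' = (E * v₁ - v₂) - E * (v₁ - v₁') + (v₂ - v₂') -
        (E' * v₁' - v₂') := by ring
    rw [e]
    refine (norm_sub_le _ _).trans ?_
    have h4 := norm_add_le ((E * v₁ - v₂) - E * (v₁ - v₁')) (v₂ - v₂')
    have h5 := norm_sub_le (E * v₁ - v₂) (E * (v₁ - v₁'))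
    rw [norm_mul, hE, one_mul] at h5
    linarith
  have h4 := key (θ₁ - θ₂) (θ₁' - θ₂') v₁' v₁'
  have h5 : Complex.exp (((θ₁ - θ₂) - (θ₁' - θ₂') : ℝ) * Complex.I) * v₁' - v₁' =
      (Complex.exp (((θ₁ - θ₂) - (θ₁' - θ₂') : ℝ) * Complex.I) - 1) * v₁' := by ring
  rw [h5, norm_mul] at h4
  rw [h4] at h3
  nlinarith [norm_nonneg (Complex.exp (((θ₁ - θ₂) - (θ₁' - θ₂') : ℝ) * Complex.I) - 1)]

/-- First order expansion of a holomorphic function on the disc. -/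
theorem norm_sub_sub_deriv_mul_le {h : ℂ → ℂ} (ha : AnalyticOnNhd ℂ h disc) {C R : ℝ} (hC0 : 0 ≤ C)
    (hC : ∀ z ∈ disc, ∀ z' ∈ disc, ‖deriv h z - deriv h z'‖ ≤ C * ‖z - z'‖)
    {x₀ x y : ℂ} (hx₀ : x₀ ∈ disc) (hx : x ∈ disc) (hy : y ∈ disc)
    (hxR : ‖x - x₀‖ ≤ R) (hyR : ‖y - x₀‖ ≤ R) :
    ‖h y - h x - deriv h x₀ * (y - x)‖ ≤ C * R * ‖y - x‖ := by
  have hconv : Convex ℝ (disc ∩ Metric.closedBall x₀ R) :=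
    convex_disc.inter (convex_closedBall _ _)
  have hd : ∀ z ∈ disc ∩ Metric.closedBall x₀ R,
      HasDerivWithinAt (fun z => h z - deriv h x₀ * z) (deriv h z - deriv h x₀)
        (disc ∩ Metric.closedBall x₀ R) z := by
    intro z hz
    have := ((ha z hz.1).differentiableAt.hasDerivAt.sub
      ((hasDerivAt_id z).const_mul (deriv h x₀))).hasDerivWithinAt
      (s := disc ∩ Metric.closedBall x₀ R)
    rw [mul_one] at this
    exact this
  have hb : ∀ z ∈ disc ∩ Metric.closedBall x₀ R, ‖deriv h z - deriv h x₀‖ ≤ C * R := by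
    intro z hz
    refine (hC z hz.1 x₀ hx₀).trans ?_
    gcongr
    simpa [dist_eq_norm] using hz.2
  have h1 := hconv.norm_image_sub_le_of_norm_hasDerivWithin_le hd hb
    ⟨hx, by simpa [dist_eq_norm] using hxR⟩ ⟨hy, by simpa [dist_eq_norm] using hyR⟩
  have e : h y - h x - deriv h x₀ * (y - x) =
      (h y - deriv h x₀ * y) - (h x - deriv h x₀ * x) := by ring
  rw [e]
  exact h1

namespace DiscIFS

variable {n : ℕ} (Φ : DiscIFS n)

/-! ### The branches of the transfer operator -/

/-- The contribution of the word `η` with weight `c` to the transfer operator. -/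
def branchTerm (c : ℝ) (s : ℂ) (ℓ : ℤ) (η : List (Fin n)) (f : C1D) (x : ℂ) : ℂ :=
  c * Φ.cocycleWeight s ℓ η x * ext f.1 (Φ.word η x)

/-- The amplitude that dominates a branch of the transfer operator. -/
def branchAmp (c a : ℝ) (η : List (Fin n)) (H : C1D) (x : ℂ) : ℝ :=
  c * Real.exp (-(2 * Real.pi * a * (Φ.wordLog η x).re)) * (ext H.1 (Φ.word η x)).re

/-- The phase of a branch of the transfer operator. -/
def branchPhase (b : ℝ) (ℓ : ℤ) (η : List (Fin n)) (x : ℂ) : ℝ :=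
  -(2 * Real.pi * b * (Φ.wordLog η x).re) + ℓ * (Φ.wordLog η x).im

/-- The quotient of `f` by `H` along a branch. -/
def branchQuot (η : List (Fin n)) (f H : C1D) (x : ℂ) : ℂ :=
  ext f.1 (Φ.word η x) / (ext H.1 (Φ.word η x)).re

theorem ext_re_pos {H : C1D} {M : ℝ} (hH : H ∈ cone M) {x : ℂ} (hx : x ∈ disc) :
    0 < (ext H.1 x).re := by
  rw [ext_of_mem _ hx]
  exact (hH ⟨x, hx⟩).2.1

theorem cocycleWeight_eq (a b : ℝ) (ℓ : ℤ) (η : List (Fin n)) (x : ℂ) :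
    Φ.cocycleWeight (a + b * Complex.I) ℓ η x =
      (Real.exp (-(2 * Real.pi * a * (Φ.wordLog η x).re)) : ℝ) *
        Complex.exp (Φ.branchPhase b ℓ η x * Complex.I) := by
  rw [cocycleWeight, branchPhase, Complex.ofReal_exp, ← Complex.exp_add]
  congr 1
  push_cast
  ring

/-- Polar form: a positive amplitude times a vector of norm at most 1, to which the alignment
inequality applies. -/
theorem branchTerm_eq {H : C1D} {M : ℝ} (hH : H ∈ cone M) (c a b : ℝ) (ℓ : ℤ) (η : List (Fin n))
    (f : C1D) {x : ℂ} (hx : x ∈ disc) :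
    Φ.branchTerm c (a + b * Complex.I) ℓ η f x = (Φ.branchAmp c a η H x : ℂ) *
      (Complex.exp (Φ.branchPhase b ℓ η x * Complex.I) * Φ.branchQuot η f H x) := by
  have h0 : ((ext H.1 (Φ.word η x)).re : ℂ) ≠ 0 := by
    exact_mod_cast (ext_re_pos hH (Φ.word_mapsTo η hx)).ne'
  rw [branchTerm, branchAmp, branchQuot, cocycleWeight_eq]
  push_cast
  field_simp

theorem branchAmp_pos {H : C1D} {M : ℝ} (hH : H ∈ cone M) {c : ℝ} (hc : 0 < c) (a : ℝ)
    (η : List (Fin n)) {x : ℂ} (hx : x ∈ disc) : 0 < Φ.branchAmp c a η H x :=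
  mul_pos (mul_pos hc (Real.exp_pos _)) (ext_re_pos hH (Φ.word_mapsTo η hx))

theorem norm_branchQuot_le {H f : C1D} {M : ℝ} (hH : H ∈ cone M)
    (hf : ∀ x, ‖f.1 x‖ ≤ (H.1 x).re) (η : List (Fin n)) {x : ℂ} (hx : x ∈ disc) :
    ‖Φ.branchQuot η f H x‖ ≤ 1 := by
  have h0 := ext_re_pos hH (Φ.word_mapsTo η hx)
  rw [branchQuot, norm_div, Complex.norm_real, Real.norm_of_nonneg h0.le, div_le_one h0,
    ext_of_mem _ (Φ.word_mapsTo η hx), ext_of_mem _ (Φ.word_mapsTo η hx)]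
  exact hf _

/-- The quotient f/H is 2M-Lipschitz, and the word contracts by ρ^N. With M of order B and distances
of order 1/B, a large N makes it almost constant. -/
theorem norm_branchQuot_sub_le {H f : C1D} {M : ℝ} (hM : 0 ≤ M) (hH : H ∈ cone M)
    (hf : ∀ x, ‖f.1 x‖ ≤ (H.1 x).re) (hf' : ∀ x, gradNorm f.1 x ≤ M * (H.1 x).re)
    (η : List (Fin n)) {x y : ℂ} (hx : x ∈ disc) (hy : y ∈ disc) :
    ‖Φ.branchQuot η f H x - Φ.branchQuot η f H y‖ ≤
      2 * M * (Φ.rate ^ η.length * ‖x - y‖) := by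
  refine (norm_div_sub_div_le hH hf hf' (Φ.word_mapsTo η hx) (Φ.word_mapsTo η hy)).trans ?_
  gcongr
  exact Φ.norm_word_sub_le η hx hy

theorem norm_wordLog_sub_le {Ct : ℝ}
    (hCt : ∀ η : List (Fin n), ∀ x ∈ disc, ‖deriv (Φ.wordLog η) x‖ ≤ Ct)
    (η : List (Fin n)) {x y : ℂ} (hx : x ∈ disc) (hy : y ∈ disc) :
    ‖Φ.wordLog η x - Φ.wordLog η y‖ ≤ Ct * ‖x - y‖ :=
  norm_image_sub_le_of_norm_deriv_le_disc (Φ.wordLog_analytic η) (hCt η) hx hy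

/-- A Harnack inequality for amplitudes: it allows comparison of the two branches at the different
points where the two damping attempts fail. -/
theorem branchAmp_le_exp_mul {Ct : ℝ}
    (hCt : ∀ η : List (Fin n), ∀ x ∈ disc, ‖deriv (Φ.wordLog η) x‖ ≤ Ct)
    {H : C1D} {M : ℝ} (hM : 0 ≤ M) (hH : H ∈ cone M) {c : ℝ} (hc : 0 < c) (a : ℝ)
    (η : List (Fin n)) {x y : ℂ} (hx : x ∈ disc) (hy : y ∈ disc) :
    Φ.branchAmp c a η H x ≤
      Real.exp ((2 * Real.pi * |a| * Ct + M * Φ.rate ^ η.length) * ‖x - y‖) *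
        Φ.branchAmp c a η H y := by
  have h1 := re_le_exp_mul_of_mem_cone hH (Φ.word_mapsTo η hx) (Φ.word_mapsTo η hy)
  have h2 : Real.exp (M * ‖Φ.word η x - Φ.word η y‖) ≤
      Real.exp (M * Φ.rate ^ η.length * ‖x - y‖) := by
    rw [Real.exp_le_exp, mul_assoc]
    gcongr
    exact Φ.norm_word_sub_le η hx hy
  have h3 : Real.exp (-(2 * Real.pi * a * (Φ.wordLog η x).re)) ≤
      Real.exp (2 * Real.pi * |a| * Ct * ‖x - y‖) *
        Real.exp (-(2 * Real.pi * a * (Φ.wordLog η y).re)) := by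
    rw [← Real.exp_add, Real.exp_le_exp]
    have h4 : |(Φ.wordLog η x).re - (Φ.wordLog η y).re| ≤ Ct * ‖x - y‖ := by
      rw [← Complex.sub_re]
      exact (Complex.abs_re_le_norm _).trans (Φ.norm_wordLog_sub_le hCt η hx hy)
    have h5 : |a * ((Φ.wordLog η x).re - (Φ.wordLog η y).re)| ≤ |a| * (Ct * ‖x - y‖) := by
      rw [abs_mul]
      gcongr
    have h6 := mul_le_mul_of_nonneg_left ((neg_le_abs _).trans h5) Real.two_pi_pos.le
    linarith
  have hHy := ext_re_pos hH (Φ.word_mapsTo η hy)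
  have hHx := ext_re_pos hH (Φ.word_mapsTo η hx)
  rw [branchAmp, branchAmp, add_mul, Real.exp_add]
  calc c * Real.exp (-(2 * Real.pi * a * (Φ.wordLog η x).re)) * (ext H.1 (Φ.word η x)).re
      ≤ c * (Real.exp (2 * Real.pi * |a| * Ct * ‖x - y‖) *
        Real.exp (-(2 * Real.pi * a * (Φ.wordLog η y).re))) *
        (Real.exp (M * Φ.rate ^ η.length * ‖x - y‖) * (ext H.1 (Φ.word η y)).re) := by
        gcongr
        exact h1.trans (by gcongr)
    _ = _ := by ring

/-- The function `z` is bounded by `A` on the part in the disc of the ball of radius `3 σ` around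
the lattice point `σ c`. -/
def BoundedNear (σ : ℝ) (z : ℂ → ℂ) (A : ℂ → ℝ) (c : ℤ × ℤ) : Prop :=
  ∀ x ∈ disc, ‖x - σ • latticePoint c‖ ≤ 3 * σ → ‖z x‖ ≤ A x

/-- If neither branch can be damped near a lattice point, then the branches are almost aligned at
some point nearby. -/
theorem exists_aligned {Ct : ℝ}
    (hCt : ∀ η : List (Fin n), ∀ x ∈ disc, ‖deriv (Φ.wordLog η) x‖ ≤ Ct) (hCt0 : 0 ≤ Ct)
    {H f : C1D} {M : ℝ} (hM : 0 ≤ M) (hH : H ∈ cone M)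
    (hf : ∀ x, ‖f.1 x‖ ≤ (H.1 x).re) {c₁ c₂ : ℝ} (hc₁ : 0 < c₁) (hc₂ : 0 < c₂) {a b : ℝ} {ℓ : ℤ}
    {N : ℕ} {η₁ η₂ : List (Fin n)} (hη₁ : η₁.length = N) (hη₂ : η₂.length = N)
    {σ τ : ℝ} (hτ1 : τ ≤ 1)
    (hosc : (2 * Real.pi * |a| * Ct + M * Φ.rate ^ N) * (6 * σ) ≤ 1 / 4) {c : ℤ × ℤ}
    (h₁ : ¬ BoundedNear σ (fun x => Φ.branchTerm c₁ (a + b * Complex.I) ℓ η₁ f x +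
      Φ.branchTerm c₂ (a + b * Complex.I) ℓ η₂ f x)
      (fun x => (1 - τ) * Φ.branchAmp c₁ a η₁ H x + Φ.branchAmp c₂ a η₂ H x) c)
    (h₂ : ¬ BoundedNear σ (fun x => Φ.branchTerm c₁ (a + b * Complex.I) ℓ η₁ f x +
      Φ.branchTerm c₂ (a + b * Complex.I) ℓ η₂ f x)
      (fun x => Φ.branchAmp c₁ a η₁ H x + (1 - τ) * Φ.branchAmp c₂ a η₂ H x) c) :
    ∃ x ∈ disc, ‖x - σ • latticePoint c‖ ≤ 3 * σ ∧
      ‖Complex.exp (Φ.branchPhase b ℓ η₁ x * Complex.I) * Φ.branchQuot η₁ f H x -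
        Complex.exp (Φ.branchPhase b ℓ η₂ x * Complex.I) * Φ.branchQuot η₂ f H x‖ ^ 2 ≤ 8 * τ ∧
      1 - 2 * τ ≤ ‖Φ.branchQuot η₁ f H x‖ := by
  unfold BoundedNear at h₁ h₂
  push Not at h₁ h₂
  obtain ⟨x, hx, hxc, hx'⟩ := h₁
  obtain ⟨y, hy, hyc, hy'⟩ := h₂
  have hxy : ‖x - y‖ ≤ 6 * σ := by
    have := norm_sub_le (x - σ • latticePoint c) (y - σ • latticePoint c)
    rw [sub_sub_sub_cancel_right] at this
    linarith
  have hexp : Real.exp ((2 * Real.pi * |a| * Ct + M * Φ.rate ^ N) * ‖x - y‖) ≤ Real.exp (1 / 4) := by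
    rw [Real.exp_le_exp]
    refine le_trans ?_ hosc
    have := Φ.rate_nonneg
    gcongr
  have hexp2 : Real.exp (1 / 4) * Real.exp (1 / 4) ≤ 2 := by
    rw [← Real.exp_add]
    have h3 : (1 / 4 + 1 / 4 : ℝ) = 1 / 2 := by norm_num
    rw [h3]
    have h4 : Real.exp (1 / 2) * Real.exp (1 / 2) = Real.exp 1 := by
      rw [← Real.exp_add]; norm_num
    nlinarith [Real.exp_one_lt_d9, Real.exp_pos (1 / 2 : ℝ)]
  have hnE : ∀ (η : List (Fin n)) (z v : ℂ),
      ‖Complex.exp (Φ.branchPhase b ℓ η z * Complex.I) * v‖ = ‖v‖ := fun η z v => by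
    rw [norm_mul, Complex.norm_exp_ofReal_mul_I, one_mul]
  -- The damped amplitude must be at most twice the other. If branch 1 is weaker at x, its failed
  -- damping there suffices. Otherwise the failed damping of branch 2 at y is used: two Harnack
  -- factors e^{1/4} have product at most 2.
  rcases le_total (Φ.branchAmp c₁ a η₁ H x) (Φ.branchAmp c₂ a η₂ H x) with hle | hle
  · refine ⟨x, hx, hxc, ?_⟩
    rw [Φ.branchTerm_eq hH _ _ _ _ _ _ hx, Φ.branchTerm_eq hH _ _ _ _ _ _ hx] at hx'
    have hA2 := Φ.branchAmp_pos hH hc₂ a η₂ hx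
    have h3 := aligned_of_lt_norm
      (by rw [hnE]; exact Φ.norm_branchQuot_le hH hf η₁ hx)
      (by rw [hnE]; exact Φ.norm_branchQuot_le hH hf η₂ hx)
      (Φ.branchAmp_pos hH hc₁ a η₁ hx) (by linarith) hτ1 hx'
    exact ⟨h3.1, by simpa only [hnE] using h3.2.1⟩
  · refine ⟨y, hy, hyc, ?_⟩
    rw [Φ.branchTerm_eq hH _ _ _ _ _ _ hy, Φ.branchTerm_eq hH _ _ _ _ _ _ hy, add_comm,
      add_comm ((Φ.branchAmp c₁ a η₁ H y : ℂ) * _)] at hy'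
    have hA1 := Φ.branchAmp_pos hH hc₁ a η₁ hx
    have e1 := Φ.branchAmp_le_exp_mul hCt hM hH hc₁ a η₁ hx hy
    have e2 := Φ.branchAmp_le_exp_mul hCt hM hH hc₂ a η₂ hy hx
    rw [hη₁] at e1
    rw [hη₂, norm_sub_rev] at e2
    have p1 := Φ.branchAmp_pos hH hc₁ a η₁ hy
    have p2 := Φ.branchAmp_pos hH hc₂ a η₂ hx
    have e1' := e1.trans (mul_le_mul_of_nonneg_right hexp p1.le)
    have e2' := e2.trans (mul_le_mul_of_nonneg_right hexp p2.le)
    have hep := Real.exp_pos (1 / 4 : ℝ)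
    have h4 : Φ.branchAmp c₂ a η₂ H y ≤ 2 * Φ.branchAmp c₁ a η₁ H y := by
      calc Φ.branchAmp c₂ a η₂ H y ≤ Real.exp (1 / 4) * Φ.branchAmp c₂ a η₂ H x := e2'
        _ ≤ Real.exp (1 / 4) * (Real.exp (1 / 4) * Φ.branchAmp c₁ a η₁ H y) := by
          gcongr; exact hle.trans e1'
        _ = Real.exp (1 / 4) * Real.exp (1 / 4) * Φ.branchAmp c₁ a η₁ H y := by ring
        _ ≤ _ := by gcongr
    have h3 := aligned_of_lt_norm
      (by rw [hnE]; exact Φ.norm_branchQuot_le hH hf η₂ hy)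
      (by rw [hnE]; exact Φ.norm_branchQuot_le hH hf η₁ hy)
      (Φ.branchAmp_pos hH hc₂ a η₂ hy) h4 hτ1 hy'
    rw [norm_sub_rev] at h3
    exact ⟨h3.1, by simpa only [hnE] using h3.2.2⟩

end DiscIFS

/-! ### Relative phases and cancellation inside small cylinders -/

namespace DiscIFS

variable {n : ℕ} (Φ : DiscIFS n)

/-- The frequency vector `-2πb - iℓ`, for which the phase is `Re (ζ · log f_η')`. -/
def frequency (b : ℝ) (ℓ : ℤ) : ℂ := ⟨-(2 * Real.pi * b), -ℓ⟩

/-- The gradient of the phase difference has modulus |ζ||h'|, so a lower bound for |h'| suffices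
whatever the proportion of b to ℓ. -/
theorem branchPhase_eq_re (b : ℝ) (ℓ : ℤ) (η : List (Fin n)) (x : ℂ) :
    Φ.branchPhase b ℓ η x = (frequency b ℓ * Φ.wordLog η x).re := by
  rw [branchPhase, Complex.mul_re, frequency]
  ring

theorem norm_frequency_le (b : ℝ) (ℓ : ℤ) : ‖frequency b ℓ‖ ≤ 7 * (|b| + |(ℓ : ℝ)|) := by
  refine (Complex.norm_le_abs_re_add_abs_im _).trans ?_
  simp only [frequency, abs_neg, abs_mul, abs_two, abs_of_pos Real.pi_pos]
  have := Real.pi_lt_d2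
  nlinarith [abs_nonneg b, abs_nonneg (ℓ : ℝ)]

theorem le_norm_frequency (b : ℝ) (ℓ : ℤ) : (|b| + |(ℓ : ℝ)|) / 2 ≤ ‖frequency b ℓ‖ := by
  have h1 := Complex.abs_re_le_norm (frequency b ℓ)
  have h2 := Complex.abs_im_le_norm (frequency b ℓ)
  simp only [frequency, abs_neg, abs_mul, abs_two, abs_of_pos Real.pi_pos] at h1 h2
  have := Real.pi_gt_three
  simp only [frequency]
  nlinarith [abs_nonneg b, abs_nonneg (ℓ : ℝ)]

/-- The relative phase of two branches changes by an amount comparable to `‖ζ‖ r` between points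
at distance comparable to `r` in a suitable direction. -/
theorem relative_phase_bounds {h : ℂ → ℂ} (ha : AnalyticOnNhd ℂ h disc) {C m₀ D r κ : ℝ}
    (hC0 : 0 ≤ C) (hr : 0 ≤ r) (hD : 0 ≤ D)
    (hC : ∀ z ∈ disc, ∀ z' ∈ disc, ‖deriv h z - deriv h z'‖ ≤ C * ‖z - z'‖)
    (hD' : ∀ z ∈ disc, ‖deriv h z‖ ≤ D)
    {x₀ x y ζ w : ℂ} (hx₀ : x₀ ∈ disc) (hx : x ∈ disc) (hy : y ∈ disc)
    (hxr : ‖x - x₀‖ ≤ r) (hyr : ‖y - x₀‖ ≤ r) (hm : m₀ ≤ ‖deriv h x₀‖) (hκ0 : 0 ≤ κ)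
    (hw : ζ * deriv h x₀ = ‖ζ * deriv h x₀‖ * w) (hκ : κ * r ≤ |(w * (y - x)).re|)
    (hsmall : 4 * C * r ≤ m₀ * κ) (hup : ‖ζ‖ * (D * (2 * r)) ≤ 1) :
    ‖ζ‖ * (m₀ * κ * r / 2) ≤ |(ζ * h x).re - (ζ * h y).re| ∧
      |(ζ * h x).re - (ζ * h y).re| ≤ 1 := by
  have hyx : ‖y - x‖ ≤ 2 * r := by
    have := norm_sub_le (y - x₀) (x - x₀)
    rw [sub_sub_sub_cancel_right] at this
    linarith
  have e0 : |(ζ * h x).re - (ζ * h y).re| = |(ζ * (h y - h x)).re| := by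
    rw [abs_sub_comm, ← Complex.sub_re, mul_sub]
  rw [e0]
  constructor
  -- In the first-order expansion at x₀ the linear term is at least |ζ|m₀κr, and `hsmall` makes the
  -- error at most half of it.
  · have h1 := norm_sub_sub_deriv_mul_le ha hC0 hC hx₀ hx hy hxr hyr
    have h2 : ζ * (h y - h x) = (‖ζ * deriv h x₀‖ : ℝ) * (w * (y - x)) +
        ζ * (h y - h x - deriv h x₀ * (y - x)) := by
      rw [← mul_assoc, ← hw]
      ring
    have h3 : |(ζ * (h y - h x - deriv h x₀ * (y - x))).re| ≤ ‖ζ‖ * (C * r * (2 * r)) := by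
      refine (Complex.abs_re_le_norm _).trans ?_
      rw [norm_mul]
      gcongr
      exact h1.trans (by gcongr)
    have h4 : ‖ζ‖ * (m₀ * (κ * r)) ≤ |((‖ζ * deriv h x₀‖ : ℝ) * (w * (y - x))).re| := by
      rw [Complex.re_ofReal_mul, abs_mul, abs_norm, norm_mul, mul_assoc]
      gcongr
    have h5 : |((‖ζ * deriv h x₀‖ : ℝ) * (w * (y - x))).re| ≤
        |(ζ * (h y - h x)).re| + |(ζ * (h y - h x - deriv h x₀ * (y - x))).re| := by
      have e1 : ((‖ζ * deriv h x₀‖ : ℝ) * (w * (y - x))).re = (ζ * (h y - h x)).re -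
          (ζ * (h y - h x - deriv h x₀ * (y - x))).re := by
        rw [h2, Complex.add_re]
        ring
      rw [e1]
      exact abs_sub _ _
    have h6 : ‖ζ‖ * (C * r * (2 * r)) ≤ ‖ζ‖ * (m₀ * κ * r / 2) := by
      refine mul_le_mul_of_nonneg_left ?_ (norm_nonneg _)
      nlinarith
    linarith
  · refine (Complex.abs_re_le_norm _).trans ?_
    rw [norm_mul]
    refine le_trans ?_ hup
    gcongr
    exact (norm_image_sub_le_of_norm_deriv_le_disc ha hD' hy hx).trans (by gcongr)

/-- The key step: every cylinder of size comparable to `r` contains a sub-cylinder of bounded depth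
that lies near a lattice point at which one of the two branches can be damped. -/
theorem exists_damped_subcylinder {K : Set ℂ} (hatt : Φ.IsAttractor K)
    {S : Fin n → Finset (Fin n)} (hS : ∀ k, (S k).Nonempty) (hdense : ∀ k, Φ.IsDense (S k))
    {L κ lam : ℝ} (hL : Φ.HasDistortion L) (hκ0 : 0 < κ)
    (hκ : ∀ g : ℂ → ℂ, AnalyticOnNhd ℂ g disc → deriv g 0 ≠ 0 →
      (∀ x ∈ disc, ∀ y ∈ disc, ‖deriv g x‖ ≤ L * ‖deriv g y‖) → ∀ w : ℂ, ‖w‖ = 1 →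
      ∃ x ∈ K, ∃ y ∈ K, κ * ‖deriv g 0‖ ≤ |(w * (g y - g x)).re|)
    (hrate : 16 * L * Φ.rate ≤ κ) (hlam : 0 < lam)
    {Ct : ℝ} (hCt : ∀ η : List (Fin n), ∀ x ∈ disc, ‖deriv (Φ.wordLog η) x‖ ≤ Ct)
    {N : ℕ} {η₁ η₂ : List (Fin n)} (hη₁ : η₁.length = N) (hη₂ : η₂.length = N)
    {m₀ C : ℝ} (hm₀ : 0 < m₀)
    (hm : ∀ x ∈ disc, m₀ ≤ ‖deriv (Φ.wordLog η₁) x - deriv (Φ.wordLog η₂) x‖) (hC0 : 0 ≤ C)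
    (hC : ∀ η, η.length = N → ∀ x ∈ disc, ∀ y ∈ disc,
      ‖deriv (Φ.wordLog η) x - deriv (Φ.wordLog η) y‖ ≤ C * ‖x - y‖)
    {H f : C1D} {M : ℝ} (hM : 0 ≤ M) (hH : H ∈ cone M)
    (hf : ∀ x, ‖f.1 x‖ ≤ (H.1 x).re) (hf' : ∀ x, gradNorm f.1 x ≤ M * (H.1 x).re)
    {c₁ c₂ : ℝ} (hc₁ : 0 < c₁) (hc₂ : 0 < c₂) {a b : ℝ} {ℓ : ℤ}
    {r σ τ δ : ℝ} (hr : 0 < r) (hσ : 0 < σ) (hτ1 : 4 * τ ≤ 1) (hδ : 8 * τ ≤ δ ^ 2) (hδ0 : 0 ≤ δ)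
    (hosc : (2 * Real.pi * |a| * Ct + M * Φ.rate ^ N) * (6 * σ) ≤ 1 / 4)
    (hσκ : 32 * σ ≤ κ * lam * r) (hσL : 8 * σ ≤ L * r)
    (hsmall : 128 * (C * L * (L * r)) ≤ m₀ * (κ * lam))
    (hup : ‖frequency b ℓ‖ * (8 * (Ct * (L * r))) ≤ 1)
    (hgap : 64 * (δ + 8 * (M * Φ.rate ^ N * (L * r))) <
      ‖frequency b ℓ‖ * (m₀ * (κ * lam) * r))
    {t₀ : ℕ} (ht₀ : L * r * Φ.rate ^ t₀ ≤ σ)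
    {ω : ℕ → Fin n} {v : List (Fin n)} (hv1 : lam * r ≤ ‖deriv (Φ.word v) 0‖)
    (hv2 : ‖deriv (Φ.word v) 0‖ ≤ r) :
    ∃ u : List (Fin n), u.length = 1 + t₀ ∧ IsAdmissible S ω u ∧ ∃ c ∈ grid σ,
      (BoundedNear σ (fun x => Φ.branchTerm c₁ (a + b * Complex.I) ℓ η₁ f x +
        Φ.branchTerm c₂ (a + b * Complex.I) ℓ η₂ f x)
        (fun x => (1 - τ) * Φ.branchAmp c₁ a η₁ H x + Φ.branchAmp c₂ a η₂ H x) c ∨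
      BoundedNear σ (fun x => Φ.branchTerm c₁ (a + b * Complex.I) ℓ η₁ f x +
        Φ.branchTerm c₂ (a + b * Complex.I) ℓ η₂ f x)
        (fun x => Φ.branchAmp c₁ a η₁ H x + (1 - τ) * Φ.branchAmp c₂ a η₂ H x) c) ∧
      ∀ x ∈ disc, ‖Φ.word v (Φ.word u x) - σ • latticePoint c‖ ≤ 2 * σ := by
  have hL1 := Φ.one_le_of_hasDistortion hL
  have hL0 : 0 < L := one_pos.trans_le hL1
  have hCt0 : 0 ≤ Ct := (norm_nonneg _).trans (hCt [] 0 zero_mem_disc)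
  set x₀ := Φ.word v 0
  have hx₀ : x₀ ∈ disc := Φ.word_mapsTo v zero_mem_disc
  set h : ℂ → ℂ := fun x => Φ.wordLog η₁ x - Φ.wordLog η₂ x with hdef
  have hha : AnalyticOnNhd ℂ h disc := (Φ.wordLog_analytic η₁).sub (Φ.wordLog_analytic η₂)
  have hhd : ∀ x ∈ disc, deriv h x = deriv (Φ.wordLog η₁) x - deriv (Φ.wordLog η₂) x := fun x hx =>
    ((Φ.hasDerivAt_wordLog η₁ hx).sub (Φ.hasDerivAt_wordLog η₂ hx)).deriv
  set ζ := frequency b ℓ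
  -- the direction in which the relative phase varies
  obtain ⟨w, hw1, hw⟩ : ∃ w : ℂ, ‖w‖ = 1 ∧ ζ * deriv h x₀ = ‖ζ * deriv h x₀‖ * w := by
    refine ⟨Complex.exp (Complex.arg (ζ * deriv h x₀) * Complex.I),
      Complex.norm_exp_ofReal_mul_I _, (Complex.norm_mul_exp_arg_mul_I _).symm⟩
  obtain ⟨i, hi, j, hj, hij⟩ := hatt.exists_letters hκ hL hrate (hdense (ω 0)) v hw1
  -- The first letters i and j create the separation; the common tail is arbitrary and only shrinks
  -- the sub-cylinders to radius σ.
  obtain ⟨t, ht, hta⟩ := exists_isAdmissible hS t₀ (shift 1 ω)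
  by_contra! hcon
  have hcyl : ∀ k : Fin n, ∀ z ∈ disc, ‖Φ.word v (Φ.word (k :: t) z) - Φ.word v (Φ.word (k :: t) 0)‖
      ≤ σ := by
    intro k z hz
    refine le_trans ?_ ht₀
    have e1 := Φ.norm_word_sub_le_of_hasDistortion hL v (Φ.word_mapsTo (k :: t) hz)
      (Φ.word_mapsTo (k :: t) zero_mem_disc)
    have e2 := Φ.norm_word_sub_le (k :: t) hz zero_mem_disc
    rw [sub_zero, List.length_cons, ht, pow_succ] at e2
    have e3 : Φ.rate ^ t₀ * Φ.rate * ‖z‖ ≤ Φ.rate ^ t₀ * 1 * 1 := by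
      have := Φ.rate_nonneg
      have := Φ.rate_lt_one.le
      have := norm_le_one_of_mem_disc hz
      gcongr
    refine e1.trans ?_
    have e4 := e2.trans e3
    rw [mul_one, mul_one] at e4
    gcongr
  -- Suppose that no damped sub-cylinder exists. The centre of each candidate is within σ of a grid
  -- point, so the sub-cylinder lies within 2σ of it and both dampings must fail there. This yields
  -- an alignment point within 3σ of the grid point, hence within 4σ of the centre.
  have hal : ∀ k ∈ S (ω 0), ∃ x ∈ disc, ‖x - Φ.word v (Φ.word (k :: t) 0)‖ ≤ 4 * σ ∧
      ‖Complex.exp (Φ.branchPhase b ℓ η₁ x * Complex.I) * Φ.branchQuot η₁ f H x -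
        Complex.exp (Φ.branchPhase b ℓ η₂ x * Complex.I) * Φ.branchQuot η₂ f H x‖ ≤ δ ∧
      1 / 2 ≤ ‖Φ.branchQuot η₁ f H x‖ := by
    intro k hk
    have hX : Φ.word v (Φ.word (k :: t) 0) ∈ disc :=
      Φ.word_mapsTo v (Φ.word_mapsTo (k :: t) zero_mem_disc)
    obtain ⟨c, hc, hcX⟩ := exists_mem_grid hσ hX
    have hnot := hcon (k :: t) (by simp [ht, add_comm]) ⟨hk, hta⟩ c hc
    have hnot' : ¬ _ := fun hb => by
      obtain ⟨z, hz, hlt⟩ := hnot hb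
      have e1 := norm_add_le (Φ.word v (Φ.word (k :: t) z) - Φ.word v (Φ.word (k :: t) 0))
        (Φ.word v (Φ.word (k :: t) 0) - σ • latticePoint c)
      rw [sub_add_sub_cancel] at e1
      linarith [hcyl k z hz]
    rw [not_or] at hnot'
    obtain ⟨x, hx, hxc, h1, h2⟩ := Φ.exists_aligned hCt hCt0 hM hH hf hc₁ hc₂ hη₁ hη₂
      (by linarith) hosc hnot'.1 hnot'.2
    refine ⟨x, hx, ?_, abs_le_of_sq_le_sq' (h1.trans hδ) hδ0 |>.2, by linarith⟩
    have e1 := norm_sub_le (x - σ • latticePoint c)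
      (Φ.word v (Φ.word (k :: t) 0) - σ • latticePoint c)
    rw [sub_sub_sub_cancel_right] at e1
    linarith
  obtain ⟨x, hx, hxX, hx1, -⟩ := hal i hi
  obtain ⟨y, hy, hyY, hy1, hy2⟩ := hal j hj
  have hfar : ∀ (k : Fin n) (z : ℂ), ‖z - Φ.word v (Φ.word (k :: t) 0)‖ ≤ 4 * σ →
      ‖z - x₀‖ ≤ 2 * L * r := by
    intro k z hz
    have e1 := Φ.norm_word_sub_le_of_hasDistortion hL v (Φ.word_mapsTo (k :: t) zero_mem_disc)
      zero_mem_disc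
    have e2 : L * ‖deriv (Φ.word v) 0‖ * ‖Φ.word (k :: t) 0 - 0‖ ≤ L * r * 1 := by
      rw [sub_zero]
      have := norm_le_one_of_mem_disc (Φ.word_mapsTo (k :: t) zero_mem_disc)
      gcongr
    have e3 := norm_add_le (z - Φ.word v (Φ.word (k :: t) 0)) (Φ.word v (Φ.word (k :: t) 0) - x₀)
    rw [sub_add_sub_cancel] at e3
    linarith
  -- The centres are separated by κ·lam·r/2 in direction w. Passing to the two alignment points
  -- costs 8σ, at most half of this; the remainder κ·lam·r/4 is written relative to the radius 2Lr.
  have hdir : κ * lam / (8 * L) * (2 * L * r) ≤ |(w * (y - x)).re| := by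
    have e1 := hij (Φ.word t 0) (Φ.word_mapsTo t zero_mem_disc) (Φ.word t 0)
      (Φ.word_mapsTo t zero_mem_disc)
    change _ ≤ |(w * (Φ.word v (Φ.word (j :: t) 0) - Φ.word v (Φ.word (i :: t) 0))).re| at e1
    set X := Φ.word v (Φ.word (i :: t) 0)
    set Y := Φ.word v (Φ.word (j :: t) 0)
    have e2 : w * (Y - X) = w * (y - x) + w * ((x - X) - (y - Y)) := by ring
    rw [e2, Complex.add_re] at e1
    have e3 : |(w * ((x - X) - (y - Y))).re| ≤ 8 * σ := by
      refine (Complex.abs_re_le_norm _).trans ?_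
      rw [norm_mul, hw1, one_mul]
      refine (norm_sub_le _ _).trans ?_
      linarith
    have e4 := abs_add_le (w * (y - x)).re (w * ((x - X) - (y - Y))).re
    have e5 : κ / 2 * (lam * r) ≤ κ / 2 * ‖deriv (Φ.word v) 0‖ := by gcongr
    have e6 : κ * lam / (8 * L) * (2 * L * r) = κ * lam * r / 4 := by
      field_simp
      ring
    rw [e6]
    linarith
  obtain ⟨hb1, hb2⟩ := relative_phase_bounds hha (C := 2 * C) (m₀ := m₀) (D := 2 * Ct)
    (r := 2 * L * r) (κ := κ * lam / (8 * L)) (by positivity) (by positivity) (by positivity)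
    (fun z hz z' hz' => by
      rw [hhd z hz, hhd z' hz', sub_sub_sub_comm]
      refine (norm_sub_le _ _).trans ?_
      have e1 := hC η₁ hη₁ z hz z' hz'
      have e2 := hC η₂ hη₂ z hz z' hz'
      linarith)
    (fun z hz => by
      rw [hhd z hz]
      refine (norm_sub_le _ _).trans ?_
      linarith [hCt η₁ z hz, hCt η₂ z hz])
    hx₀ hx hy (hfar i x hxX) (hfar j y hyY) (by rw [hhd x₀ hx₀]; exact hm x₀ hx₀) (by positivity)
    hw hdir
    (by
      rw [mul_div_assoc', le_div_iff₀ (by positivity)]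
      linarith)
    (by linarith)
  have hphase : ∀ z, (ζ * h z).re = Φ.branchPhase b ℓ η₁ z - Φ.branchPhase b ℓ η₂ z := by
    intro z
    rw [branchPhase_eq_re, branchPhase_eq_re, ← Complex.sub_re, ← mul_sub]
  rw [hphase, hphase] at hb1 hb2
  have hxy : ‖x - y‖ ≤ 4 * L * r := by
    have e1 := norm_sub_le (x - x₀) (y - x₀)
    rw [sub_sub_sub_cancel_right] at e1
    linarith [hfar i x hxX, hfar j y hyY]
  have hquot : ∀ η : List (Fin n), η.length = N →
      ‖Φ.branchQuot η f H x - Φ.branchQuot η f H y‖ ≤ 8 * (M * Φ.rate ^ N * (L * r)) := by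
    intro η hη
    have e1 := Φ.norm_branchQuot_sub_le hM hH hf hf' η hx hy
    rw [hη] at e1
    have e2 : 2 * M * (Φ.rate ^ N * ‖x - y‖) ≤ 2 * M * (Φ.rate ^ N * (4 * L * r)) := by
      have := Φ.rate_nonneg
      gcongr
    linarith
  -- Alignment at both points makes the relative phases nearly equal modulo 2π, whereas the phase
  -- difference is at least |ζ|m₀κ·lam·r/8 and at most 1. The resulting factor 8·2·4 = 64 is the one
  -- in `hgap`.
  have h1 := norm_exp_sub_one_le_of_aligned hx1 hy1 (hquot η₁ hη₁) (hquot η₂ hη₂) hy2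
  have h2 := half_abs_le_norm_exp_sub_one hb2
  have e7 : ‖ζ‖ * (m₀ * (κ * lam / (8 * L)) * (2 * L * r) / 2) =
      ‖ζ‖ * (m₀ * (κ * lam) * r) / 8 := by
    field_simp
  rw [e7] at hb1
  linarith

end DiscIFS

/-- The extension by zero is Borel on the whole plane, so integrals against the random measures can
be pulled back by the coding map. -/
theorem measurable_ext {g : disc → ℂ} (hg : ContinuousOn (ext g) disc) : Measurable (ext g) := by
  classical
  have h : ext g = disc.piecewise (ext g) (fun _ => 0) := by
    funext z
    by_cases hz : z ∈ disc
    · rw [Set.piecewise_eq_of_mem _ _ _ hz]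
    · rw [Set.piecewise_eq_of_notMem _ _ _ hz, ext, dif_neg hz]
  rw [h]
  exact hg.measurable_piecewise continuousOn_const isCompact_disc.isClosed.measurableSet

namespace DiscIFS

variable {n : ℕ} (Φ : DiscIFS n) {p : Fin n → ℝ} {S : Fin n → Finset (Fin n)} {N : ℕ}

/-! ### Damped transfer operators -/

variable (p S) in
/-- The weights of the transfer operator, damped by the factors `β`. -/
def dampedWeight (ω : ℕ → Fin n) (a : ℝ) (β : (Fin N → Fin n) → ℂ → ℝ) (J : Fin N → Fin n)
    (x : ℂ) : ℂ :=
  (wordWeight p S ω J : ℂ) * Φ.cocycleWeight a 0 (List.ofFn J) x * (β J x : ℂ)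

theorem contDiffOn_dampedWeight (ω : ℕ → Fin n) (a : ℝ) {β : (Fin N → Fin n) → ℂ → ℝ}
    (hβ : ∀ J, ContDiff ℝ 1 (β J)) (J : Fin N → Fin n) :
    ContDiffOn ℝ 1 (Φ.dampedWeight p S ω a β J) disc :=
  (Φ.contDiffOn_const_mul_cocycleWeight _ _ _ _).mul
    (Complex.ofRealCLM.contDiff.comp (hβ J)).contDiffOn

variable (p S) in
/-- The transfer operator with real parameter `a`, damped by the factors `β`. -/
def dampedOp (ω : ℕ → Fin n) (a : ℝ) (β : (Fin N → Fin n) → ℂ → ℝ)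
    (hβ : ∀ J, ContDiff ℝ 1 (β J)) : C1D →ₗ[ℂ] C1D :=
  weightedOp (words S N ω) (Φ.contDiffOn_dampedWeight (p := p) (S := S) ω a hβ)
    (fun J => Φ.contDiffOn_word (List.ofFn J)) (fun J => Φ.word_mapsTo (List.ofFn J))

theorem ext_eq_ofReal_of_mem_cone {H : C1D} {M : ℝ} (hH : H ∈ cone M) {x : ℂ} (hx : x ∈ disc) :
    ext H.1 x = ((ext H.1 x).re : ℂ) := by
  rw [ext_of_mem _ hx]
  exact Complex.ext rfl (by simpa using (hH ⟨x, hx⟩).1)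

theorem dampedOp_apply (ω : ℕ → Fin n) (a : ℝ) {β : (Fin N → Fin n) → ℂ → ℝ}
    (hβ : ∀ J, ContDiff ℝ 1 (β J)) {H : C1D} {M : ℝ} (hH : H ∈ cone M) (x : disc) :
    (Φ.dampedOp p S ω a β hβ H).1 x = ((∑ J ∈ words S N ω,
      β J x * Φ.branchAmp (wordWeight p S ω J) a (List.ofFn J) H x : ℝ) : ℂ) := by
  rw [dampedOp, weightedOp_apply, Complex.ofReal_sum]
  refine Finset.sum_congr rfl fun J _ => ?_
  rw [ext_eq_ofReal_of_mem_cone hH (Φ.word_mapsTo _ x.2), dampedWeight, cocycleWeight_ofReal,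
    branchAmp]
  push_cast
  ring

theorem norm_dampedWeight (hp : ∀ i, 0 < p i) (ω : ℕ → Fin n) (a : ℝ)
    {β : (Fin N → Fin n) → ℂ → ℝ} {x : ℂ} (J : Fin N → Fin n) (hβ0 : 0 ≤ β J x) :
    ‖Φ.dampedWeight p S ω a β J x‖ = wordWeight p S ω J *
      Real.exp (-(2 * Real.pi * a * (Φ.wordLog (List.ofFn J) x).re)) * β J x := by
  rw [dampedWeight, cocycleWeight_ofReal, norm_mul, norm_mul, Complex.norm_real, Complex.norm_real,
    Complex.norm_real, Real.norm_of_nonneg (wordWeight_nonneg hp ω J), Real.norm_of_nonneg hβ0,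
    Real.norm_of_nonneg (Real.exp_pos _).le]

/-- Since the damping factor is at least 1/2, its gradient bound D becomes a relative bound 2D. -/
theorem norm_fderivWithin_dampedWeight_le (hp : ∀ i, 0 < p i) {Ct : ℝ}
    (hCt : ∀ η : List (Fin n), ∀ x ∈ disc, ‖deriv (Φ.wordLog η) x‖ ≤ Ct)
    (ω : ℕ → Fin n) (a : ℝ) {β : (Fin N → Fin n) → ℂ → ℝ} (hβ : ∀ J, ContDiff ℝ 1 (β J))
    {D : ℝ} (J : Fin N → Fin n) {x : ℂ} (hx : x ∈ disc) (hβ1 : 1 / 2 ≤ β J x)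
    (hD : ‖fderiv ℝ (β J) x‖ ≤ D) :
    ‖fderivWithin ℝ (Φ.dampedWeight p S ω a β J) disc x‖ ≤
      (2 * Real.pi * |a| * Ct + 2 * D) * ‖Φ.dampedWeight p S ω a β J x‖ := by
  have h1 := ((Φ.contDiffOn_cocycleWeight a 0 (List.ofFn J)).differentiableOn one_ne_zero x
    hx).hasFDerivWithinAt
  have h2 : HasFDerivWithinAt (fun x => (β J x : ℂ)) (Complex.ofRealCLM.comp (fderiv ℝ (β J) x))
      disc x := Complex.ofRealCLM.hasFDerivAt.comp_hasFDerivWithinAt x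
    (((hβ J).differentiable one_ne_zero x).hasFDerivAt.hasFDerivWithinAt)
  have h3 := (h1.const_mul (wordWeight p S ω J : ℂ)).mul h2
  have h4 := h3.fderivWithin (uniqueDiffOn_disc x hx)
  have h4' : fderivWithin ℝ (Φ.dampedWeight p S ω a β J) disc x = _ := h4
  have h5 := Φ.norm_fderivWithin_cocycleWeight_le hCt a 0 (List.ofFn J) hx
  have hn : ‖Φ.cocycleWeight a 0 (List.ofFn J) x‖ =
      Real.exp (-(2 * Real.pi * a * (Φ.wordLog (List.ofFn J) x).re)) := by
    rw [cocycleWeight_ofReal, Complex.norm_real, Real.norm_of_nonneg (Real.exp_pos _).le]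
  have hw0 := wordWeight_nonneg (S := S) hp ω J
  have hofReal : ‖Complex.ofRealCLM.comp (fderiv ℝ (β J) x)‖ ≤ D := by
    refine (ContinuousLinearMap.opNorm_comp_le _ _).trans ?_
    rwa [Complex.ofRealCLM_norm, one_mul]
  have hD0 : 0 ≤ D := (norm_nonneg _).trans hD
  have hβ0 : 0 ≤ β J x := by linarith
  rw [h4', Φ.norm_dampedWeight hp ω a J hβ0]
  refine (norm_add_le _ _).trans ?_
  rw [norm_smul, norm_smul, norm_smul, norm_mul, Complex.norm_real, Complex.norm_real,
    Real.norm_of_nonneg hw0, Real.norm_of_nonneg hβ0]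
  rw [hn, Int.cast_zero, abs_zero, add_zero, Complex.norm_real, Real.norm_eq_abs] at h5
  rw [hn]
  set W := wordWeight p S ω J
  set E := Real.exp (-(2 * Real.pi * a * (Φ.wordLog (List.ofFn J) x).re))
  have hE0 : 0 < E := Real.exp_pos _
  have h6 : W * E * ‖Complex.ofRealCLM.comp (fderiv ℝ (β J) x)‖ ≤ W * E * (2 * D * β J x) := by
    refine mul_le_mul_of_nonneg_left ?_ (mul_nonneg hw0 hE0.le)
    nlinarith
  have h7 := mul_le_mul_of_nonneg_left (mul_le_mul_of_nonneg_left h5 hw0) hβ0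
  calc _ ≤ W * E * (2 * D * β J x) + β J x * (W * (2 * Real.pi * |a| * Ct * E)) :=
        add_le_add h6 h7
    _ = _ := by ring

theorem sum_branchAmp_pos (hp : ∀ i, 0 < p i) (hS : ∀ k, (S k).Nonempty) (ω : ℕ → Fin n) (a : ℝ)
    {β : (Fin N → Fin n) → ℂ → ℝ} {x : ℂ} (hx : x ∈ disc) (hβ : ∀ J, 1 / 2 ≤ β J x) {H : C1D}
    {M : ℝ} (hH : H ∈ cone M) : 0 < ∑ J ∈ words S N ω,
      β J x * Φ.branchAmp (wordWeight p S ω J) a (List.ofFn J) H x := by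
  refine Finset.sum_pos (fun J hJ => mul_pos (by linarith [hβ J])
    (Φ.branchAmp_pos hH ?_ a _ hx)) ?_
  · exact Finset.prod_pos fun j _ => branchWeight_pos hp (Fintype.mem_piFinset.1 hJ j)
  · choose f hf using hS
    exact ⟨fun j => f (ω j), Fintype.mem_piFinset.2 fun j => hf _⟩

theorem norm_fderivWithin_le_of_mem_cone {H : C1D} {M : ℝ} (hH : H ∈ cone M) {z : ℂ}
    (hz : z ∈ disc) : ‖fderivWithin ℝ (ext H.1) disc z‖ ≤ M * (ext H.1 z).re := by
  rw [ext_of_mem _ hz]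
  exact (hH ⟨z, hz⟩).2.2

theorem norm_ext_of_mem_cone {H : C1D} {M : ℝ} (hH : H ∈ cone M) {z : ℂ}
    (hz : z ∈ disc) : ‖ext H.1 z‖ = (ext H.1 z).re := by
  rw [ext_eq_ofReal_of_mem_cone hH hz, Complex.norm_real,
    Real.norm_of_nonneg (ext_re_pos hH hz).le, Complex.ofReal_re]

/-- The damped operators preserve the cones. -/
theorem dampedOp_mem_cone (hp : ∀ i, 0 < p i) (hS : ∀ k, (S k).Nonempty) {Ct : ℝ}
    (hCt : ∀ η : List (Fin n), ∀ x ∈ disc, ‖deriv (Φ.wordLog η) x‖ ≤ Ct)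
    (ω : ℕ → Fin n) (a : ℝ) {β : (Fin N → Fin n) → ℂ → ℝ} (hβ : ∀ J, ContDiff ℝ 1 (β J))
    {D : ℝ} (hβ1 : ∀ J x, 1 / 2 ≤ β J x) (hD : ∀ J x, ‖fderiv ℝ (β J) x‖ ≤ D)
    {H : C1D} {M : ℝ} (hH : H ∈ cone M)
    (hM : 2 * Real.pi * |a| * Ct + 2 * D + Φ.rate ^ N * M ≤ M) :
    Φ.dampedOp p S ω a β hβ H ∈ cone M := by
  intro x
  have hpos := Φ.sum_branchAmp_pos hp hS ω a x.2 (fun J => hβ1 J x) hH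
  rw [Φ.dampedOp_apply ω a hβ hH, Complex.ofReal_im, Complex.ofReal_re]
  refine ⟨rfl, hpos, ?_⟩
  have h1 := gradNorm_weightedOp_le_of_bounds (words S N ω)
    (Φ.contDiffOn_dampedWeight (p := p) (S := S) ω a hβ)
    (fun J => Φ.contDiffOn_word (List.ofFn J)) (fun J => Φ.word_mapsTo (List.ofFn J)) (g := H)
    (h := fun z => (ext H.1 z).re) (M := M) (θ := Φ.rate ^ N)
    (E := 2 * Real.pi * |a| * Ct + 2 * D)
    (fun z hz => (norm_ext_of_mem_cone hH hz).le)
    (fun z hz => norm_fderivWithin_le_of_mem_cone hH hz) x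
    (fun J => Φ.norm_fderivWithin_dampedWeight_le hp hCt ω a hβ J x.2 (hβ1 J x) (hD J x))
    (fun J _ => by simpa using Φ.norm_fderivWithin_word_le (List.ofFn J) x.2)
  have h2 : ∑ J ∈ words S N ω, ‖Φ.dampedWeight p S ω a β J x‖ *
      (ext H.1 (Φ.word (List.ofFn J) x)).re = ∑ J ∈ words S N ω,
      β J x * Φ.branchAmp (wordWeight p S ω J) a (List.ofFn J) H x := by
    refine Finset.sum_congr rfl fun J _ => ?_
    rw [Φ.norm_dampedWeight hp ω a J (by linarith [hβ1 J x]), branchAmp]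
    ring
  rw [h2] at h1
  exact h1.trans (mul_le_mul_of_nonneg_right hM hpos.le)

/-! ### Comparison with the undamped operator -/

variable (p S) in
/-- The function `P_{0,0,ω,N} (H²)`. -/
def squareTransfer (ω : ℕ → Fin n) (N : ℕ) (H : C1D) (x : ℂ) : ℝ :=
  ∑ J ∈ words S N ω, wordWeight p S ω J * (ext H.1 (Φ.word (List.ofFn J) x)).re ^ 2

theorem continuousOn_squareTransfer (ω : ℕ → Fin n) (N : ℕ) (H : C1D) :
    ContinuousOn (Φ.squareTransfer p S ω N H) disc :=
  continuousOn_finsetSum _ fun J _ => continuousOn_const.mul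
    ((Complex.continuous_re.comp_continuousOn ((continuousOn_ext H).comp
      (Φ.continuousOn_word (List.ofFn J)) (Φ.word_mapsTo (List.ofFn J)))).pow 2)

theorem transferFun_norm_sq {H : C1D} {M : ℝ} (hH : H ∈ cone M) (ω : ℕ → Fin n) {z : ℂ}
    (hz : z ∈ disc) :
    ext (Φ.transferFun p S 0 0 ω N fun x => ((‖H.1 x‖ ^ 2 : ℝ) : ℂ)) z =
      (Φ.squareTransfer p S ω N H z : ℂ) := by
  rw [ext_of_mem _ hz, transferFun_eq, squareTransfer, Complex.ofReal_sum]
  refine Finset.sum_congr rfl fun J _ => ?_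
  have hJ := Φ.word_mapsTo (List.ofFn J) hz
  rw [cocycleWeight_zero, mul_one, ext_of_mem _ hJ, Complex.ofReal_mul]
  congr 2
  rw [← norm_ext_of_mem_cone hH hJ, ext_of_mem _ hJ]

theorem integral_transferFun_norm_sq {H : C1D} {M : ℝ} (hH : H ∈ cone M) (ω ω' : ℕ → Fin n) :
    ∫ z, (ext (Φ.transferFun p S 0 0 ω N fun x => ((‖H.1 x‖ ^ 2 : ℝ) : ℂ)) z).re
      ∂(Φ.randomMeasure p S ω') = Φ.average p S ω' (Φ.squareTransfer p S ω N H) := by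
  have hc : ContinuousOn (ext (Φ.transferFun p S 0 0 ω N fun x => ((‖H.1 x‖ ^ 2 : ℝ) : ℂ))) disc :=
    (Complex.continuous_ofReal.comp_continuousOn (Φ.continuousOn_squareTransfer ω N H)).congr
      fun z hz => Φ.transferFun_norm_sq hH ω hz
  refine (Φ.integral_randomMeasure p S ω'
    (Complex.measurable_re.comp (measurable_ext hc))).trans ?_
  refine integral_congr_ae (Eventually.of_forall fun u => ?_)
  simp only [Function.comp_apply]
  rw [Φ.transferFun_norm_sq hH ω (Φ.coding_mem u), Complex.ofReal_re]

theorem squareTransfer_nonneg (hp : ∀ i, 0 < p i) (ω : ℕ → Fin n) (H : C1D) (x : ℂ) :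
    0 ≤ Φ.squareTransfer p S ω N H x :=
  Finset.sum_nonneg fun J _ => mul_nonneg (wordWeight_nonneg hp ω J) (sq_nonneg _)

/-- Harnack along contracting words: at distances of order 1/B each term changes by at most
(e^{1/4})² ≤ 2. -/
theorem squareTransfer_le_two_mul (hp : ∀ i, 0 < p i) (ω : ℕ → Fin n) {H : C1D} {M : ℝ}
    (hM : 0 ≤ M) (hH : H ∈ cone M) {x y : ℂ} (hx : x ∈ disc) (hy : y ∈ disc)
    (hxy : M * Φ.rate ^ N * ‖x - y‖ ≤ 1 / 4) :
    Φ.squareTransfer p S ω N H x ≤ 2 * Φ.squareTransfer p S ω N H y := by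
  rw [squareTransfer, squareTransfer, Finset.mul_sum]
  refine Finset.sum_le_sum fun J _ => ?_
  have hxJ := Φ.word_mapsTo (List.ofFn J) hx
  have hyJ := Φ.word_mapsTo (List.ofFn J) hy
  have h1 := re_le_exp_mul_of_mem_cone hH hxJ hyJ
  have h2 : Real.exp (M * ‖Φ.word (List.ofFn J) x - Φ.word (List.ofFn J) y‖) ≤
      Real.exp (1 / 4) := by
    rw [Real.exp_le_exp]
    refine le_trans ?_ hxy
    rw [mul_assoc]
    refine mul_le_mul_of_nonneg_left ?_ hM
    simpa using Φ.norm_word_sub_le (List.ofFn J) hx hy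
  have hexp2 : Real.exp (1 / 4) ^ 2 ≤ 2 := by
    have h4 : Real.exp (1 / 4) ^ 4 = Real.exp 1 := by
      rw [← Real.exp_nat_mul]; norm_num
    nlinarith [Real.exp_one_lt_d9, sq_nonneg (Real.exp (1 / 4 : ℝ))]
  have hx0 := ext_re_pos hH hxJ
  have hy0 := ext_re_pos hH hyJ
  have h3 : (ext H.1 (Φ.word (List.ofFn J) x)).re ^ 2 ≤
      2 * (ext H.1 (Φ.word (List.ofFn J) y)).re ^ 2 := by
    calc (ext H.1 (Φ.word (List.ofFn J) x)).re ^ 2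
        ≤ (Real.exp (1 / 4) * (ext H.1 (Φ.word (List.ofFn J) y)).re) ^ 2 := by
          gcongr
          exact h1.trans (by gcongr)
      _ = Real.exp (1 / 4) ^ 2 * (ext H.1 (Φ.word (List.ofFn J) y)).re ^ 2 := by ring
      _ ≤ _ := by gcongr
  have h4 := mul_le_mul_of_nonneg_left h3 (wordWeight_nonneg (S := S) hp ω J)
  linarith

/-- The pointwise Cauchy-Schwarz estimate. -/
theorem sq_sum_branchAmp_le (hp : ∀ i, 0 < p i) (ω : ℕ → Fin n) {a C : ℝ}
    (hC : ∀ η : List (Fin n), η.length = N → ∀ x ∈ disc, ‖Φ.wordLog η x‖ ≤ C)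
    {β : (Fin N → Fin n) → ℂ → ℝ} {x : ℂ} (hx : x ∈ disc) (hβ0 : ∀ J, 0 ≤ β J x)
    (hβ1 : ∀ J, β J x ≤ 1) {H : C1D} {M : ℝ} (hH : H ∈ cone M) :
    (∑ J ∈ words S N ω, β J x * Φ.branchAmp (wordWeight p S ω J) a (List.ofFn J) H x) ^ 2 ≤
      Real.exp (4 * Real.pi * |a| * C) * ((∑ J ∈ words S N ω, wordWeight p S ω J * β J x) *
        Φ.squareTransfer p S ω N H x) := by
  have h1 : ∑ J ∈ words S N ω, β J x * Φ.branchAmp (wordWeight p S ω J) a (List.ofFn J) H x ≤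
      Real.exp (2 * Real.pi * |a| * C) * ∑ J ∈ words S N ω,
        wordWeight p S ω J * β J x * (ext H.1 (Φ.word (List.ofFn J) x)).re := by
    rw [Finset.mul_sum]
    refine Finset.sum_le_sum fun J _ => ?_
    have hH0 := ext_re_pos hH (Φ.word_mapsTo (List.ofFn J) hx)
    have hw0 := wordWeight_nonneg (S := S) hp ω J
    have hb0 := hβ0 J
    have h2 : Real.exp (-(2 * Real.pi * a * (Φ.wordLog (List.ofFn J) x).re)) ≤
        Real.exp (2 * Real.pi * |a| * C) := by
      rw [Real.exp_le_exp]
      have h3 : |a * (Φ.wordLog (List.ofFn J) x).re| ≤ |a| * C := by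
        rw [abs_mul]
        gcongr
        exact (Complex.abs_re_le_norm _).trans (hC _ (by simp) x hx)
      have h4 := mul_le_mul_of_nonneg_left ((neg_le_abs _).trans h3) Real.two_pi_pos.le
      linarith
    calc _ = wordWeight p S ω J * β J x * (ext H.1 (Φ.word (List.ofFn J) x)).re *
          Real.exp (-(2 * Real.pi * a * (Φ.wordLog (List.ofFn J) x).re)) := by
          rw [branchAmp]; ring
      _ ≤ wordWeight p S ω J * β J x * (ext H.1 (Φ.word (List.ofFn J) x)).re *
          Real.exp (2 * Real.pi * |a| * C) := by gcongr
      _ = _ := by ring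
  have h0 : 0 ≤ ∑ J ∈ words S N ω,
      β J x * Φ.branchAmp (wordWeight p S ω J) a (List.ofFn J) H x :=
    Finset.sum_nonneg fun J _ => mul_nonneg (hβ0 J) (mul_nonneg
      (mul_nonneg (wordWeight_nonneg hp ω J) (Real.exp_pos _).le)
      (ext_re_pos hH (Φ.word_mapsTo (List.ofFn J) hx)).le)
  -- Cauchy-Schwarz puts β² with the weights and H² with the operator; then β² ≤ β makes the gain
  -- linear in the total damping.
  have h5 : (∑ J ∈ words S N ω,
      wordWeight p S ω J * β J x * (ext H.1 (Φ.word (List.ofFn J) x)).re) ^ 2 ≤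
      (∑ J ∈ words S N ω, wordWeight p S ω J * β J x ^ 2) * Φ.squareTransfer p S ω N H x := by
    refine Finset.sum_sq_le_sum_mul_sum_of_sq_le_mul _
      (fun J _ => mul_nonneg (wordWeight_nonneg hp ω J) (sq_nonneg _))
      (fun J _ => mul_nonneg (wordWeight_nonneg hp ω J) (sq_nonneg _)) fun J _ => le_of_eq ?_
    ring
  have h6 : ∑ J ∈ words S N ω, wordWeight p S ω J * β J x ^ 2 ≤
      ∑ J ∈ words S N ω, wordWeight p S ω J * β J x := by
    refine Finset.sum_le_sum fun J _ => mul_le_mul_of_nonneg_left ?_ (wordWeight_nonneg hp ω J)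
    nlinarith [hβ0 J, hβ1 J]
  calc _ ≤ (Real.exp (2 * Real.pi * |a| * C) * ∑ J ∈ words S N ω,
        wordWeight p S ω J * β J x * (ext H.1 (Φ.word (List.ofFn J) x)).re) ^ 2 := by gcongr
    _ = Real.exp (4 * Real.pi * |a| * C) * (∑ J ∈ words S N ω,
        wordWeight p S ω J * β J x * (ext H.1 (Φ.word (List.ofFn J) x)).re) ^ 2 := by
      rw [mul_pow, ← Real.exp_nat_mul]
      congr 2
      push_cast
      ring
    _ ≤ _ := by
      gcongr
      exact h5.trans (mul_le_mul_of_nonneg_right h6 (Φ.squareTransfer_nonneg hp ω H x))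

end DiscIFS

/-- Words with a common prefix and prescribed last letter: their logarithmic derivatives differ
essentially by the pair in (UNI). The letter in position N is selected by ω N. -/
theorem exists_words_snoc {n : ℕ} {S : Fin n → Finset (Fin n)} (hS : ∀ k, (S k).Nonempty) (N : ℕ)
    (ω : ℕ → Fin n) : ∃ ξ : List (Fin n), ∀ i ∈ S (ω N),
      ∃ J ∈ words S (N + 1) ω, List.ofFn J = ξ ++ [i] := by
  choose f hf using hS
  refine ⟨List.ofFn fun j : Fin N => f (ω j), fun i hi =>
    ⟨Fin.snoc (α := fun _ => Fin n) (fun j : Fin N => f (ω j)) i, ?_, ?_⟩⟩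
  · refine Fintype.mem_piFinset.2 fun j => ?_
    refine Fin.lastCases ?_ (fun j => ?_) j
    · simpa using hi
    · simpa using hf _
  · rw [List.ofFn_succ', List.concat_eq_append]
    simp

/-! ### Damping factors -/

section Damping

variable {n N : ℕ} {J₁ J₂ : Fin N → Fin n} {σ τ : ℝ} {Γ₁ Γ₂ : Finset (ℤ × ℤ)}

open Classical in
/-- The factors that damp the branch `J₁` near the lattice points in `Γ₁` and the branch `J₂` near
those in `Γ₂`. -/
def dampingFactor (J₁ J₂ : Fin N → Fin n) (σ τ : ℝ) (Γ₁ Γ₂ : Finset (ℤ × ℤ)) (J : Fin N → Fin n)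
    (x : ℂ) : ℝ :=
  1 - τ * ((if J = J₁ then bumpSum σ Γ₁ x else 0) + if J = J₂ then bumpSum σ Γ₂ x else 0)

theorem dampingFactor_left (h : J₁ ≠ J₂) (x : ℂ) :
    dampingFactor J₁ J₂ σ τ Γ₁ Γ₂ J₁ x = 1 - τ * bumpSum σ Γ₁ x := by
  simp [dampingFactor, h]

theorem dampingFactor_right (h : J₁ ≠ J₂) (x : ℂ) :
    dampingFactor J₁ J₂ σ τ Γ₁ Γ₂ J₂ x = 1 - τ * bumpSum σ Γ₂ x := by
  simp [dampingFactor, h.symm]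

theorem dampingFactor_other {J : Fin N → Fin n} (h₁ : J ≠ J₁) (h₂ : J ≠ J₂) (x : ℂ) :
    dampingFactor J₁ J₂ σ τ Γ₁ Γ₂ J x = 1 := by
  simp [dampingFactor, h₁, h₂]

/-- Since J₁ ≠ J₂, at most one bump sum acts on any given word, so all bounds reduce to those for a
single bump sum. -/
theorem dampingFactor_cases (h : J₁ ≠ J₂) (J : Fin N → Fin n) :
    (∃ Γ, dampingFactor J₁ J₂ σ τ Γ₁ Γ₂ J = fun x => 1 - τ * bumpSum σ Γ x) := by
  by_cases h₁ : J = J₁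
  · exact ⟨Γ₁, funext fun x => by rw [h₁, dampingFactor_left h]⟩
  by_cases h₂ : J = J₂
  · exact ⟨Γ₂, funext fun x => by rw [h₂, dampingFactor_right h]⟩
  · exact ⟨∅, funext fun x => by rw [dampingFactor_other h₁ h₂]; simp [bumpSum]⟩

theorem contDiff_dampingFactor (h : J₁ ≠ J₂) (J : Fin N → Fin n) :
    ContDiff ℝ 1 (dampingFactor J₁ J₂ σ τ Γ₁ Γ₂ J) := by
  obtain ⟨Γ, hΓ⟩ := dampingFactor_cases (σ := σ) (τ := τ) (Γ₁ := Γ₁) (Γ₂ := Γ₂) h J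
  rw [hΓ]
  exact contDiff_const.sub (contDiff_const.mul (contDiff_bumpSum σ Γ))

theorem dampingFactor_le_one (h : J₁ ≠ J₂) (hτ : 0 ≤ τ) (J : Fin N → Fin n) (x : ℂ) :
    dampingFactor J₁ J₂ σ τ Γ₁ Γ₂ J x ≤ 1 := by
  obtain ⟨Γ, hΓ⟩ := dampingFactor_cases (σ := σ) (τ := τ) (Γ₁ := Γ₁) (Γ₂ := Γ₂) h J
  rw [hΓ]
  have := mul_nonneg hτ (bumpSum_nonneg σ Γ x)
  simp only
  linarith

theorem le_dampingFactor (h : J₁ ≠ J₂) (hτ : 0 ≤ τ) (J : Fin N → Fin n) (x : ℂ) :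
    1 - 49 * τ ≤ dampingFactor J₁ J₂ σ τ Γ₁ Γ₂ J x := by
  obtain ⟨Γ, hΓ⟩ := dampingFactor_cases (σ := σ) (τ := τ) (Γ₁ := Γ₁) (Γ₂ := Γ₂) h J
  rw [hΓ]
  have := mul_le_mul_of_nonneg_left (bumpSum_le σ Γ x) hτ
  simp only
  linarith

theorem norm_fderiv_dampingFactor_le (h : J₁ ≠ J₂) (hτ : 0 ≤ τ) {C : ℝ} (hC0 : 0 ≤ C)
    (hC : ∀ z, ‖fderiv ℝ (bump : ℂ → ℝ) z‖ ≤ C) (hσ : 0 < σ) (J : Fin N → Fin n) (x : ℂ) :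
    ‖fderiv ℝ (dampingFactor J₁ J₂ σ τ Γ₁ Γ₂ J) x‖ ≤ τ * (49 * (C / σ)) := by
  obtain ⟨Γ, hΓ⟩ := dampingFactor_cases (σ := σ) (τ := τ) (Γ₁ := Γ₁) (Γ₂ := Γ₂) h J
  have h1 := (((contDiff_bumpSum σ Γ).differentiable one_ne_zero x).hasFDerivAt.const_mul
    τ).const_sub 1
  rw [hΓ, h1.fderiv, norm_neg, norm_smul, Real.norm_of_nonneg hτ]
  exact mul_le_mul_of_nonneg_left (norm_fderiv_bumpSum_le hC0 hC hσ Γ x) hτ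

/-- The weights sum to 1, and near `c` one of the two special words, of weight at least w₀^N, loses
a proportion at least τ. -/
theorem sum_mul_dampingFactor_le {p : Fin n → ℝ} {S : Fin n → Finset (Fin n)} {w₀ : ℝ}
    (hw₀ : 0 < w₀) (hw : ∀ k, ∀ i ∈ S k, w₀ ≤ branchWeight p S k i)
    (hp : ∀ i, 0 < p i) (hS : ∀ k, (S k).Nonempty) {ω : ℕ → Fin n} (h : J₁ ≠ J₂)
    (hJ₁ : J₁ ∈ words S N ω) (hJ₂ : J₂ ∈ words S N ω) (hτ : 0 ≤ τ) (hσ : 0 < σ) {c : ℤ × ℤ}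
    (hc : c ∈ Γ₁ ∨ c ∈ Γ₂) {x : ℂ} (hx : ‖x - σ • latticePoint c‖ ≤ 2 * σ) :
    ∑ J ∈ words S N ω, wordWeight p S ω J * dampingFactor J₁ J₂ σ τ Γ₁ Γ₂ J x ≤
      1 - τ * w₀ ^ N := by
  obtain ⟨J₀, hJ₀, hle⟩ : ∃ J₀ ∈ words S N ω,
      τ ≤ 1 - dampingFactor J₁ J₂ σ τ Γ₁ Γ₂ J₀ x := by
    rcases hc with hc | hc
    · refine ⟨J₁, hJ₁, ?_⟩
      rw [dampingFactor_left h]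
      nlinarith [one_le_bumpSum hσ hc hx]
    · refine ⟨J₂, hJ₂, ?_⟩
      rw [dampingFactor_right h]
      nlinarith [one_le_bumpSum hσ hc hx]
  have h1 : wordWeight p S ω J₀ * (1 - dampingFactor J₁ J₂ σ τ Γ₁ Γ₂ J₀ x) ≤
      ∑ J ∈ words S N ω, wordWeight p S ω J * (1 - dampingFactor J₁ J₂ σ τ Γ₁ Γ₂ J x) :=
    Finset.single_le_sum (f := fun J => wordWeight p S ω J *
      (1 - dampingFactor J₁ J₂ σ τ Γ₁ Γ₂ J x)) (fun J _ => mul_nonneg (wordWeight_nonneg hp ω J)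
        (sub_nonneg.2 (dampingFactor_le_one h hτ J x))) hJ₀
  have h2 : w₀ ^ N * τ ≤ wordWeight p S ω J₀ * (1 - dampingFactor J₁ J₂ σ τ Γ₁ Γ₂ J₀ x) :=
    mul_le_mul (pow_le_wordWeight hw₀ hw hJ₀) hle hτ (wordWeight_nonneg hp ω J₀)
  simp only [mul_sub, mul_one, Finset.sum_sub_distrib] at h1
  rw [sum_wordWeight hp hS] at h1
  linarith

end Damping

/-! ### Domination by the damped operators -/

namespace DiscIFS

variable {n : ℕ} (Φ : DiscIFS n) {p : Fin n → ℝ} {S : Fin n → Finset (Fin n)} {N : ℕ}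

theorem norm_branchTerm_le {H f : C1D} {M : ℝ} (hH : H ∈ cone M)
    (hf : ∀ x, ‖f.1 x‖ ≤ (H.1 x).re) {c : ℝ} (hc : 0 ≤ c) (a b : ℝ) (ℓ : ℤ) (η : List (Fin n))
    {x : ℂ} (hx : x ∈ disc) :
    ‖Φ.branchTerm c (a + b * Complex.I) ℓ η f x‖ ≤ Φ.branchAmp c a η H x := by
  have h0 : 0 ≤ Φ.branchAmp c a η H x :=
    mul_nonneg (mul_nonneg hc (Real.exp_pos _).le) (ext_re_pos hH (Φ.word_mapsTo η hx)).le
  rw [Φ.branchTerm_eq hH _ _ _ _ _ _ hx, norm_mul, norm_mul, Complex.norm_exp_ofReal_mul_I,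
    one_mul, Complex.norm_real, Real.norm_of_nonneg h0]
  exact mul_le_of_le_one_right h0 (Φ.norm_branchQuot_le hH hf η hx)

/-- The radius 3σ in `BoundedNear` is the support radius of a bump, so the bound holds wherever the
damping is active. -/
theorem le_of_bumpSum_ne_zero {σ : ℝ} (hσ : 0 < σ) {Γ : Finset (ℤ × ℤ)} {z : ℂ → ℂ} {A : ℂ → ℝ}
    (hΓ : ∀ c ∈ Γ, BoundedNear σ z A c) {x : ℂ} (hx : x ∈ disc) (hne : bumpSum σ Γ x ≠ 0) :
    ‖z x‖ ≤ A x := by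
  obtain ⟨c, hc, hcx⟩ := exists_of_bumpSum_ne_zero hσ hne
  exact hΓ c hc x hx hcx

/-- The transfer operator is dominated by the damped operator. -/
theorem norm_sum_branchTerm_le (hp : ∀ i, 0 < p i) {ω : ℕ → Fin n} {J₁ J₂ : Fin N → Fin n}
    (h : J₁ ≠ J₂) (hJ₁ : J₁ ∈ words S N ω) (hJ₂ : J₂ ∈ words S N ω)
    {H f : C1D} {M : ℝ} (hH : H ∈ cone M) (hf : ∀ x, ‖f.1 x‖ ≤ (H.1 x).re) {a b : ℝ} {ℓ : ℤ}
    {σ τ τ' : ℝ} (hσ : 0 < σ) (hτ : 0 ≤ τ) (hτ' : 98 * τ ≤ τ') {Γ₁ Γ₂ : Finset (ℤ × ℤ)}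
    (hΓ₁ : ∀ c ∈ Γ₁, BoundedNear σ
      (fun x => Φ.branchTerm (wordWeight p S ω J₁) (a + b * Complex.I) ℓ (List.ofFn J₁) f x +
        Φ.branchTerm (wordWeight p S ω J₂) (a + b * Complex.I) ℓ (List.ofFn J₂) f x)
      (fun x => (1 - τ') * Φ.branchAmp (wordWeight p S ω J₁) a (List.ofFn J₁) H x +
        Φ.branchAmp (wordWeight p S ω J₂) a (List.ofFn J₂) H x) c)
    (hΓ₂ : ∀ c ∈ Γ₂, BoundedNear σ
      (fun x => Φ.branchTerm (wordWeight p S ω J₁) (a + b * Complex.I) ℓ (List.ofFn J₁) f x +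
        Φ.branchTerm (wordWeight p S ω J₂) (a + b * Complex.I) ℓ (List.ofFn J₂) f x)
      (fun x => Φ.branchAmp (wordWeight p S ω J₁) a (List.ofFn J₁) H x +
        (1 - τ') * Φ.branchAmp (wordWeight p S ω J₂) a (List.ofFn J₂) H x) c)
    {x : ℂ} (hx : x ∈ disc) :
    ‖∑ J ∈ words S N ω,
      Φ.branchTerm (wordWeight p S ω J) (a + b * Complex.I) ℓ (List.ofFn J) f x‖ ≤
      ∑ J ∈ words S N ω, dampingFactor J₁ J₂ σ τ Γ₁ Γ₂ J x *
        Φ.branchAmp (wordWeight p S ω J) a (List.ofFn J) H x := by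
  classical
  have hpair : ({J₁, J₂} : Finset (Fin N → Fin n)) ⊆ words S N ω := by
    intro J hJ
    rcases Finset.mem_insert.1 hJ with rfl | hJ
    · exact hJ₁
    · rw [Finset.mem_singleton.1 hJ]; exact hJ₂
  rw [← Finset.sum_sdiff hpair, ← Finset.sum_sdiff hpair, Finset.sum_pair h, Finset.sum_pair h]
  refine (norm_add_le _ _).trans (add_le_add ?_ ?_)
  · refine (norm_sum_le _ _).trans (Finset.sum_le_sum fun J hJ => ?_)
    have hJ' := (Finset.mem_sdiff.1 hJ).2
    simp only [Finset.mem_insert, Finset.mem_singleton, not_or] at hJ'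
    rw [dampingFactor_other hJ'.1 hJ'.2, one_mul]
    exact Φ.norm_branchTerm_le hH hf (wordWeight_nonneg hp ω J) a b ℓ _ hx
  · rw [dampingFactor_left h, dampingFactor_right h]
    have hn1 := Φ.norm_branchTerm_le hH hf (wordWeight_nonneg (S := S) hp ω J₁) a b ℓ
      (List.ofFn J₁) hx
    have hn2 := Φ.norm_branchTerm_le hH hf (wordWeight_nonneg (S := S) hp ω J₂) a b ℓ
      (List.ofFn J₂) hx
    have hn := norm_add_le
      (Φ.branchTerm (wordWeight p S ω J₁) (a + b * Complex.I) ℓ (List.ofFn J₁) f x)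
      (Φ.branchTerm (wordWeight p S ω J₂) (a + b * Complex.I) ℓ (List.ofFn J₂) f x)
    have A1 : 0 ≤ Φ.branchAmp (wordWeight p S ω J₁) a (List.ofFn J₁) H x :=
      (norm_nonneg _).trans hn1
    have A2 : 0 ≤ Φ.branchAmp (wordWeight p S ω J₂) a (List.ofFn J₂) H x :=
      (norm_nonneg _).trans hn2
    -- At most 49 units of bump height overlap, so the total damping of a branch is at most 49τ ≤
    -- τ'/2, half of what `BoundedNear` allows.
    have t1 := mul_le_mul_of_nonneg_left (bumpSum_le σ Γ₁ x) hτ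
    have t2 := mul_le_mul_of_nonneg_left (bumpSum_le σ Γ₂ x) hτ
    have s1 : τ * bumpSum σ Γ₁ x * Φ.branchAmp (wordWeight p S ω J₁) a (List.ofFn J₁) H x ≤
        τ' / 2 * Φ.branchAmp (wordWeight p S ω J₁) a (List.ofFn J₁) H x :=
      mul_le_mul_of_nonneg_right (by linarith) A1
    have s2 : τ * bumpSum σ Γ₂ x * Φ.branchAmp (wordWeight p S ω J₂) a (List.ofFn J₂) H x ≤
        τ' / 2 * Φ.branchAmp (wordWeight p S ω J₂) a (List.ofFn J₂) H x :=
      mul_le_mul_of_nonneg_right (by linarith) A2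
    have hτ'0 : 0 ≤ τ' := by linarith
    have r1 := mul_nonneg hτ'0 A1
    have r2 := mul_nonneg hτ'0 A2
    by_cases z1 : bumpSum σ Γ₁ x = 0
    · by_cases z2 : bumpSum σ Γ₂ x = 0
      · rw [z1, z2]
        linarith
      · have q := le_of_bumpSum_ne_zero hσ hΓ₂ hx z2
        beta_reduce at q
        rw [z1]
        linarith
    · by_cases z2 : bumpSum σ Γ₂ x = 0
      · have q := le_of_bumpSum_ne_zero hσ hΓ₁ hx z1
        beta_reduce at q
        rw [z2]
        linarith
      -- When both dampings are active, the average of the two bounds saves τ'/2 on each amplitude;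
      -- this is why only half of τ' is used.
      · have q₁ := le_of_bumpSum_ne_zero hσ hΓ₁ hx z1
        have q₂ := le_of_bumpSum_ne_zero hσ hΓ₂ hx z2
        beta_reduce at q₁ q₂
        linarith

end DiscIFS

/-! ### The L² contraction and the finite family of operators -/

namespace DiscIFS

variable {n : ℕ} (Φ : DiscIFS n) {p : Fin n → ℝ} {S : Fin n → Finset (Fin n)} {N : ℕ}

variable (S) in
/-- Every cylinder of size comparable to `r` contains an admissible sub-cylinder of depth `m` that
lies near a point of `σ Γ`. -/
def IsDenseAt (ω : ℕ → Fin n) (lam r σ : ℝ) (m : ℕ) (Γ : Set (ℤ × ℤ)) : Prop :=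
  ∀ v : List (Fin n), lam * r ≤ ‖deriv (Φ.word v) 0‖ → ‖deriv (Φ.word v) 0‖ ≤ r →
    ∃ u : List (Fin n), u.length = m ∧ IsAdmissible S (shift v.length ω) u ∧ ∃ c ∈ Γ,
      ∀ x ∈ disc, ‖Φ.word v (Φ.word u x) - σ • latticePoint c‖ ≤ 2 * σ

/-- The contraction of the damped operators in `L²`. -/
theorem integral_dampedOp_le {w₀ : ℝ} (hw₀ : 0 < w₀)
    (hw : ∀ k, ∀ i ∈ S k, w₀ ≤ branchWeight p S k i)
    (hp : ∀ i, 0 < p i) (hS : ∀ k, (S k).Nonempty) {L κ : ℝ} (hL : Φ.HasDistortion L)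
    (hκ : ∀ i, ∀ x ∈ disc, κ ≤ ‖deriv (Φ.map i) x‖) (hκ0 : 0 < κ)
    {r σ τ : ℝ} (hr : 0 < r) (hr1 : r ≤ 1) (hσ : 0 < σ) (hτ : 0 ≤ τ) (hτ1 : 49 * τ ≤ 1)
    {C : ℝ} (hC : ∀ η : List (Fin n), η.length = N → ∀ x ∈ disc, ‖Φ.wordLog η x‖ ≤ C)
    {ω : ℕ → Fin n} {J₁ J₂ : Fin N → Fin n}
    (h : J₁ ≠ J₂) (hJ₁ : J₁ ∈ words S N ω) (hJ₂ : J₂ ∈ words S N ω) {a M : ℝ} (hM : 0 ≤ M)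
    (hosc : M * Φ.rate ^ N * (2 * L * r) ≤ 1 / 4) {m : ℕ} {Γ₁ Γ₂ : Finset (ℤ × ℤ)}
    (hΓ : Φ.IsDenseAt S (shift N ω) (κ / L) r σ m {c | c ∈ Γ₁ ∨ c ∈ Γ₂})
    {H : C1D} (hH : H ∈ cone M) :
    ∫ z, ‖ext (Φ.dampedOp p S ω a _ (contDiff_dampingFactor (σ := σ) (τ := τ) (Γ₁ := Γ₁)
        (Γ₂ := Γ₂) h) H).1 z‖ ^ 2 ∂(Φ.randomMeasure p S (shift N ω)) ≤
      Real.exp (4 * Real.pi * |a| * C) * (1 - w₀ ^ m * (τ * w₀ ^ N) / 4) *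
        ∫ z, (ext (Φ.transferFun p S 0 0 ω N fun x => ((‖H.1 x‖ ^ 2 : ℝ) : ℂ)) z).re
          ∂(Φ.randomMeasure p S (shift N ω)) := by
  have hβ1 := fun (J : Fin N → Fin n) (x : ℂ) => dampingFactor_le_one (σ := σ) (Γ₁ := Γ₁)
    (Γ₂ := Γ₂) h hτ J x
  have hβ0 : ∀ (J : Fin N → Fin n) (x : ℂ), 0 ≤ dampingFactor J₁ J₂ σ τ Γ₁ Γ₂ J x := fun J x => by
    have := le_dampingFactor (σ := σ) (Γ₁ := Γ₁) (Γ₂ := Γ₂) h hτ J x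
    linarith
  set T := Φ.dampedOp p S ω a _ (contDiff_dampingFactor (σ := σ) (τ := τ) (Γ₁ := Γ₁)
        (Γ₂ := Γ₂) h) H with hT
  set E := Real.exp (4 * Real.pi * |a| * C)
  have hE0 : 0 < E := Real.exp_pos _
  have hTm := measurable_ext (continuousOn_ext T)
  rw [Φ.integral_transferFun_norm_sq hH, Φ.integral_randomMeasure p S _ (hTm.norm.pow_const 2)]
  set F : ℂ → ℝ := fun z => ‖ext T.1 z‖ ^ 2 with hFdef
  set G : ℂ → ℝ := fun z => E * Φ.squareTransfer p S ω N H z with hGdef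
  have hF : ContinuousOn F disc := (continuousOn_ext T).norm.pow 2
  have hG : ContinuousOn G disc := continuousOn_const.mul (Φ.continuousOn_squareTransfer ω N H)
  have hQ0 := fun x => Φ.squareTransfer_nonneg (S := S) (N := N) hp ω H x
  have hpt : ∀ x ∈ disc, F x ≤ (∑ J ∈ words S N ω,
      wordWeight p S ω J * dampingFactor J₁ J₂ σ τ Γ₁ Γ₂ J x) * G x := by
    intro x hx
    have h1 := Φ.sq_sum_branchAmp_le (S := S) hp ω (a := a) hC hx (fun J => hβ0 J x)
      (fun J => hβ1 J x) hH
    have h2 : F x = (∑ J ∈ words S N ω, dampingFactor J₁ J₂ σ τ Γ₁ Γ₂ J x *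
        Φ.branchAmp (wordWeight p S ω J) a (List.ofFn J) H x) ^ 2 := by
      simp only [hFdef]
      rw [ext_of_mem _ hx, hT, Φ.dampedOp_apply ω a _ hH ⟨x, hx⟩, Complex.norm_real,
        Real.norm_eq_abs, sq_abs]
    rw [h2]
    refine h1.trans (le_of_eq ?_)
    simp only [hGdef]
    ring
  have hFG : ∀ x ∈ disc, F x ≤ G x := by
    intro x hx
    refine (hpt x hx).trans ?_
    have h1 : ∑ J ∈ words S N ω, wordWeight p S ω J * dampingFactor J₁ J₂ σ τ Γ₁ Γ₂ J x ≤ 1 := by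
      rw [← sum_wordWeight hp hS N ω]
      exact Finset.sum_le_sum fun J _ =>
        mul_le_of_le_one_right (wordWeight_nonneg hp ω J) (hβ1 J x)
    exact mul_le_of_le_one_left (mul_nonneg hE0.le (hQ0 x)) h1
  have hL1 := Φ.one_le_of_hasDistortion hL
  -- It is enough to gain on every cylinder of size comparable to r: each contains a sub-cylinder of
  -- depth m on which the damped mass is at most 1 - τw₀^N.
  have key := Φ.average_le_of_cylinders (p := p) (S := S) hp hS hL hκ hκ0 hr hr1
    (ω := shift N ω) (c := 1 - w₀ ^ m * (τ * w₀ ^ N) / 4) hF hG fun v hv1 hv2 => ?_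
  · refine key.trans (le_of_eq ?_)
    rw [hGdef, Φ.average_const_mul]
    ring
  · obtain ⟨u, hu, hua, c, hc, huc⟩ := hΓ v hv1 hv2
    rw [← hu]
    refine Φ.average_le_of_subcylinder hw₀ hw hp hS hua
      (hF.comp (Φ.continuousOn_word v) (Φ.word_mapsTo v))
      (hG.comp (Φ.continuousOn_word v) (Φ.word_mapsTo v))
      (fun x hx => hFG _ (Φ.word_mapsTo v hx)) (mul_nonneg hτ (pow_nonneg hw₀.le N))
      (fun x hx => ?_) fun x hx y hy => ?_
    · have hvx := Φ.word_mapsTo v (Φ.word_mapsTo u hx)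
      refine (hpt _ hvx).trans ?_
      exact mul_le_mul_of_nonneg_right (sum_mul_dampingFactor_le hw₀ hw hp hS h hJ₁ hJ₂ hτ hσ hc
        (huc x hx)) (mul_nonneg hE0.le (hQ0 _))
    · have hvx := Φ.word_mapsTo v hx
      have hvy := Φ.word_mapsTo v hy
      have h1 : ‖Φ.word v x - Φ.word v y‖ ≤ 2 * L * r := by
        refine (Φ.norm_word_sub_le_of_hasDistortion hL v hx hy).trans ?_
        calc L * ‖deriv (Φ.word v) 0‖ * ‖x - y‖ ≤ L * r * 2 := by
              gcongr
              exact norm_sub_le_two_of_mem_disc hx hy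
          _ = 2 * L * r := by ring
      have h2 := Φ.squareTransfer_le_two_mul (S := S) hp ω hM hH hvx hvy
        (le_trans (by have := Φ.rate_nonneg; gcongr) hosc)
      simp only [hGdef, Function.comp_apply]
      have h3 := mul_le_mul_of_nonneg_left h2 hE0.le
      linarith

/-- The Dolgopyat operators, under explicit conditions on the constants. -/
theorem exists_dolgopyat_operators {K : Set ℂ} (hatt : Φ.IsAttractor K)
    (hp : ∀ i, 0 < p i) (hS : ∀ k, (S k).Nonempty) (hdense : ∀ k, Φ.IsDense (S k))
    {w₀ : ℝ} (hw₀ : 0 < w₀) (hw : ∀ k, ∀ i ∈ S k, w₀ ≤ branchWeight p S k i)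
    {L κ κ₁ : ℝ} (hL : Φ.HasDistortion L) (hκ0 : 0 < κ)
    (hκ : ∀ g : ℂ → ℂ, AnalyticOnNhd ℂ g disc → deriv g 0 ≠ 0 →
      (∀ x ∈ disc, ∀ y ∈ disc, ‖deriv g x‖ ≤ L * ‖deriv g y‖) → ∀ w : ℂ, ‖w‖ = 1 →
      ∃ x ∈ K, ∃ y ∈ K, κ * ‖deriv g 0‖ ≤ |(w * (g y - g x)).re|)
    (hrate : 16 * L * Φ.rate ≤ κ) (hκ₁0 : 0 < κ₁)
    (hκ₁ : ∀ i, ∀ x ∈ disc, κ₁ ≤ ‖deriv (Φ.map i) x‖)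
    {Ct : ℝ} (hCt : ∀ η : List (Fin n), ∀ x ∈ disc, ‖deriv (Φ.wordLog η) x‖ ≤ Ct)
    {ω : ℕ → Fin n} {J₁ J₂ : Fin N → Fin n} (h : J₁ ≠ J₂) (hJ₁ : J₁ ∈ words S N ω)
    (hJ₂ : J₂ ∈ words S N ω) {m₀ C C' : ℝ} (hm₀ : 0 < m₀)
    (hm : ∀ x ∈ disc,
      m₀ ≤ ‖deriv (Φ.wordLog (List.ofFn J₁)) x - deriv (Φ.wordLog (List.ofFn J₂)) x‖)
    (hC0 : 0 ≤ C) (hC : ∀ η, η.length = N → ∀ x ∈ disc, ∀ y ∈ disc,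
      ‖deriv (Φ.wordLog η) x - deriv (Φ.wordLog η) y‖ ≤ C * ‖x - y‖)
    (hC' : ∀ η : List (Fin n), η.length = N → ∀ x ∈ disc, ‖Φ.wordLog η x‖ ≤ C')
    {Cb : ℝ} (hCb0 : 0 ≤ Cb) (hCb : ∀ z, ‖fderiv ℝ (bump : ℂ → ℝ) z‖ ≤ Cb)
    {M : ℝ} (hM : 0 ≤ M) {a b : ℝ} {ℓ : ℤ}
    {r σ τ τ' δ : ℝ} (hr : 0 < r) (hr1 : r ≤ 1) (hσ : 0 < σ) (hτ0 : 0 ≤ τ) (hττ' : 98 * τ ≤ τ')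
    (hτ1 : 4 * τ' ≤ 1) (hδ : 8 * τ' ≤ δ ^ 2) (hδ0 : 0 ≤ δ)
    (hosc : (2 * Real.pi * |a| * Ct + M * Φ.rate ^ N) * (6 * σ) ≤ 1 / 4)
    (hosc' : M * Φ.rate ^ N * (2 * L * r) ≤ 1 / 4)
    (hσκ : 32 * σ ≤ κ * (κ₁ / L) * r) (hσL : 8 * σ ≤ L * r)
    (hsmall : 128 * (C * L * (L * r)) ≤ m₀ * (κ * (κ₁ / L)))
    (hup : ‖frequency b ℓ‖ * (8 * (Ct * (L * r))) ≤ 1)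
    (hgap : 64 * (δ + 8 * (M * Φ.rate ^ N * (L * r))) <
      ‖frequency b ℓ‖ * (m₀ * (κ * (κ₁ / L)) * r))
    {t₀ : ℕ} (ht₀ : L * r * Φ.rate ^ t₀ ≤ σ)
    (hcone : 2 * Real.pi * |a| * Ct + 2 * (τ * (49 * (Cb / σ))) + Φ.rate ^ N * M ≤ M)
    (hdom : 2 * ((2 * Real.pi * ‖(a + b * Complex.I : ℂ)‖ + |(ℓ : ℝ)|) * Ct + Φ.rate ^ N * M) ≤ M)
    {α : ℝ} (hα : Real.exp (4 * Real.pi * |a| * C') *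
      (1 - w₀ ^ (1 + t₀) * (τ * w₀ ^ N) / 4) ≤ α) :
    ∃ 𝒩 : Set (C1D →ₗ[ℂ] C1D), 𝒩.Finite ∧ (∀ T ∈ 𝒩, IsBoundedOp T) ∧
      (∀ T ∈ 𝒩, ∀ H ∈ cone M, T H ∈ cone M) ∧
      (∀ T ∈ 𝒩, ∀ H ∈ cone M,
        ∫ z, ‖ext (T H).1 z‖ ^ 2 ∂(Φ.randomMeasure p S (shift N ω)) ≤
          α * ∫ z, (ext (Φ.transferFun p S 0 0 ω N fun x => ((‖H.1 x‖ ^ 2 : ℝ) : ℂ)) z).re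
            ∂(Φ.randomMeasure p S (shift N ω))) ∧
      (∀ H ∈ cone M, ∀ f : C1D, (∀ x, ‖f.1 x‖ ≤ (H.1 x).re) →
        (∀ x, gradNorm f.1 x ≤ M * (H.1 x).re) →
        ∃ T ∈ 𝒩,
          (∀ x, ‖(Φ.transfer p S (a + b * Complex.I) ℓ ω N f).1 x‖ ≤ ((T H).1 x).re) ∧
          ∀ x, gradNorm (Φ.transfer p S (a + b * Complex.I) ℓ ω N f).1 x ≤
            M * ((T H).1 x).re) := by
  classical
  set op : Finset (ℤ × ℤ) × Finset (ℤ × ℤ) → (C1D →ₗ[ℂ] C1D) := fun Γ =>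
    Φ.dampedOp p S ω a _ (contDiff_dampingFactor (σ := σ) (τ := τ) (Γ₁ := Γ.1) (Γ₂ := Γ.2) h)
    with hop
  have hhalf : ∀ (Γ : Finset (ℤ × ℤ) × Finset (ℤ × ℤ)) (J : Fin N → Fin n) (x : ℂ),
      1 / 2 ≤ dampingFactor J₁ J₂ σ τ Γ.1 Γ.2 J x := fun Γ J x => by
    have := le_dampingFactor (σ := σ) (Γ₁ := Γ.1) (Γ₂ := Γ.2) h hτ0 J x
    linarith
  -- The L² bound is required of every member, so only pairs of grid subsets whose union meets the
  -- neighbourhood of a sub-cylinder in every cylinder are admitted.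
  refine ⟨op '' {Γ | Γ ∈ (grid σ).powerset ×ˢ (grid σ).powerset ∧
    Φ.IsDenseAt S (shift N ω) (κ₁ / L) r σ (1 + t₀) {c | c ∈ Γ.1 ∨ c ∈ Γ.2}}, ?_, ?_, ?_, ?_, ?_⟩
  · exact ((Finset.finite_toSet _).subset fun Γ hΓ => hΓ.1).image op
  · rintro _ ⟨Γ, -, rfl⟩
    exact isBoundedOp_weightedOp _ _ _ _
  · rintro _ ⟨Γ, -, rfl⟩ H hH
    exact Φ.dampedOp_mem_cone hp hS hCt ω a _ (hhalf Γ)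
      (norm_fderiv_dampingFactor_le h hτ0 hCb0 hCb hσ) hH hcone
  · rintro _ ⟨Γ, ⟨-, hΓ⟩, rfl⟩ H hH
    refine (Φ.integral_dampedOp_le hw₀ hw hp hS hL hκ₁ hκ₁0 hr hr1 hσ hτ0 (by linarith) hC' h
      hJ₁ hJ₂ hM hosc' hΓ hH).trans ?_
    refine mul_le_mul_of_nonneg_right hα ?_
    rw [Φ.integral_transferFun_norm_sq hH]
    exact Φ.average_nonneg _ fun x _ => Φ.squareTransfer_nonneg hp ω H x
  · intro H hH f hf hf'
    -- Every grid point where damping is permitted for the given f and H is used; cancellation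
    -- inside cylinders shows that this pair is admitted.
    set Γ₁ := (grid σ).filter fun c => BoundedNear σ
      (fun x => Φ.branchTerm (wordWeight p S ω J₁) (a + b * Complex.I) ℓ (List.ofFn J₁) f x +
        Φ.branchTerm (wordWeight p S ω J₂) (a + b * Complex.I) ℓ (List.ofFn J₂) f x)
      (fun x => (1 - τ') * Φ.branchAmp (wordWeight p S ω J₁) a (List.ofFn J₁) H x +
        Φ.branchAmp (wordWeight p S ω J₂) a (List.ofFn J₂) H x) c
    set Γ₂ := (grid σ).filter fun c => BoundedNear σ
      (fun x => Φ.branchTerm (wordWeight p S ω J₁) (a + b * Complex.I) ℓ (List.ofFn J₁) f x +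
        Φ.branchTerm (wordWeight p S ω J₂) (a + b * Complex.I) ℓ (List.ofFn J₂) f x)
      (fun x => Φ.branchAmp (wordWeight p S ω J₁) a (List.ofFn J₁) H x +
        (1 - τ') * Φ.branchAmp (wordWeight p S ω J₂) a (List.ofFn J₂) H x) c
    have hwpos : ∀ J ∈ words S N ω, 0 < wordWeight p S ω J := fun J hJ =>
      Finset.prod_pos fun j _ => branchWeight_pos hp (Fintype.mem_piFinset.1 hJ j)
    have hdense' : Φ.IsDenseAt S (shift N ω) (κ₁ / L) r σ (1 + t₀) {c | c ∈ Γ₁ ∨ c ∈ Γ₂} := by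
      intro v hv1 hv2
      have hL0 : 0 < L := one_pos.trans_le (Φ.one_le_of_hasDistortion hL)
      obtain ⟨u, hu, hua, c, hc, hcΓ, hcu⟩ := Φ.exists_damped_subcylinder hatt hS hdense hL hκ0 hκ
        hrate (div_pos hκ₁0 hL0) hCt (List.length_ofFn (f := J₁)) (List.length_ofFn (f := J₂))
        hm₀ hm hC0 hC hM hH hf hf' (hwpos J₁ hJ₁) (hwpos J₂ hJ₂) hr hσ hτ1 hδ hδ0 hosc hσκ hσL
        hsmall hup hgap ht₀ (ω := shift v.length (shift N ω)) hv1 hv2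
      refine ⟨u, hu, hua, c, ?_, hcu⟩
      exact hcΓ.imp (fun hb => Finset.mem_filter.2 ⟨hc, hb⟩) fun hb => Finset.mem_filter.2 ⟨hc, hb⟩
    have hTH := fun x : disc => Φ.dampedOp_apply (p := p) (S := S) ω a
      (contDiff_dampingFactor (σ := σ) (τ := τ) (Γ₁ := Γ₁) (Γ₂ := Γ₂) h) hH x
    have hTre : ∀ x : disc, ((op (Γ₁, Γ₂) H).1 x).re = ∑ J ∈ words S N ω,
        dampingFactor J₁ J₂ σ τ Γ₁ Γ₂ J x *
          Φ.branchAmp (wordWeight p S ω J) a (List.ofFn J) H x := by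
      intro x
      simp only [hop]
      rw [hTH x, Complex.ofReal_re]
    refine ⟨op (Γ₁, Γ₂), ⟨(Γ₁, Γ₂), ⟨Finset.mem_product.2 ⟨Finset.mem_powerset.2
      (Finset.filter_subset _ _), Finset.mem_powerset.2 (Finset.filter_subset _ _)⟩, hdense'⟩,
      rfl⟩, fun x => ?_, fun x => ?_⟩
    · rw [hTre x]
      have h1 := Φ.norm_sum_branchTerm_le hp h hJ₁ hJ₂ hH hf hσ hτ0 hττ'
        (Γ₁ := Γ₁) (Γ₂ := Γ₂) (fun c hc => (Finset.mem_filter.1 hc).2)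
        (fun c hc => (Finset.mem_filter.1 hc).2) x.2
      have h2 : (Φ.transfer p S (a + b * Complex.I) ℓ ω N f).1 x = ∑ J ∈ words S N ω,
          Φ.branchTerm (wordWeight p S ω J) (a + b * Complex.I) ℓ (List.ofFn J) f x :=
        Φ.transferFun_eq p S _ ℓ ω N f.1 x
      rw [h2]
      exact h1
    · rw [transfer_eq_weightedOp]
      have h1 := gradNorm_weightedOp_le_of_bounds (words S N ω)
        (fun J => Φ.contDiffOn_const_mul_cocycleWeight (wordWeight p S ω J)
          (a + b * Complex.I) ℓ (List.ofFn J))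
        (fun J => Φ.contDiffOn_word (List.ofFn J)) (fun J => Φ.word_mapsTo (List.ofFn J)) (g := f)
        (h := fun z => (ext H.1 z).re) (M := M) (θ := Φ.rate ^ N)
        (E := (2 * Real.pi * ‖(a + b * Complex.I : ℂ)‖ + |(ℓ : ℝ)|) * Ct)
        (fun z hz => by rw [ext_of_mem _ hz, ext_of_mem _ hz]; exact hf _)
        (fun z hz => by rw [ext_of_mem _ hz]; exact hf' ⟨z, hz⟩) x
        (fun J => by
          have h2 := (((Φ.contDiffOn_cocycleWeight (a + b * Complex.I) ℓ
            (List.ofFn J)).differentiableOn one_ne_zero x x.2).hasFDerivWithinAt.const_mul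
            (wordWeight p S ω J : ℂ)).fderivWithin (uniqueDiffOn_disc x x.2)
          have h3 := Φ.norm_fderivWithin_cocycleWeight_le hCt (a + b * Complex.I) ℓ
            (List.ofFn J) x.2
          rw [h2, norm_smul, norm_mul, mul_left_comm]
          exact mul_le_mul_of_nonneg_left h3 (norm_nonneg _))
        (fun J _ => by simpa using Φ.norm_fderivWithin_word_le (List.ofFn J) x.2)
      refine h1.trans ?_
      rw [hTre x]
      -- The gradient estimate involves undamped amplitudes. Damping by at most one half costs a
      -- factor 2, which `hdom` absorbs.
      have h4 : ∑ J ∈ words S N ω, ‖(wordWeight p S ω J : ℂ) *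
          Φ.cocycleWeight (a + b * Complex.I) ℓ (List.ofFn J) x‖ *
          (ext H.1 (Φ.word (List.ofFn J) x)).re ≤ 2 * ∑ J ∈ words S N ω,
          dampingFactor J₁ J₂ σ τ Γ₁ Γ₂ J x *
            Φ.branchAmp (wordWeight p S ω J) a (List.ofFn J) H x := by
        rw [Finset.mul_sum]
        refine Finset.sum_le_sum fun J hJ => ?_
        have h5 := (Φ.branchAmp_pos hH (hwpos J hJ) a (List.ofFn J) x.2).le
        rw [norm_mul, norm_cocycleWeight, Complex.norm_real, Real.norm_of_nonneg (hwpos J hJ).le]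
        change Φ.branchAmp (wordWeight p S ω J) a (List.ofFn J) H x ≤ _
        nlinarith [hhalf (Γ₁, Γ₂) J x]
      have h6 : 0 ≤ ∑ J ∈ words S N ω, dampingFactor J₁ J₂ σ τ Γ₁ Γ₂ J x *
          Φ.branchAmp (wordWeight p S ω J) a (List.ofFn J) H x :=
        (Φ.sum_branchAmp_pos hp hS ω a x.2 (fun J => hhalf (Γ₁, Γ₂) J x) hH).le
      have hCt0 : 0 ≤ Ct := (norm_nonneg _).trans (hCt [] 0 zero_mem_disc)
      have hr0 := Φ.rate_nonneg
      have h7 : 0 ≤ (2 * Real.pi * ‖(a + b * Complex.I : ℂ)‖ + |(ℓ : ℝ)|) * Ct +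
          Φ.rate ^ N * M := by
        have := Real.pi_pos
        positivity
      refine (mul_le_mul_of_nonneg_left h4 h7).trans ?_
      calc _ = 2 * ((2 * Real.pi * ‖(a + b * Complex.I : ℂ)‖ + |(ℓ : ℝ)|) * Ct +
          Φ.rate ^ N * M) * ∑ J ∈ words S N ω, dampingFactor J₁ J₂ σ τ Γ₁ Γ₂ J x *
            Φ.branchAmp (wordWeight p S ω J) a (List.ofFn J) H x := by ring
        _ ≤ _ := mul_le_mul_of_nonneg_right hdom h6

end DiscIFS

/-! ### Choice of the constants -/

namespace DiscIFS

variable {n : ℕ} {Φ : DiscIFS n} {e : Fin 4 ↪ Fin n} {S : Fin n → Finset (Fin n)}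

/-- All cases of the model in one form: every sub-system is maximal and retains one of the two pairs
from (UNI). -/
theorem IsModelFamily.exists_isMaxDisjoint (h : Φ.IsModelFamily e S) (k : Fin n) :
    ∃ Ψ, Φ.IsMaxDisjoint Ψ (S k) ∧ (({e 0, e 1} : Finset (Fin n)) ⊆ Ψ ∨ {e 2, e 3} ⊆ Ψ) := by
  obtain ⟨h0, h1, h2, h3, h4⟩ := h
  by_cases hk : k ∈ Set.range e
  · obtain ⟨i, rfl⟩ := hk
    fin_cases i
    · exact ⟨_, h0, Or.inl subset_rfl⟩
    · exact ⟨_, h1, Or.inl subset_rfl⟩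
    · exact ⟨_, h2, Or.inr subset_rfl⟩
    · exact ⟨_, h3, Or.inr subset_rfl⟩
  · rcases h4 k hk with h | h
    · exact ⟨_, h, Or.inl (by intro x; simp; tauto)⟩
    · exact ⟨_, h, Or.inr (by intro x; simp; tauto)⟩

theorem IsModelFamily.isDense (h : Φ.IsModelFamily e S) (k : Fin n) : Φ.IsDense (S k) := by
  obtain ⟨Ψ, hΨ, -⟩ := h.exists_isMaxDisjoint k
  exact hΨ.exists_inter

theorem IsModelFamily.nonempty (h : Φ.IsModelFamily e S) (k : Fin n) : (S k).Nonempty := by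
  obtain ⟨i, hi, -⟩ := h.isDense k k
  exact ⟨i, hi⟩

/-- Every sub-system of the model contains a pair of maps with the non-integrability property. -/
theorem IsModelFamily.exists_uniPair (h : Φ.IsModelFamily e S) {m m' : ℝ}
    (h₁ : Φ.UNIPair (e 0) (e 1) m m') (h₂ : Φ.UNIPair (e 2) (e 3) m m') (k : Fin n) :
    ∃ i ∈ S k, ∃ j ∈ S k, i ≠ j ∧ Φ.UNIPair i j m m' := by
  obtain ⟨Ψ, hΨ, hsub⟩ := h.exists_isMaxDisjoint k
  rcases hsub with hsub | hsub
  · exact ⟨e 0, hΨ.1 (hsub (by simp)), e 1, hΨ.1 (hsub (by simp)),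
      e.injective.ne (by decide), h₁⟩
  · exact ⟨e 2, hΨ.1 (hsub (by simp)), e 3, hΨ.1 (hsub (by simp)),
      e.injective.ne (by decide), h₂⟩

variable {p : Fin n → ℝ}

set_option maxHeartbeats 4000000 in
/-- The main estimate, for a system that contracts strongly with respect to the non-concentration
constant of its attractor. -/
theorem exists_dolgopyat_constants {K : Set ℂ} (hatt : Φ.IsAttractor K)
    (hp : ∀ i, 0 < p i) (hmod : Φ.IsModelFamily e S) (huni : Φ.UNI e)
    {L κ : ℝ} (hL : Φ.HasDistortion L) (hκ0 : 0 < κ)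
    (hκ : ∀ g : ℂ → ℂ, AnalyticOnNhd ℂ g disc → deriv g 0 ≠ 0 →
      (∀ x ∈ disc, ∀ y ∈ disc, ‖deriv g x‖ ≤ L * ‖deriv g y‖) → ∀ w : ℂ, ‖w‖ = 1 →
      ∃ x ∈ K, ∃ y ∈ K, κ * ‖deriv g 0‖ ≤ |(w * (g y - g x)).re|)
    (hrate : 16 * L * Φ.rate ≤ κ) :
    ∃ (N : ℕ) (A α : ℝ), 0 < N ∧ 1 < A ∧ 0 < α ∧ α < 1 ∧
    ∃ ε R : ℝ, 0 < ε ∧ 0 < R ∧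
    ∀ (a b : ℝ) (ℓ : ℤ), |a| < ε → R < |b| + |(ℓ : ℝ)| →
    ∀ ω : ℕ → Fin n,
    ∃ 𝒩 : Set (C1D →ₗ[ℂ] C1D), 𝒩.Finite ∧ (∀ T ∈ 𝒩, IsBoundedOp T) ∧
      (∀ T ∈ 𝒩, ∀ H ∈ cone (A * (|b| + |(ℓ : ℝ)|)), T H ∈ cone (A * (|b| + |(ℓ : ℝ)|))) ∧
      (∀ T ∈ 𝒩, ∀ H ∈ cone (A * (|b| + |(ℓ : ℝ)|)),
        ∫ z, ‖ext (T H).1 z‖ ^ 2 ∂(Φ.randomMeasure p S (shift N ω)) ≤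
          α * ∫ z, (ext (Φ.transferFun p S 0 0 ω N fun x => ((‖H.1 x‖ ^ 2 : ℝ) : ℂ)) z).re
            ∂(Φ.randomMeasure p S (shift N ω))) ∧
      (∀ H ∈ cone (A * (|b| + |(ℓ : ℝ)|)), ∀ f : C1D,
        (∀ x, ‖f.1 x‖ ≤ (H.1 x).re) →
        (∀ x, gradNorm f.1 x ≤ A * (|b| + |(ℓ : ℝ)|) * (H.1 x).re) →
        ∃ T ∈ 𝒩,
          (∀ x, ‖(Φ.transfer p S (a + b * Complex.I) ℓ ω N f).1 x‖ ≤ ((T H).1 x).re) ∧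
          ∀ x, gradNorm (Φ.transfer p S (a + b * Complex.I) ℓ ω N f).1 x ≤
            A * (|b| + |(ℓ : ℝ)|) * ((T H).1 x).re) := by
  obtain ⟨Ct, m, m', -, hCt', hu₁, hu₂, hm₀⟩ := huni
  have hCt : ∀ η : List (Fin n), ∀ x ∈ disc, ‖deriv (Φ.wordLog η) x‖ ≤ Ct := fun η x hx => by
    rw [← Φ.norm_fderiv_log_norm_deriv_word η hx]
    exact hCt' η x hx
  have hCt0 : 0 ≤ Ct := (norm_nonneg _).trans (hCt [] 0 zero_mem_disc)
  have hS := hmod.nonempty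
  have hL1 := Φ.one_le_of_hasDistortion hL
  have hL0 : 0 < L := one_pos.trans_le hL1
  obtain ⟨w₀, hw₀, hw₀1, hw⟩ := exists_le_branchWeight (S := S) hp
  obtain ⟨κ₁, hκ₁0, hκ₁⟩ := Φ.exists_le_norm_deriv_map
  obtain ⟨Cb, hCb0, hCb⟩ := exists_bound_fderiv_bump
  set m₀ := m - 2 * Ct * Φ.rate
  set lam := κ₁ / L with hlam
  have hlam0 : 0 < lam := div_pos hκ₁0 hL0
  -- The term 56·Ct serves the gradient bound for the transfer operator, 2(14·Ct·B + AB/4) ≤ AB; the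
  -- term 2 leaves room in the cone condition for the gradient of the damping.
  set A : ℝ := 56 * Ct + 2 with hA
  have hA0 : 0 < A := by positivity
  -- the scale of the cylinders is `δ₁ / B`
  obtain ⟨δ₁, hδ₁0, hδ₁⟩ : ∃ δ₁ : ℝ, 0 < δ₁ ∧ 56 * (Ct + 1) * L * δ₁ = 1 :=
    ⟨(56 * (Ct + 1) * L)⁻¹, by positivity, mul_inv_cancel₀ (by positivity)⟩
  have hδ₁1 : L * δ₁ ≤ 1 / 56 := by nlinarith [mul_pos hL0 hδ₁0]
  have hδ₁1' : δ₁ ≤ 1 := by nlinarith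
  -- the bumps have size `s₁ δ₁ / B`
  obtain ⟨s₁, hs₁0, hs₁κ, hs₁L⟩ : ∃ s₁ : ℝ, 0 < s₁ ∧ 32 * s₁ ≤ κ * lam ∧ 8 * s₁ ≤ L := by
    refine ⟨min (κ * lam / 32) (L / 8), lt_min (by positivity) (by positivity), ?_, ?_⟩
    · linarith [min_le_left (κ * lam / 32) (L / 8)]
    · linarith [min_le_right (κ * lam / 32) (L / 8)]
  obtain ⟨t₀, ht₀⟩ : ∃ t₀ : ℕ, L * Φ.rate ^ t₀ ≤ s₁ := by
    obtain ⟨t₀, ht₀⟩ := exists_pow_lt_of_lt_one (div_pos hs₁0 hL0) Φ.rate_lt_one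
    refine ⟨t₀, ?_⟩
    rw [lt_div_iff₀ hL0] at ht₀
    linarith
  -- The right side of the gap condition is at least 2g₀, independently of B because Br = δ₁. Of
  -- this, 64δ takes g₀/2 and the variation of f/H at most g₀/2 once N is large.
  set g₀ := m₀ * (κ * lam) * δ₁ / 4 with hg₀
  have hg₀0 : 0 < g₀ := by positivity
  set δ := g₀ / 128 with hδ
  have hδ0 : 0 < δ := by positivity
  obtain ⟨N', hN'1, hN'2, hN'3⟩ : ∃ N' : ℕ, Φ.rate ^ N' ≤ 1 / 4 ∧
      8 * (A * δ₁ * L * Φ.rate ^ N') ≤ 1 ∧ 1024 * (A * δ₁ * L * Φ.rate ^ N') ≤ g₀ := by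
    have hq : 0 < A * δ₁ * L := by positivity
    obtain ⟨N', hN'⟩ := exists_pow_lt_of_lt_one (y := Φ.rate)
      (lt_min (show (0 : ℝ) < 1 / 4 by norm_num) (lt_min (show 0 < 1 / (8 * (A * δ₁ * L)) by
        positivity) (show 0 < g₀ / (1024 * (A * δ₁ * L)) by positivity))) Φ.rate_lt_one
    refine ⟨N', (hN'.trans_le (min_le_left _ _)).le, ?_, ?_⟩
    · have h1 := (hN'.trans_le ((min_le_right _ _).trans (min_le_left _ _))).le
      rw [le_div_iff₀ (by positivity)] at h1
      linarith
    · have h1 := (hN'.trans_le ((min_le_right _ _).trans (min_le_right _ _))).le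
      rw [le_div_iff₀ (by positivity)] at h1
      linarith
  -- N' is the length of the common prefix; the distinguishing last letter has index N', so it is
  -- selected by ω N'.
  set N := N' + 1 with hN
  set θ := Φ.rate ^ N with hθ
  have hθ0 : 0 ≤ θ := pow_nonneg Φ.rate_nonneg N
  have hθN' : θ ≤ Φ.rate ^ N' :=
    pow_le_pow_of_le_one Φ.rate_nonneg Φ.rate_lt_one.le (Nat.le_succ N')
  have hθ1 : θ ≤ 1 / 4 := hθN'.trans hN'1
  have hθ2 : 8 * (A * δ₁ * L * θ) ≤ 1 := le_trans (by gcongr) hN'2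
  have hθ3 : 1024 * (A * δ₁ * L * θ) ≤ g₀ := le_trans (by gcongr) hN'3
  -- These constants depend on N and may be large: C is compensated by taking R large, and C' by
  -- taking ε small.
  obtain ⟨C, hC0, hC'⟩ := Φ.exists_lipschitz_deriv_wordLog {η | η.length = N}
    (List.finite_length_eq (Fin n) N)
  obtain ⟨C', hC'0, hCb'⟩ := Φ.exists_bound_wordLog {η | η.length = N}
    (List.finite_length_eq (Fin n) N)
  -- the strength of the damping
  obtain ⟨τ', hτ'0, hτ'1, hτ'δ⟩ : ∃ τ' : ℝ, 0 < τ' ∧ 4 * τ' ≤ 1 ∧ 8 * τ' ≤ δ ^ 2 := by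
    refine ⟨min (1 / 4) (δ ^ 2 / 8), lt_min (by norm_num) (by positivity), ?_, ?_⟩
    · linarith [min_le_left (1 / 4) (δ ^ 2 / 8)]
    · linarith [min_le_right (1 / 4) (δ ^ 2 / 8)]
  -- The factor 98 = 2·49 accounts for overlapping bumps. The second condition makes the damping
  -- contribute at most B/4 in the cone condition: 98τCb/(s₁r) ≤ B/4, where Br = δ₁.
  obtain ⟨τ, hτ0, hττ', hτC⟩ : ∃ τ : ℝ, 0 < τ ∧ 98 * τ ≤ τ' ∧ 392 * (τ * Cb) ≤ s₁ * δ₁ := by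
    refine ⟨min (τ' / 98) (s₁ * δ₁ / (392 * (Cb + 1))), lt_min (by positivity) (by positivity),
      ?_, ?_⟩
    · linarith [min_le_left (τ' / 98) (s₁ * δ₁ / (392 * (Cb + 1)))]
    · have h1 := min_le_right (τ' / 98) (s₁ * δ₁ / (392 * (Cb + 1)))
      rw [le_div_iff₀ (by positivity)] at h1
      have h2 : 0 < min (τ' / 98) (s₁ * δ₁ / (392 * (Cb + 1))) :=
        lt_min (by positivity) (by positivity)
      linarith
  set γ := w₀ ^ (1 + t₀) * (τ * w₀ ^ N) / 4 with hγ
  have hγ0 : 0 < γ := by positivity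
  have hγ1 : γ < 1 := by
    have h1 : w₀ ^ (1 + t₀) ≤ 1 := pow_le_one₀ hw₀.le hw₀1
    have h2 : w₀ ^ N ≤ 1 := pow_le_one₀ hw₀.le hw₀1
    have h3 : τ * w₀ ^ N ≤ 1 * 1 := by
      gcongr
      linarith
    have h4 : w₀ ^ (1 + t₀) * (τ * w₀ ^ N) ≤ 1 * (1 * 1) := by gcongr
    rw [hγ]
    linarith
  -- The first bound gives 2π|a|Ct ≤ 1/2. The second gives e^{4π|a|C'} ≤ 1 + γ/2, and (1 + γ/2)(1 -
  -- γ) ≤ 1 - γ/2, the value taken for α.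
  set ε := min (1 / (14 * (Ct + 1))) (Real.log (1 + γ / 2) / (4 * Real.pi * (C' + 1))) with hε
  have hlog0 : 0 < Real.log (1 + γ / 2) := Real.log_pos (by linarith)
  have hπ := Real.pi_pos
  -- For B > R the cylinders of size δ₁/B are so small that the second-order error in the relative
  -- phase is negligible.
  set R : ℝ := 1 + 128 * (C * L * (L * δ₁)) / (m₀ * (κ * lam)) with hR
  have hR1 : 1 ≤ R := by
    have : 0 ≤ 128 * (C * L * (L * δ₁)) / (m₀ * (κ * lam)) := by positivity
    linarith
  refine ⟨N, A, 1 - γ / 2, Nat.succ_pos _, by linarith, by linarith, by linarith, ε, R,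
    lt_min (by positivity) (by positivity), by linarith, fun a b ℓ ha hB ω => ?_⟩
  set B := |b| + |(ℓ : ℝ)| with hBdef
  have hB1 : 1 ≤ B := hR1.trans hB.le
  have hB0 : 0 < B := by linarith
  obtain ⟨i, hi, j, hj, hij, hupair⟩ := hmod.exists_uniPair hu₁ hu₂ (ω N')
  obtain ⟨ξ, hξ⟩ := exists_words_snoc hS N' ω
  obtain ⟨J₁, hJ₁, hJ₁'⟩ := hξ i hi
  obtain ⟨J₂, hJ₂, hJ₂'⟩ := hξ j hj
  have hne : J₁ ≠ J₂ := by
    rintro rfl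
    rw [hJ₁'] at hJ₂'
    simp only [List.append_cancel_left_eq, List.cons.injEq, and_true] at hJ₂'
    exact hij hJ₂'
  have haCt : 14 * (|a| * (Ct + 1)) ≤ 1 := by
    have h1 := (ha.trans_le (min_le_left _ _)).le
    rw [le_div_iff₀ (by positivity)] at h1
    linarith
  have ha0 := abs_nonneg a
  have haCt0 : 0 ≤ |a| * Ct := mul_nonneg ha0 hCt0
  have ha2 : 2 * Real.pi * |a| * Ct ≤ 1 / 2 := by
    have h1 : 2 * Real.pi ≤ 7 := by linarith [Real.pi_lt_d2]
    have h2 : 2 * Real.pi * (|a| * Ct) ≤ 7 * (|a| * Ct) := by gcongr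
    linarith
  set r := δ₁ / B with hr
  have hr0 : 0 < r := div_pos hδ₁0 hB0
  have hrB : B * r = δ₁ := mul_div_cancel₀ _ hB0.ne'
  have hr1 : r ≤ δ₁ := div_le_self hδ₁0.le hB1
  have hζ1 := norm_frequency_le b ℓ
  have hζ2 := le_norm_frequency b ℓ
  have hMr : ∀ t : ℝ, A * B * θ * (t * r) = A * δ₁ * θ * t := fun t => by rw [← hrB]; ring
  refine Φ.exists_dolgopyat_operators hatt hp hS hmod.isDense hw₀ hw hL hκ0 hκ hrate hκ₁0 hκ₁ hCt
    hne hJ₁ hJ₂ hm₀ (fun x hx => ?_) hC0 hC' hCb' hCb0 hCb (M := A * B) (by positivity) hr0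
    (hr1.trans hδ₁1') (σ := s₁ * r) (by positivity) hτ0.le hττ' hτ'1 hτ'δ hδ0.le ?_ ?_ ?_ ?_ ?_ ?_
    ?_ (t₀ := t₀) ?_ ?_ ?_ ?_
  · rw [hJ₁', hJ₂']
    exact Φ.le_norm_deriv_wordLog_sub hCt hupair ξ hx
  · have h1 : A * B * θ * (6 * (s₁ * r)) = 6 * (A * δ₁ * θ * s₁) := by
      rw [← hMr]; ring
    have h2 : A * δ₁ * θ * (8 * s₁) ≤ A * δ₁ * θ * L := by gcongr
    have h3 : s₁ * r ≤ 1 / 448 := by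
      have : 8 * s₁ * r ≤ L * δ₁ := by gcongr
      linarith
    have h4 : 2 * Real.pi * |a| * Ct * (6 * (s₁ * r)) ≤ 1 / 2 * (6 * (1 / 448)) := by gcongr
    rw [add_mul, h1]
    linarith
  · have h1 : A * B * θ * (2 * L * r) = A * δ₁ * θ * (2 * L) := hMr _
    rw [h1]
    linarith
  · rw [← mul_assoc]
    exact mul_le_mul_of_nonneg_right hs₁κ hr0.le
  · rw [← mul_assoc]
    exact mul_le_mul_of_nonneg_right hs₁L hr0.le
  · have h1 : 128 * (C * L * (L * δ₁)) / (m₀ * (κ * lam)) ≤ B := by linarith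
    rw [div_le_iff₀ (by positivity)] at h1
    have h2 : B * (128 * (C * L * (L * r))) ≤ B * (m₀ * (κ * lam)) := by
      calc _ = 128 * (C * L * (L * δ₁)) := by rw [← hrB]; ring
        _ ≤ _ := h1
    exact le_of_mul_le_mul_left h2 hB0
  · calc _ ≤ 7 * B * (8 * (Ct * (L * r))) := by gcongr
      _ = 56 * Ct * L * δ₁ := by rw [← hrB]; ring
      _ ≤ 1 := by linarith [mul_pos hL0 hδ₁0]
  · have h1 : B / 2 * (m₀ * (κ * lam) * r) = 2 * g₀ := by rw [hg₀, ← hrB]; ring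
    have h2 : B / 2 * (m₀ * (κ * lam) * r) ≤ ‖frequency b ℓ‖ * (m₀ * (κ * lam) * r) := by gcongr
    rw [h1] at h2
    refine lt_of_lt_of_le ?_ h2
    rw [hMr L]
    linarith
  · calc L * r * Φ.rate ^ t₀ = L * Φ.rate ^ t₀ * r := by ring
      _ ≤ _ := by gcongr
  · have h1 : 2 * (τ * (49 * (Cb / (s₁ * r)))) ≤ B / 4 := by
      have h2 : 2 * (τ * (49 * (Cb / (s₁ * r)))) = 98 * (τ * Cb) / (s₁ * r) := by ring
      rw [h2, div_le_iff₀ (by positivity)]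
      have h3 : B / 4 * (s₁ * r) = s₁ * δ₁ / 4 := by rw [← hrB]; ring
      rw [h3]
      linarith
    have h4 : θ * (A * B) ≤ 1 / 4 * (A * B) := by gcongr
    have h5 : 2 * B ≤ A * B := by
      gcongr
      linarith
    linarith
  · have h1 : ‖(a + b * Complex.I : ℂ)‖ ≤ |a| + |b| := by
      refine (norm_add_le _ _).trans (le_of_eq ?_)
      simp
    have h2 : 2 * Real.pi ≤ 7 := by linarith [Real.pi_lt_d2]
    have h3 : 2 * Real.pi * ‖(a + b * Complex.I : ℂ)‖ ≤ 7 * (|a| + |b|) := by gcongr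
    have h4 : 2 * Real.pi * ‖(a + b * Complex.I : ℂ)‖ + |(ℓ : ℝ)| ≤ 14 * B := by
      rw [hBdef]
      rw [hBdef] at hB1
      linarith [abs_nonneg b, abs_nonneg (ℓ : ℝ)]
    have h5 : (2 * Real.pi * ‖(a + b * Complex.I : ℂ)‖ + |(ℓ : ℝ)|) * Ct ≤ 14 * B * Ct := by gcongr
    have h6 : θ * (A * B) ≤ 1 / 4 * (A * B) := by gcongr
    have h7 : 56 * Ct * B ≤ A * B := by
      gcongr
      linarith
    linarith
  · have h1 := (ha.trans_le (min_le_right _ _)).le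
    rw [le_div_iff₀ (by positivity)] at h1
    have h2 : 4 * Real.pi * |a| * C' ≤ Real.log (1 + γ / 2) := by
      have : 0 ≤ 4 * Real.pi * |a| := by positivity
      linarith
    have h3 : Real.exp (4 * Real.pi * |a| * C') ≤ 1 + γ / 2 := by
      rw [← Real.exp_log (show 0 < 1 + γ / 2 by linarith)]
      exact Real.exp_le_exp.2 h2
    have h4 : Real.exp (4 * Real.pi * |a| * C') * (1 - γ) ≤ (1 + γ / 2) * (1 - γ) :=
      mul_le_mul_of_nonneg_right h3 (by linarith)
    refine h4.trans ?_
    linarith [sq_nonneg γ]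

end DiscIFS

end Dolgopyat

end

/-! ### The threshold for the contraction rate -/

open Dolgopyat in
theorem lemma2p4 (K : Set ℂ) (hK : ¬ InAnalyticCurve K) (L : ℝ) :
    ∃ ρ₀ : ℝ, 0 < ρ₀ ∧
      ∀ (n : ℕ) (Φ : DiscIFS n) (e : Fin 4 ↪ Fin n) (p : Fin n → ℝ) (S : Fin n → Finset (Fin n)),
        Φ.IsAttractor K → Φ.HasDistortion L → Φ.rate < ρ₀ →
        Φ.Separated e → Φ.UNI e →
        (∀ i, 0 < p i) → ∑ i, p i = 1 → Φ.IsModelFamily e S →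
        ∃ (N : ℕ) (A α : ℝ), 0 < N ∧ 1 < A ∧ 0 < α ∧ α < 1 ∧
        ∃ ε R : ℝ, 0 < ε ∧ 0 < R ∧
        ∀ (a b : ℝ) (ℓ : ℤ), |a| < ε → R < |b| + |(ℓ : ℝ)| →
        ∀ ω : ℕ → Fin n,
        ∃ 𝒩 : Set (C1D →ₗ[ℂ] C1D), 𝒩.Finite ∧ (∀ T ∈ 𝒩, IsBoundedOp T) ∧
          (∀ T ∈ 𝒩, ∀ H ∈ cone (A * (|b| + |(ℓ : ℝ)|)), T H ∈ cone (A * (|b| + |(ℓ : ℝ)|))) ∧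
          (∀ T ∈ 𝒩, ∀ H ∈ cone (A * (|b| + |(ℓ : ℝ)|)),
            ∫ z, ‖ext (T H).1 z‖ ^ 2 ∂(Φ.randomMeasure p S (shift N ω)) ≤
              α * ∫ z, (ext (Φ.transferFun p S 0 0 ω N fun x => ((‖H.1 x‖ ^ 2 : ℝ) : ℂ)) z).re
                ∂(Φ.randomMeasure p S (shift N ω))) ∧
          (∀ H ∈ cone (A * (|b| + |(ℓ : ℝ)|)), ∀ f : C1D,
            (∀ x, ‖f.1 x‖ ≤ (H.1 x).re) →
            (∀ x, gradNorm f.1 x ≤ A * (|b| + |(ℓ : ℝ)|) * (H.1 x).re) →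
            ∃ T ∈ 𝒩,
              (∀ x, ‖(Φ.transfer p S (a + b * Complex.I) ℓ ω N f).1 x‖ ≤ ((T H).1 x).re) ∧
              ∀ x, gradNorm (Φ.transfer p S (a + b * Complex.I) ℓ ω N f).1 x ≤
                A * (|b| + |(ℓ : ℝ)|) * ((T H).1 x).re) := by
  -- If no system has attractor K and distortion constant L, nothing is to be proved. Otherwise any
  -- one of them supplies the self-similarity used to obtain κ; the property defining κ refers to K
  -- and L only, so ρ₀ = κ/(16L) serves all systems.
  by_cases hex : ∃ (n : ℕ) (Φ : DiscIFS n), Φ.IsAttractor K ∧ Φ.HasDistortion L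
  · obtain ⟨n₀, Φ₀, hatt₀, hL₀⟩ := hex
    have hL1 := Φ₀.one_le_of_hasDistortion hL₀
    obtain ⟨κ, hκ0, hκ⟩ := hatt₀.exists_nonconcentration hK hL1
    refine ⟨κ / (16 * L), by positivity, fun n Φ e p S hatt hL hrate _ huni hp _ hmod => ?_⟩
    rw [lt_div_iff₀ (by positivity)] at hrate
    exact DiscIFS.exists_dolgopyat_constants hatt hp hmod huni hL hκ0 hκ (by linarith)
  · exact ⟨1, one_pos, fun n Φ e p S hatt hL => absurd ⟨n, Φ, hatt, hL⟩ hex⟩
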